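/- Let $R$ be a finite commutative local ring of odd characteristic whose maximal ideal is principal, generated by $\gamma\in R$ with $\gamma\neq 0$ and $\gamma^2=0$ (a chain ring $\mathtt R_2$ of nilpotency index $2$), and let $K=R/\langle\gamma\rangle$ (so $K=\mathtt R_1$ is also the residue field), $q=|K|$. Let $N_1,N_2$ be non-negative integers. An $\mathtt R_2\mathtt R_1$-linear code of block-length $(N_1,N_2)$ is an $R$-submodule $\mathscr C$ of $R^{N_1}\oplus K^{N_2}$. It is Euclidean self-orthogonal if $\sum_{i}c_ic'_i+\gamma\sum_j d_jd'_j=0$ in $R$ for all $(c\,|\,d),(c'\,|\,d')\in\mathscr C$, where $\gamma\cdot\overline{a}:=\gamma a$ for $\overline a\in K$. For linear codes over $K$, $\perp_E$ is the dual for the standard dot product. A code $\mathscr C$ has type $\{k_0,k_1;\ell_0\}$ if, after a permutation of the first $N_1$ and a permutation of the last $N_2$ coordinates, it is generated by the rows of a matrix $$\left[\begin{array}{ccc|cc} I_{k_0}&A_{0,1}&A_{0,2}&0&B_{0,1}\\ 0&\gamma I_{k_1}&\gamma A_{1,2}&0&0\\ 0&0&\gamma C_{0,2}&I_{\ell_0}&D_{0,1}\end{array}\right].$$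 Let $\mathscr C^{(X)}\subseteq R^{N_1}$ be the $R$-module generated by the rows of $[I_{k_0}\ A_{0,1}\ A_{0,2}]$ and $[0\ \gamma I_{k_1}\ \gamma A_{1,2}]$, and $\mathscr C^{(Y)}\subseteq K^{N_2}$ the $K$-space generated by the rows of $[I_{\ell_0}\ D_{0,1}]$ (columns put back in their original order). Put $Tor_i(\mathscr C^{(X)})=\{\overline c\in K^{N_1}:\ c\in R^{N_1},\ \gamma^{i-1}c\in\mathscr C^{(X)}\}$ for $i=1,2$, and $Tor_1(\mathscr C^{(Y)})=\mathscr C^{(Y)}$. For a finite field with $q$ elements, $q$ odd, let $\sigma_q(n,0)=1$, $\sigma_q(n,s)=0$ for $s>\lfloor n/2\rfloor$, and for $1\le s\le\lfloor n/2\rfloor$ $$\sigma_q(n,s)=\begin{cases}\dfrac{\prod_{i=0}^{s-1}(q^{n-1-2i}-1)}{\prod_{j=1}^{s}(q^j-1)}& n\text{ odd},\\[3mm] \dfrac{(q^{n-s}-\nu q^{n/2-s}+\nu q^{n/2}-1)\prod_{i=1}^{s-1}(q^{n-2i}-1)}{\prod_{j=1}^{s}(q^j-1)}& n\text{ even},\end{cases}$$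 where $\nu=1$ if $(-1)^{n/2}$ is a square in $\mathbb F_q$ and $\nu=-1$ otherwise. Let ${n\brack s}_q=\prod_{i=0}^{s-1}\frac{q^n-q^i}{q^s-q^i}$ and $$\Theta_2(k_0,k_1;\ell_0)=k_0\left(N_1+N_2-\tfrac32k_0-k_1-\ell_0-\tfrac12\right)+\ell_0(N_1-2k_0-k_1).$$ 1. The number of Euclidean self-orthogonal $\mathtt R_2\mathtt R_1$-linear codes of block-length $(N_1,N_2)$ is $$\sum_{k_0=0}^{\lfloor N_1/2\rfloor}\ \sum_{k_1=0}^{N_1-2k_0}\ \sum_{\ell_0=0}^{\lfloor N_2/2\rfloor}\sigma_q(N_1,k_0)\,\sigma_q(N_2,\ell_0){N_1-2k_0\brack k_1}_q q^{\Theta_2(k_0,k_1;\ell_0)}.$$ 2. For all $k_0,k_1,\ell_0\ge 0$, the number of those of type $\{k_0,k_1;\ell_0\}$ is $\sigma_q(N_1,k_0)\,\sigma_q(N_2,\ell_0){N_1-2k_0\brack k_1}_q q^{\Theta_2(k_0,k_1;\ell_0)}$ if $2k_0+k_1\le N_1$ and $2\ell_0\le N_2$, and $0$ otherwise. 3. If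 $C_1\subseteq C_2\subseteq K^{N_1}$ and $C_3\subseteq K^{N_2}$ are linear codes over $K$ of dimensions $k_0$, $k_0+k_1$ and $\ell_0$ with $C_1\subseteq C_1^{\perp_E}$, $C_2\subseteq C_1^{\perp_E}$ and $C_3\subseteq C_3^{\perp_E}$, then there are precisely $q^{\Theta_2(k_0,k_1;\ell_0)}$ Euclidean self-orthogonal $\mathtt R_2\mathtt R_1$-linear codes $\mathscr C$ of block-length $(N_1,N_2)$ with $Tor_1(\mathscr C^{(X)})=C_1$, $Tor_2(\mathscr C^{(X)})=C_2$ and $Tor_1(\mathscr C^{(Y)})=C_3$. 4. Let $p$ be an odd prime, $GR(p^2,r)=\mathbb Z_{p^2}[x]/\langle h(x)\rangle$ with $h$ monic of degree $r$ and irreducible modulo $p$, let $1\le t\le k$, and let $\mathcal R_2=GR(p^2,r)[y]/\langle g(y),p\,y^t\rangle$ with $g(y)=y^k+p(g_{k-1}y^{k-1}+\cdots+g_0)$, $g_i\in GR(p^2,r)$, $g_0$ a unit. Each $a\in\mathcal R_2$ is uniquely $\sum_{i=0}^{k-1}\sum_{s=0}^{r-1}a_{i,s}x^sy^i$ with $a_{i,s}\in\mathbb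 Z_{p^2}$ for $i<t$ and $a_{i,s}\in\mathbb Z_p$ for $i\ge t$. Let $\xi\in\mathbb C$ be a primitive $p^2$-th root of unity, $\chi_a(b)=\prod_s\left(\prod_{i<t}\xi^{a_{i,s}b_{i,s}}\prod_{t\le j<k}\xi^{p\,a_{j,s}b_{j,s}}\right)$ for $a,b\in\mathcal R_2$, and $\chi_{\mathbf u}(\mathbf v)=\prod_{l}\chi_{u_l}(v_l)$ for $\mathbf u,\mathbf v\in\mathcal R_2^N$, $N\ge0$. Then the number of additive subgroups $\mathcal C$ of $\mathcal R_2^N$ that are self-orthogonal, that is, $\chi_{\mathbf d}(\mathbf c)=1$ for all $\mathbf c,\mathbf d\in\mathcal C$, is $$\sum_{k_0=0}^{\lfloor Nrt/2\rfloor}\ \sum_{k_1=0}^{Nrt-2k_0}\ \sum_{\ell_0=0}^{\lfloor Nr(k-t)/2\rfloor}\sigma_p(Nrt,k_0)\,\sigma_p(Nr(k-t),\ell_0){Nrt-2k_0\brack k_1}_p p^{k_0\left(Nrk-\frac32k_0-k_1-\ell_0-\frac12\right)+\ell_0(Nrt-2k_0-k_1)}.$$ -/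

import Mathlib

open Polynomial

namespace MixedCodes

noncomputable section

/-! ### Counting functions -/

/-- The Gaussian binomial coefficient
`(q^n - 1)(q^n - q)⋯(q^n - q^(s-1)) / ((q^s - 1)(q^s - q)⋯(q^s - q^(s-1)))`. -/
def gaussBinom (q n s : ℕ) : ℝ :=
  (∏ i ∈ Finset.range s, ((q : ℝ) ^ n - (q : ℝ) ^ i)) /
    ∏ i ∈ Finset.range s, ((q : ℝ) ^ s - (q : ℝ) ^ i)

open Classical in
/-- The sign attached to even `n`: it is `1` if `(-1)^(n/2)` is a square in `K`, and `-1`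
otherwise. -/
def nu (K : Type*) [CommRing K] (n : ℕ) : ℝ :=
  if IsSquare ((-1 : K) ^ (n / 2)) then 1 else -1

/-- The number `σ_q(n, s)` for the finite field `K` with `q` elements, by its explicit formula. -/
def sigma (K : Type*) [CommRing K] (n s : ℕ) : ℝ :=
  let q : ℝ := (Nat.card K : ℝ)
  if s = 0 then 1
  else if n / 2 < s then 0
  else if Odd n then
    (∏ i ∈ Finset.range s, (q ^ (n - 1 - 2 * i) - 1)) / ∏ j ∈ Finset.Icc 1 s, (q ^ j - 1)
  else
    ((q ^ (n - s) - nu K n * q ^ (n / 2 - s) + nu K n * q ^ (n / 2) - 1) *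
      ∏ i ∈ Finset.Icc 1 (s - 1), (q ^ (n - 2 * i) - 1)) / ∏ j ∈ Finset.Icc 1 s, (q ^ j - 1)

/-- The exponent
`k₀(N₁ + N₂ - (3/2)k₀ - k₁ - ℓ₀ - 1/2) + ℓ₀(N₁ - 2k₀ - k₁)`, as a real number. -/
def Theta (N₁ N₂ k₀ k₁ l₀ : ℕ) : ℝ :=
  (k₀ : ℝ) * ((N₁ : ℝ) + N₂ - 3 / 2 * k₀ - k₁ - l₀ - 1 / 2) +
    (l₀ : ℝ) * ((N₁ : ℝ) - 2 * k₀ - k₁)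

/-! ### Codes over the residue field -/

/-- The Euclidean dual of a linear code over `K`, as a set of words. -/
def fieldDual {K : Type*} [CommRing K] {n : ℕ} (C : Submodule K (Fin n → K)) :
    Set (Fin n → K) :=
  {x | ∀ y ∈ C, ∑ i, x i * y i = 0}

/-! ### Linear codes over the mixed alphabet `R` and `R ⧸ ⟨γ⟩` -/

section Mixed

variable {R : Type*} [CommRing R]

/-- The chain ring of nilpotency index one below `R`; it is also the residue field. -/
abbrev Res (γ : R) : Type _ := R ⧸ Ideal.span {γ}

/-- The ambient module `R^N₁ ⊕ (R/⟨γ⟩)^N₂`. -/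
abbrev Ambient (γ : R) (N₁ N₂ : ℕ) : Type _ := (Fin N₁ → R) × (Fin N₂ → Res γ)

/-- Multiplication by `γ`, as a map from `R/⟨γ⟩` to `R`; it is well defined as `γ² = 0`. -/
def gammaMul (γ : R) (hγ : γ ^ 2 = 0) : Res γ →ₗ[R] R :=
  Submodule.liftQ (Ideal.span {γ}) (LinearMap.mulLeft R γ) (by
    intro x hx
    obtain ⟨a, rfl⟩ := Ideal.mem_span_singleton'.mp hx
    have : γ * (a * γ) = a * γ ^ 2 := by ring
    simp [this, hγ])

theorem gammaMul_mk (γ : R) (hγ : γ ^ 2 = 0) (x : R) :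
    gammaMul γ hγ (Ideal.Quotient.mk _ x) = γ * x := rfl

/-- The Euclidean bilinear form `∑ cᵢ c'ᵢ + γ ∑ dⱼ d'ⱼ`. -/
def eucForm (γ : R) (hγ : γ ^ 2 = 0) {N₁ N₂ : ℕ} (m m' : Ambient γ N₁ N₂) : R :=
  ∑ i, m.1 i * m'.1 i + gammaMul γ hγ (∑ j, m.2 j * m'.2 j)

/-- The Euclidean dual of a mixed-alphabet linear code, as a set of words. -/
def eucDual (γ : R) (hγ : γ ^ 2 = 0) {N₁ N₂ : ℕ} (C : Submodule R (Ambient γ N₁ N₂)) :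
    Set (Ambient γ N₁ N₂) :=
  {m | ∀ m' ∈ C, eucForm γ hγ m m' = 0}

/-- Euclidean self-orthogonality. -/
def IsSelfOrthogonal (γ : R) (hγ : γ ^ 2 = 0) {N₁ N₂ : ℕ}
    (C : Submodule R (Ambient γ N₁ N₂)) : Prop :=
  (C : Set (Ambient γ N₁ N₂)) ⊆ eucDual γ hγ C

/-- A generator matrix that is in standard form up to a permutation of the first `N₁` and a
permutation of the last `N₂` coordinates:
the rows are `[ I  A₀₁  A₀₂ | 0  B₀₁ ]`, `[ 0  γI  γA₁₂ | 0  0 ]` and `[ 0  0  γC₀₂ | I  D₀₁ ]`,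
with `k₀`, `k₁` and `l₀` rows. The equivalences `eX` and `eY` say which coordinate each column
of the standard form belongs to (and force `k₀ + k₁ + m = N₁` and `l₀ + n = N₂`). -/
structure StdGen (γ : R) (N₁ N₂ k₀ k₁ l₀ : ℕ) where
  m : ℕ
  n : ℕ
  eX : (Fin k₀ ⊕ Fin k₁) ⊕ Fin m ≃ Fin N₁
  eY : Fin l₀ ⊕ Fin n ≃ Fin N₂
  A₀₁ : Matrix (Fin k₀) (Fin k₁) R
  A₀₂ : Matrix (Fin k₀) (Fin m) R
  A₁₂ : Matrix (Fin k₁) (Fin m) R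
  B₀₁ : Matrix (Fin k₀) (Fin n) (Res γ)
  C₀₂ : Matrix (Fin l₀) (Fin m) R
  D₀₁ : Matrix (Fin l₀) (Fin n) (Res γ)

namespace StdGen

variable {γ : R} {N₁ N₂ k₀ k₁ l₀ : ℕ} (S : StdGen γ N₁ N₂ k₀ k₁ l₀)

/-- The block `A`, with rows `[ I  A₀₁  A₀₂ ]` and `[ 0  γI  γA₁₂ ]`. -/
def A : Matrix (Fin k₀ ⊕ Fin k₁) (Fin N₁) R :=
  (Matrix.fromCols (Matrix.fromBlocks 1 S.A₀₁ 0 (γ • (1 : Matrix (Fin k₁) (Fin k₁) R)))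
    (Matrix.fromRows S.A₀₂ (γ • S.A₁₂))).submatrix id S.eX.symm

/-- The block `B`, with rows `[ 0  B₀₁ ]` and `[ 0  0 ]`. -/
def B : Matrix (Fin k₀ ⊕ Fin k₁) (Fin N₂) (Res γ) :=
  (Matrix.fromBlocks 0 S.B₀₁ 0 0).submatrix id S.eY.symm

/-- The block `C`, with rows `[ 0  0  γC₀₂ ]`. -/
def C : Matrix (Fin l₀) (Fin N₁) R :=
  (Matrix.fromCols 0 (γ • S.C₀₂)).submatrix id S.eX.symm

/-- The block `D`, with rows `[ I  D₀₁ ]`. -/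
def D : Matrix (Fin l₀) (Fin N₂) (Res γ) :=
  (Matrix.fromCols 1 S.D₀₁).submatrix id S.eY.symm

/-- The code with generator matrix `[ A | B ; C | D ]`. -/
def code : Submodule R (Ambient γ N₁ N₂) :=
  Submodule.span R
    (Set.range (fun i => ((S.A i, S.B i) : Ambient γ N₁ N₂)) ∪
      Set.range (fun j => ((S.C j, S.D j) : Ambient γ N₁ N₂)))

/-- The linear code of length `N₁` over `R` generated by the rows of `A`. -/
def codeX : Submodule R (Fin N₁ → R) := Submodule.span R (Set.range S.A)

/-- The linear code of length `N₂` over `R/⟨γ⟩` generated by the rows of `D`. -/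
def codeY : Submodule (Res γ) (Fin N₂ → Res γ) := Submodule.span (Res γ) (Set.range S.D)

end StdGen

/-- The code `C` is of type `{k₀, k₁; l₀}`. -/
def HasType {γ : R} {N₁ N₂ : ℕ} (C : Submodule R (Ambient γ N₁ N₂)) (k₀ k₁ l₀ : ℕ) : Prop :=
  ∃ S : StdGen γ N₁ N₂ k₀ k₁ l₀, S.code = C

/-- The `i`-th torsion code (`i ≥ 1`) of a linear code `E` over `R`: the reductions modulo `γ` of
the words `c` with `γ^(i-1) c ∈ E`. -/
def torsion (γ : R) (i : ℕ) {n : ℕ} (E : Submodule R (Fin n → R)) : Set (Fin n → Res γ) :=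
  {x | ∃ c : Fin n → R, (∀ j, Ideal.Quotient.mk (Ideal.span {γ}) (c j) = x j) ∧
    γ ^ (i - 1) • c ∈ E}

/-- The torsion codes `Tor₁(C^(X))`, `Tor₂(C^(X))` and `Tor₁(C^(Y))` of `C` are `C₁`, `C₂` and
`C₃`. As `R/⟨γ⟩` is its own residue field, `Tor₁(C^(Y))` is just `C^(Y)`. -/
def HasTorsionCodes {γ : R} {N₁ N₂ : ℕ} (C : Submodule R (Ambient γ N₁ N₂))
    (C₁ C₂ : Submodule (Res γ) (Fin N₁ → Res γ)) (C₃ : Submodule (Res γ) (Fin N₂ → Res γ)) :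
    Prop :=
  ∃ (k₀ k₁ l₀ : ℕ) (S : StdGen γ N₁ N₂ k₀ k₁ l₀), S.code = C ∧
    torsion γ 1 S.codeX = (C₁ : Set (Fin N₁ → Res γ)) ∧
    torsion γ 2 S.codeX = (C₂ : Set (Fin N₁ → Res γ)) ∧ S.codeY = C₃

end Mixed

/-! ### Eisenstein extensions of Galois rings of characteristic `p²` -/

/-- Data of an Eisenstein extension with invariants `p, 2, r, k, t`: a monic basic irreducible
polynomial `h` of degree `r` over `ℤ/p²` (so that `GR(p², r) = (ℤ/p²)[x]/⟨h⟩`), and the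
coefficients `g₀, …, g_{k-1}` in `GR(p², r)`, with `g₀` a unit, of the Eisenstein polynomial
`y^k + p (g_{k-1} y^{k-1} + ⋯ + g₁ y + g₀)`. -/
structure EisensteinData (p r k t : ℕ) where
  h : (ZMod (p ^ 2))[X]
  monic : h.Monic
  natDegree_eq : h.natDegree = r
  irreducible : Irreducible (h.map (ZMod.castHom (dvd_pow_self p two_ne_zero) (ZMod p)))
  one_le_t : 1 ≤ t
  t_le_k : t ≤ k
  coeffs : Fin k → AdjoinRoot h
  isUnit_coeff_zero : IsUnit (coeffs ⟨0, lt_of_lt_of_le one_le_t t_le_k⟩)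

namespace EisensteinData

variable {p r k t : ℕ} (E : EisensteinData p r k t)

/-- The Galois ring `GR(p², r)`. -/
abbrev GR : Type := AdjoinRoot E.h

/-- The Eisenstein polynomial `g(y) = y^k + p (g_{k-1} y^{k-1} + ⋯ + g₀)`. -/
def g : (E.GR)[X] := X ^ k + C (p : E.GR) * ∑ i : Fin k, C (E.coeffs i) * X ^ (i : ℕ)

/-- The chain ring `GR(p², r)[y] / ⟨g(y), p y^t⟩`. -/
abbrev ChainRing : Type := (E.GR)[X] ⧸ Ideal.span {E.g, C (p : E.GR) * X ^ t}

/-- The class of `x`. -/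
def x : E.ChainRing := Ideal.Quotient.mk _ (C (AdjoinRoot.root E.h))

/-- The class of `y`. -/
def y : E.ChainRing := Ideal.Quotient.mk _ X

/-- The coordinate module `(ℤ/p²)^{rt} ⊕ (ℤ/p)^{r(k-t)}`, with coordinates indexed by pairs. -/
abbrev Coord (p r k t : ℕ) : Type :=
  (Fin t × Fin r → ZMod (p ^ 2)) × (Fin (k - t) × Fin r → ZMod p)

/-- The element `a₀ + a₁ y + ⋯ + a_{k-1} y^{k-1}` with `aᵢ = ∑ₛ a_{i,s} x^s`, where the `a_{i,s}`
are in `ℤ/p²` for `i < t` and in `ℤ/p` for `t ≤ i < k`. -/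
def expand (u : Coord p r k t) : E.ChainRing :=
  ∑ i : Fin t, ∑ s : Fin r, ((u.1 (i, s)).val : E.ChainRing) * E.x ^ (s : ℕ) * E.y ^ (i : ℕ) +
    ∑ j : Fin (k - t), ∑ s : Fin r,
      ((u.2 (j, s)).val : E.ChainRing) * E.x ^ (s : ℕ) * E.y ^ (t + (j : ℕ))

theorem natCast_p_mul_p : (p : E.GR) * (p : E.GR) = 0 := by
  have h : ((p ^ 2 : ℕ) : ZMod (p ^ 2)) = 0 := ZMod.natCast_self _
  have h2 := congrArg (AdjoinRoot.of E.h) h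
  rw [map_natCast, map_zero] at h2
  rw [← h2]; push_cast; ring

/-- Polynomials of degree less than `k` that vanish in the chain ring. -/
theorem coeff_of_mem {P : (E.GR)[X]} (hP : P ∈ Ideal.span {E.g, C (p : E.GR) * X ^ t})
    (hdeg : ∀ n, k ≤ n → P.coeff n = 0) :
    (∀ i < t, P.coeff i = 0) ∧ ∀ i, (p : E.GR) * P.coeff i = 0 := by
  obtain ⟨A, B, hAB⟩ := Ideal.mem_span_pair.mp hP
  have hpp := E.natCast_p_mul_p
  have hCC : C (p : E.GR) * C (p : E.GR) = 0 := by rw [← C_mul, hpp, C_0]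
  have hpP : C (p : E.GR) * P = C (p : E.GR) * A * X ^ k := by
    rw [← hAB, g]
    linear_combination (A * (∑ i : Fin k, C (E.coeffs i) * X ^ (i : ℕ)) + B * X ^ t) * hCC
  have hpA : C (p : E.GR) * A = 0 := by
    ext n
    have := congrArg (fun Q => Q.coeff (n + k)) hpP
    simp only [coeff_mul_X_pow, coeff_C_mul] at this
    rw [coeff_C_mul, ← this, hdeg _ (by omega)]
    simp
  have hP' : P = A * X ^ k + C (p : E.GR) * B * X ^ t := by
    rw [← hAB, g]
    linear_combination (∑ i : Fin k, C (E.coeffs i) * X ^ (i : ℕ)) * hpA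
  refine ⟨fun i hi => ?_, fun i => ?_⟩
  · have h1 : i < k := lt_of_lt_of_le hi E.t_le_k
    rw [hP', coeff_add, coeff_mul_X_pow', coeff_mul_X_pow', if_neg (by omega), if_neg (by omega),
      add_zero]
  · rw [← coeff_C_mul, hpP, hpA, zero_mul, coeff_zero]

/-- Independence of the powers of `x` over `ℤ/p²`. -/
theorem eq_zero_of_sum [Fact p.Prime] (z : Fin r → ZMod (p ^ 2))
    (hz : ∑ s, AdjoinRoot.of E.h (z s) * AdjoinRoot.root E.h ^ (s : ℕ) = 0) (s : Fin r) :
    z s = 0 := by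
  have hp : 1 < p ^ 2 := Nat.one_lt_pow two_ne_zero (Fact.out : p.Prime).one_lt
  have : Fact (1 < p ^ 2) := ⟨hp⟩
  have h1 : AdjoinRoot.mk E.h (∑ s : Fin r, C (z s) * X ^ (s : ℕ)) = 0 := by
    rw [map_sum, ← hz]
    exact Finset.sum_congr rfl fun s _ => by simp
  rw [AdjoinRoot.mk_eq_zero] at h1
  have h2 : (∑ s : Fin r, C (z s) * X ^ (s : ℕ)).degree < E.h.degree := by
    rw [degree_eq_natDegree E.monic.ne_zero, E.natDegree_eq]
    refine lt_of_le_of_lt (degree_sum_le _ _) ?_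
    rw [Finset.sup_lt_iff (by exact WithBot.bot_lt_coe _)]
    intro b _
    refine lt_of_le_of_lt (degree_C_mul_X_pow_le _ _) ?_
    exact_mod_cast b.2
  have h3 : (∑ s : Fin r, C (z s) * X ^ (s : ℕ)) = 0 := by
    by_contra h
    exact E.monic.not_dvd_of_degree_lt h h2 h1
  have h4 := congrArg (fun Q => Q.coeff (s : ℕ)) h3
  simpa [finsetSum_coeff, coeff_X_pow, Fin.val_inj] using h4

/-- Expansion along the powers of `x` over `ℤ/p²`. -/
theorem exists_sum [Fact p.Prime] (a : E.GR) : ∃ z : Fin r → ZMod (p ^ 2),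
    ∑ s, AdjoinRoot.of E.h (z s) * AdjoinRoot.root E.h ^ (s : ℕ) = a := by
  have hp : 1 < p ^ 2 := Nat.one_lt_pow two_ne_zero (Fact.out : p.Prime).one_lt
  have : Fact (1 < p ^ 2) := ⟨hp⟩
  obtain ⟨P, rfl⟩ := AdjoinRoot.mk_surjective a
  have hr : E.h ≠ 1 := by
    intro h
    have := E.irreducible.not_isUnit
    simp [h] at this
  refine ⟨fun s => (P %ₘ E.h).coeff s, ?_⟩
  have h1 : AdjoinRoot.mk E.h P = AdjoinRoot.mk E.h (P %ₘ E.h) := by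
    conv_lhs => rw [← modByMonic_add_div P E.h]
    simp
  rw [h1]
  conv_rhs => rw [(P %ₘ E.h).as_sum_range' r
    ((natDegree_modByMonic_lt P E.monic hr).trans_eq E.natDegree_eq)]
  rw [map_sum, Finset.sum_range]
  exact Finset.sum_congr rfl fun s _ => by rw [← C_mul_X_pow_eq_monomial]; simp

/-- The polynomial in `y` behind the expansion. -/
def lift (u : Coord p r k t) : (E.GR)[X] :=
  ∑ i : Fin t, C (∑ s : Fin r, ((u.1 (i, s)).val : E.GR) * AdjoinRoot.root E.h ^ (s : ℕ)) *
      X ^ (i : ℕ) +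
    ∑ j : Fin (k - t), C (∑ s : Fin r, ((u.2 (j, s)).val : E.GR) *
      AdjoinRoot.root E.h ^ (s : ℕ)) * X ^ (t + (j : ℕ))

theorem mk_lift (u : Coord p r k t) : Ideal.Quotient.mk _ (E.lift u) = E.expand u := by
  simp only [lift, expand, x, y, map_add, map_sum, map_mul, map_pow, map_natCast,
    Finset.sum_mul]

theorem coeff_lift_lt (u : Coord p r k t) (i : Fin t) : (E.lift u).coeff i =
    ∑ s : Fin r, ((u.1 (i, s)).val : E.GR) * AdjoinRoot.root E.h ^ (s : ℕ) := by
  rw [lift, coeff_add, finsetSum_coeff, finsetSum_coeff]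
  simp only [coeff_C_mul_X_pow]
  rw [Finset.sum_eq_single i, if_pos rfl, add_eq_left, Finset.sum_eq_zero]
  · intro j _
    rw [if_neg (by omega)]
  · intro j _ hj
    rw [if_neg fun h => hj (Fin.ext h.symm)]
  · simp

theorem coeff_lift_ge (u : Coord p r k t) (j : Fin (k - t)) : (E.lift u).coeff (t + j) =
    ∑ s : Fin r, ((u.2 (j, s)).val : E.GR) * AdjoinRoot.root E.h ^ (s : ℕ) := by
  rw [lift, coeff_add, finsetSum_coeff, finsetSum_coeff]
  simp only [coeff_C_mul_X_pow]
  rw [Finset.sum_eq_zero, zero_add, Finset.sum_eq_single j, if_pos rfl]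
  · intro i _ hi
    rw [if_neg fun h => hi (Fin.ext (by omega))]
  · simp
  · intro i _
    rw [if_neg (by omega)]

theorem coeff_lift_big (u : Coord p r k t) (n : ℕ) (hn : k ≤ n) : (E.lift u).coeff n = 0 := by
  have := E.t_le_k
  rw [lift, coeff_add, finsetSum_coeff, finsetSum_coeff]
  simp only [coeff_C_mul_X_pow]
  rw [Finset.sum_eq_zero, Finset.sum_eq_zero, add_zero]
  · intro j _
    rw [if_neg (by omega)]
  · intro i _
    rw [if_neg (by omega)]

theorem of_val [Fact p.Prime] (z : ZMod (p ^ 2)) : AdjoinRoot.of E.h z = (z.val : E.GR) := by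
  have : NeZero (p ^ 2) := ⟨pow_ne_zero 2 (Fact.out : p.Prime).ne_zero⟩
  conv_lhs => rw [← ZMod.natCast_zmod_val z]
  rw [map_natCast]

/-- Each element has exactly one expansion. -/
theorem expand_bijective [Fact p.Prime] : Function.Bijective E.expand := by
  have hp0 : p ≠ 0 := (Fact.out : p.Prime).ne_zero
  have : NeZero (p ^ 2) := ⟨pow_ne_zero 2 hp0⟩
  have htk := E.t_le_k
  constructor
  · intro u v huv
    rw [← mk_lift, ← mk_lift, Ideal.Quotient.eq] at huv
    obtain ⟨h1, h2⟩ := E.coeff_of_mem huv fun n hn => by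
      rw [coeff_sub, E.coeff_lift_big u n hn, E.coeff_lift_big v n hn, sub_zero]
    refine Prod.ext ?_ ?_
    · funext ⟨i, s⟩
      have h := h1 i i.2
      rw [coeff_sub, coeff_lift_lt, coeff_lift_lt, ← Finset.sum_sub_distrib] at h
      refine sub_eq_zero.mp (E.eq_zero_of_sum (fun s => u.1 (i, s) - v.1 (i, s)) ?_ s)
      rw [← h]
      refine Finset.sum_congr rfl fun s _ => ?_
      rw [map_sub, of_val, of_val, sub_mul]
    · funext ⟨j, s⟩
      have h := h2 (t + j)
      rw [coeff_sub, coeff_lift_ge, coeff_lift_ge, ← Finset.sum_sub_distrib,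
        Finset.mul_sum] at h
      have h3 := E.eq_zero_of_sum
        (fun s => ((p * (u.2 (j, s)).val : ℕ) : ZMod (p ^ 2)) - (p * (v.2 (j, s)).val : ℕ)) (by
          rw [← h]
          refine Finset.sum_congr rfl fun s _ => ?_
          rw [map_sub, map_natCast, map_natCast]
          push_cast
          ring) s
      rw [sub_eq_zero, ZMod.natCast_eq_natCast_iff] at h3
      have h4 : (u.2 (j, s)).val ≡ (v.2 (j, s)).val [MOD p] :=
        Nat.ModEq.mul_left_cancel' hp0 (pow_two p ▸ h3)
      rw [← ZMod.natCast_eq_natCast_iff, ZMod.natCast_zmod_val, ZMod.natCast_zmod_val] at h4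
      exact h4
  · intro a
    obtain ⟨P, rfl⟩ := Ideal.Quotient.mk_surjective a
    have hlow : (C (p : E.GR) * ∑ i : Fin k, C (E.coeffs i) * X ^ (i : ℕ)).degree < k := by
      rw [degree_lt_iff_coeff_zero]
      intro n hn
      rw [coeff_C_mul, finsetSum_coeff, Finset.sum_eq_zero, mul_zero]
      intro i _
      rw [coeff_C_mul_X_pow, if_neg (by have := i.2; omega)]
    have hgm : E.g.Monic := monic_X_pow_add hlow
    have hgd : ∀ n, k ≤ n → (P %ₘ E.g).coeff n = 0 := by
      nontriviality E.GR
      rw [← degree_lt_iff_coeff_zero]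
      refine (degree_modByMonic_lt P hgm).trans_eq ?_
      rw [g, degree_add_eq_left_of_degree_lt (by rwa [degree_X_pow]), degree_X_pow]
    choose z hz using E.exists_sum
    let u : Coord p r k t := (fun is => z ((P %ₘ E.g).coeff is.1) is.2,
      fun js => ((z ((P %ₘ E.g).coeff (t + js.1)) js.2).val : ZMod p))
    refine ⟨u, ?_⟩
    have hPQ : Ideal.Quotient.mk (Ideal.span {E.g, C (p : E.GR) * X ^ t}) P =
        Ideal.Quotient.mk _ (P %ₘ E.g) := by
      rw [Ideal.Quotient.eq]
      refine Ideal.mem_span_pair.mpr ⟨P /ₘ E.g, 0, ?_⟩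
      linear_combination modByMonic_add_div P E.g
    rw [hPQ, ← mk_lift, Ideal.Quotient.eq]
    have key : ∀ n, ∃ w : E.GR, (E.lift u - P %ₘ E.g).coeff n = p * w ∧
        (n < t ∨ k ≤ n → w = 0) := by
      intro n
      by_cases h1 : n < t
      · refine ⟨0, ?_, fun _ => rfl⟩
        rw [coeff_sub, E.coeff_lift_lt u ⟨n, h1⟩, ← hz ((P %ₘ E.g).coeff n), mul_zero, sub_eq_zero]
        refine Finset.sum_congr rfl fun s _ => ?_
        rw [of_val]
      by_cases h2 : k ≤ n
      · refine ⟨0, ?_, fun _ => rfl⟩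
        rw [coeff_sub, E.coeff_lift_big u n h2, hgd n h2, sub_zero, mul_zero]
      obtain ⟨j, rfl⟩ := Nat.exists_eq_add_of_le (not_lt.mp h1)
      refine ⟨-∑ s : Fin r, (((z ((P %ₘ E.g).coeff (t + j)) s).val / p : ℕ) : E.GR) *
        AdjoinRoot.root E.h ^ (s : ℕ), ?_, fun h => absurd h (by omega)⟩
      rw [coeff_sub, E.coeff_lift_ge u ⟨j, by omega⟩]
      conv_lhs => rw [← hz ((P %ₘ E.g).coeff (t + j))]
      rw [← Finset.sum_sub_distrib, mul_neg, Finset.mul_sum, ← Finset.sum_neg_distrib]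
      refine Finset.sum_congr rfl fun s _ => ?_
      have h3 := congrArg (Nat.cast (R := E.GR))
        (Nat.mod_add_div (z ((P %ₘ E.g).coeff (t + j)) s).val p)
      push_cast at h3
      simp only [u, of_val, ZMod.val_natCast]
      linear_combination (AdjoinRoot.root E.h ^ (s : ℕ)) * h3
    rw [as_sum_range_C_mul_X_pow (E.lift u - P %ₘ E.g)]
    refine Ideal.sum_mem _ fun n _ => ?_
    obtain ⟨w, hw, hw0⟩ := key n
    rw [hw]
    by_cases h : n < t ∨ k ≤ n
    · rw [hw0 h]
      simp
    · refine Ideal.mem_span_pair.mpr ⟨0, C w * X ^ (n - t), ?_⟩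
      have hn : n = n - t + t := by omega
      conv_rhs => rw [hn]
      rw [C_mul, pow_add]
      ring

/-- The coordinate map `Ψ`. -/
def psi [Fact p.Prime] : E.ChainRing ≃ Coord p r k t := (Equiv.ofBijective _ E.expand_bijective).symm

/-- The character `χ_a`, where `ξ` is a primitive `p²`-th root of unity:
`χ_a(b) = ∏ ξ^{a_{i,s} b_{i,s}} ∏ ξ^{p a_{j,s} b_{j,s}}`. -/
def chi [Fact p.Prime] (ξ : ℂ) (a b : E.ChainRing) : ℂ :=
  (∏ i, ξ ^ ((E.psi a).1 i * (E.psi b).1 i).val) *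
    ∏ j, (ξ ^ p) ^ ((E.psi a).2 j * (E.psi b).2 j).val

/-- The `χ`-dual of an additive code of length `N`, as a set of words. -/
def chiDual [Fact p.Prime] (ξ : ℂ) {N : ℕ} (𝒞 : AddSubgroup (Fin N → E.ChainRing)) :
    Set (Fin N → E.ChainRing) :=
  {d | ∀ c ∈ 𝒞, ∏ l, E.chi ξ (d l) (c l) = 1}

end EisensteinData

end

end MixedCodes

namespace MixedCodes

open Matrix

/-! ### Bases of subspaces -/

section Bases

variable {K V : Type*} [Field K] [AddCommGroup V] [Module K V] [FiniteDimensional K V]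

/-! Everything is done for an abstract `g : K →ₗ[R] R` playing the role of multiplication by `γ`
(`IsSocleEmbedding`), with words indexed by arbitrary finite types `ι`, `κ` of sizes `N₁`, `N₂`.
Chain rings use `g = gammaMul`; the additive codes over Eisenstein extensions use `ℤ/p²`, `ℤ/p` and
`g = mulP`.

Reducing the first block maps a code `C` onto a subspace `A = tor₁` of `K^N₁`. The words of `C` that
reduce to zero form, after division by `g`, a subspace `U = kerPart` of `K^N₁ × K^N₂`. Put `B = tor₂
= {z | (z, 0) ∈ U}` and let `D = tor₃` be the projection of `U` to `K^N₂`. Self-orthogonality forces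
`A ≤ B ≤ A^⊥` and `D ≤ D^⊥`. Conversely, fix such `A`, `B`, `D` of dimensions `k₀`, `k₀ + k₁`, `l₀`,
and write `q` for the size of `K`. The codes above them are counted in two steps.

The subspaces `U` number `q^((N₁ - k₀ - k₁) l₀)` (`card_kernels`). Given `A` and `U`, a code is
generated by `U` and lifts of a basis of `A`, each lift being free modulo `U` (`card_extensions`).
Lifts are built one at a time. Orthogonality to `U` is `l₀` affine conditions on the second block.
Orthogonality to the lift itself and to the `i` previous ones is `i + 1` affine conditions on the
`γ`-part of the first block, because `γ² = 0` removes the quadratic term and `2` is invertible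
(`card_lift`, `card_lifts`). Dividing by the `q^(k₀ (k₀ + k₁ + l₀))` choices modulo `U` and
multiplying by the number of `U` gives the exponent `Theta` (`card_codes_torsion`).

It remains to count the triples. The number of self-orthogonal `A` and `D` is `sigma`
(`card_isotropic`): such spaces are built vector by vector, from the number of zeros of a sum of
squares. The `B` between `A` and `A^⊥` are subspaces of a space of dimension `N₁ - 2k₀`
(`card_subspaces_between`). Information sets produce a standard generator matrix for every code, so
types and torsion codes of the matrix are the dimensions and spaces above (`hasType_iff`,
`hasTorsionCodes_iff`). For Eisenstein extensions the coordinate map is additive and turns the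
character pairing into `ξ` raised to the form, so additive codes become `ℤ/p²`-submodules of the
mixed space (`prod_chi`). -/

theorem exists_linearIndependent_span_eq (C : Submodule K V) {d : ℕ}
    (hd : Module.finrank K C = d) :
    ∃ b : Fin d → V, LinearIndependent K b ∧ Submodule.span K (Set.range b) = C := by
  subst hd
  let b := Module.finBasis K C
  refine ⟨fun i => b i, b.linearIndependent.map' C.subtype C.ker_subtype, ?_⟩
  have := congrArg (Submodule.map C.subtype) b.span_eq
  rwa [Submodule.map_span, Submodule.map_top, Submodule.range_subtype, ← Set.range_comp] at this

end Bases

/-! ### Counting by fibres -/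

section Fibers

theorem card_eq_mul_of_fibers {A B : Type*} [Finite A] [Finite B] (f : A → B) (n : ℕ)
    (h : ∀ b, Nat.card {a // f a = b} = n) : Nat.card A = Nat.card B * n := by
  have := Fintype.ofFinite B
  rw [← Nat.card_congr (Equiv.sigmaFiberEquiv f), Nat.card_sigma]
  simp [h, Nat.card_eq_fintype_card]

theorem real_card_eq_mul_of_fibers {A B : Type*} [Finite A] [Finite B] (f : A → B) (n : ℝ)
    (h : ∀ b, (Nat.card {a // f a = b} : ℝ) = n) : (Nat.card A : ℝ) = Nat.card B * n := by
  have := Fintype.ofFinite B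
  rw [← Nat.card_congr (Equiv.sigmaFiberEquiv f), Nat.card_sigma]
  simp [h, Nat.card_eq_fintype_card]

theorem card_fiber_mul {A B : Type*} [AddGroup A] [AddGroup B] [Finite A] [Finite B] (f : A →+ B)
    (hf : Function.Surjective f) (b : B) :
    Nat.card {a // f a = b} * Nat.card B = Nat.card A := by
  rw [mul_comm]
  symm
  refine card_eq_mul_of_fibers f _ fun c => ?_
  obtain ⟨a₀, rfl⟩ := hf b
  obtain ⟨a₁, rfl⟩ := hf c
  exact Nat.card_congr
    { toFun := fun a => ⟨a.1 - a₁ + a₀, by simp [a.2]⟩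
      invFun := fun a => ⟨a.1 - a₀ + a₁, by simp [a.2]⟩
      left_inv := fun a => by ext; simp
      right_inv := fun a => by ext; simp }

theorem card_fiber_ker {A B : Type*} [AddGroup A] [AddGroup B] [Finite A] [Finite B] (f : A →+ B)
    (hf : Function.Surjective f) (b c : B) :
    Nat.card {a // f a = b} = Nat.card {a // f a = c} :=
  Nat.eq_of_mul_eq_mul_right Nat.card_pos
    ((card_fiber_mul f hf b).trans (card_fiber_mul f hf c).symm)

/-- A finite type is counted along a function with values in a finset. -/
theorem card_eq_sum_fibers {A B : Type*} [Finite A] [DecidableEq B] (s : Finset B) (f : A → B)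
    (h : ∀ a, f a ∈ s) : Nat.card A = ∑ b ∈ s, Nat.card {a // f a = b} := by
  have := Fintype.ofFinite A
  simp only [Nat.card_eq_fintype_card, Fintype.card_subtype]
  rw [← Finset.card_univ]
  exact Finset.card_eq_sum_card_fiberwise fun a _ => h a

end Fibers

/-! ### Counting subspaces in a family closed under subspaces -/

section Subspaces

variable {K V : Type*} [Field K] [AddCommGroup V] [Module K V] [Finite V]

/-- Linearly independent tuples whose span is in a family of subspaces. -/
theorem card_tuples_family (F : Submodule K V → Prop) (hbot : F ⊥)
    (hmono : ∀ A B, A ≤ B → F B → F A) (e : ℕ → ℝ) (s : ℕ)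
    (he : ∀ A, F A →
      (Nat.card {v // v ∉ A ∧ F (A ⊔ K ∙ v)} : ℝ) = e (Module.finrank K A)) :
    (Nat.card {v : Fin s → V //
      LinearIndependent K v ∧ F (Submodule.span K (Set.range v))} : ℝ) =
        ∏ i ∈ Finset.range s, e i := by
  induction s with
  | zero =>
    have : Unique {v : Fin 0 → V //
        LinearIndependent K v ∧ F (Submodule.span K (Set.range v))} :=
      { default := ⟨Fin.elim0, linearIndependent_empty_type, by simpa using hbot⟩
        uniq := fun a => Subtype.ext (Subsingleton.elim _ _) }
    rw [Nat.card_unique, Nat.cast_one, Finset.prod_range_zero]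
  | succ s ih =>
    rw [Finset.prod_range_succ, ← ih]
    have hspan : ∀ v : Fin (s + 1) → V, Submodule.span K (Set.range v) =
        Submodule.span K (Set.range (Fin.tail v)) ⊔ K ∙ v 0 := by
      intro v
      conv_lhs => rw [← Fin.cons_self_tail v, Fin.range_cons, Submodule.span_insert, sup_comm]
    have hind : ∀ v : Fin (s + 1) → V, LinearIndependent K v ↔
        LinearIndependent K (Fin.tail v) ∧
          v 0 ∉ Submodule.span K (Set.range (Fin.tail v)) := by
      intro v
      conv_lhs => rw [← Fin.cons_self_tail v, linearIndependent_finCons]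
    -- Forget the head of the tuple. The fibre over a tail is the set of vectors that extend its
    -- span inside the family, so only the dimension of that span matters.
    refine real_card_eq_mul_of_fibers (fun v => ⟨Fin.tail v.1, ((hind _).1 v.2.1).1,
      hmono _ _ ((hspan v.1).symm ▸ le_sup_left) v.2.2⟩) _ fun t => ?_
    have hd := finrank_span_eq_card t.2.1
    rw [Fintype.card_fin] at hd
    have ht := he _ t.2.2
    rw [hd] at ht
    rw [← ht]
    refine congrArg Nat.cast <| Nat.card_congr
      { toFun := fun v => ⟨v.1.1 0, ?_⟩
        invFun := fun x => ⟨⟨Fin.cons x.1 t.1, ?_⟩, ?_⟩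
        left_inv := fun v => ?_
        right_inv := fun x => ?_ }
    · have h := congrArg Subtype.val v.2
      simp only at h
      have h1 := (hind _).1 v.1.2.1
      have h2 := v.1.2.2
      rw [hspan] at h2
      rw [h] at h1 h2
      exact ⟨h1.2, h2⟩
    · rw [hind, hspan]
      simpa using ⟨⟨t.2.1, x.2.1⟩, x.2.2⟩
    · exact Subtype.ext (by simp)
    · have h := congrArg Subtype.val v.2
      simp only at h
      refine Subtype.ext (Subtype.ext ?_)
      simp [← h]
    · simp

variable [Finite K]

theorem card_submodule (C : Submodule K V) : Nat.card C = Nat.card K ^ Module.finrank K C := by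
  have := Fintype.ofFinite K
  rw [Module.natCard_eq_pow_finrank (K := K)]

theorem card_bases (C : Submodule K V) :
    Nat.card {v : Fin (Module.finrank K C) → C // LinearIndependent K v} =
      ∏ i ∈ Finset.range (Module.finrank K C),
        (Nat.card K ^ Module.finrank K C - Nat.card K ^ i) := by
  have := Fintype.ofFinite K
  rw [card_linearIndependent le_rfl, Nat.card_eq_fintype_card, Finset.prod_range]

/-- The number of subspaces of a given dimension in a family of subspaces. -/
theorem card_family (F : Submodule K V → Prop) (hbot : F ⊥)
    (hmono : ∀ A B, A ≤ B → F B → F A) (e : ℕ → ℝ) (s : ℕ)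
    (he : ∀ A, F A →
      (Nat.card {v // v ∉ A ∧ F (A ⊔ K ∙ v)} : ℝ) = e (Module.finrank K A)) :
    (Nat.card {A : Submodule K V // F A ∧ Module.finrank K A = s} : ℝ) *
      ∏ i ∈ Finset.range s, ((Nat.card K : ℝ) ^ s - (Nat.card K : ℝ) ^ i) =
        ∏ i ∈ Finset.range s, e i := by
  rw [← card_tuples_family F hbot hmono e s he]
  symm
  have hcast : ∏ i ∈ Finset.range s, ((Nat.card K : ℝ) ^ s - (Nat.card K : ℝ) ^ i) =
      ((∏ i ∈ Finset.range s, (Nat.card K ^ s - Nat.card K ^ i) : ℕ) : ℝ) := by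
    rw [Nat.cast_prod]
    refine Finset.prod_congr rfl fun i hi => ?_
    rw [Nat.cast_sub (Nat.pow_le_pow_right Nat.card_pos (Finset.mem_range.1 hi).le)]
    push_cast
    rfl
  rw [hcast, ← Nat.cast_mul]
  congr 1
  -- The fibre over a subspace is the set of its ordered bases.
  refine card_eq_mul_of_fibers (fun v => ⟨Submodule.span K (Set.range v.1), v.2.2, by
    rw [finrank_span_eq_card v.2.1, Fintype.card_fin]⟩) _ ?_
  rintro ⟨A, hA, rfl⟩
  rw [← card_bases]
  have key : ∀ w : Fin (Module.finrank K A) → A, LinearIndependent K w →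
      Submodule.span K (Set.range fun i => (w i : V)) = A := by
    intro w hw
    have h : LinearIndependent K fun i => (w i : V) := hw.map' A.subtype A.ker_subtype
    refine Submodule.eq_of_le_of_finrank_eq ?_ ?_
    · rw [Submodule.span_le]
      rintro _ ⟨i, rfl⟩
      exact (w i).2
    · rw [finrank_span_eq_card h, Fintype.card_fin]
  refine Nat.card_congr
    { toFun := fun v => ⟨fun i => ⟨v.1.1 i, ?_⟩, ?_⟩
      invFun := fun w => ⟨⟨fun i => w.1 i, w.2.map' A.subtype A.ker_subtype, ?_⟩, ?_⟩
      left_inv := fun v => rfl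
      right_inv := fun x => rfl }
  · have h := congrArg Subtype.val v.2
    simp only at h
    exact h.le (Submodule.subset_span ⟨i, rfl⟩)
  · exact LinearIndependent.of_comp A.subtype v.1.2.1
  · rwa [key _ w.2]
  · exact Subtype.ext (key _ w.2)

end Subspaces

/-! ### Zeros of a sum of squares over a finite field of odd characteristic -/

section SumsOfSquares

variable {K : Type*} [Field K]

theorem nu_two_sq : nu K 2 ^ 2 = 1 := by
  unfold nu; split_ifs <;> norm_num

/-- Both sides depend only on the parity of `n / 2`: an even power of `-1` is the square `1`, an odd
one is `-1`. -/
theorem nu_eq_pow (n : ℕ) : nu K n = nu K 2 ^ (n / 2) := by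
  rcases Nat.even_or_odd' (n / 2) with ⟨m, hm | hm⟩
  · rw [hm, pow_mul, nu_two_sq, one_pow, nu, hm, pow_mul]
    simp
  · rw [hm, pow_succ, pow_mul, nu_two_sq, one_pow, one_mul, nu, hm, pow_succ, pow_mul, nu]
    have h1 : ((-1 : K) ^ 2) ^ m * -1 = (-1) ^ (2 / 2) := by norm_num
    rw [h1]

open Classical in
theorem quadraticChar_neg_one_eq_nu [Fintype K] : ((quadraticChar K (-1) : ℤ) : ℝ) = nu K 2 := by
  have h : (-1 : K) ≠ 0 := by simp
  unfold nu
  split_ifs with h1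
  · rw [(quadraticChar_one_iff_isSquare h).2 (by simpa using h1)]; simp
  · rw [quadraticChar_neg_one_iff_not_isSquare.2 (by simpa using h1)]; simp

/-- The correction term in the number of zeros of a sum of `n` squares. -/
noncomputable def zeroCorrection (K : Type*) [CommRing K] (n : ℕ) : ℝ :=
  if Even n then nu K n * ((Nat.card K - 1) * (Nat.card K : ℝ) ^ (n / 2)) else 0

theorem zeroCorrection_add_two (n : ℕ) :
    zeroCorrection K (n + 2) = nu K 2 * Nat.card K * zeroCorrection K n := by
  unfold zeroCorrection
  have h : (n + 2) / 2 = n / 2 + 1 := by omega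
  rw [nu_eq_pow (n + 2), nu_eq_pow n, h]
  have h2 : Even (n + 2) ↔ Even n := by simp [Nat.even_add]
  rw [if_congr h2 rfl rfl]
  split_ifs
  · ring
  · ring

variable [Finite K]

/-- For fixed `x` the equation `y² = -x²` has `1 + χ(-x²)` solutions, with `χ` the quadratic
character; this is `1` for `x = 0` and `1 + χ(-1)` otherwise. -/
theorem card_two_squares_zero (hK : ringChar K ≠ 2) :
    (Nat.card {p : K × K // p.1 ^ 2 + p.2 ^ 2 = 0} : ℝ) =
      Nat.card K + (Nat.card K - 1) * nu K 2 := by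
  classical
  have := Fintype.ofFinite K
  rw [Nat.card_congr (Equiv.subtypeProdEquivSigmaSubtype fun x y : K => x ^ 2 + y ^ 2 = 0),
    Nat.card_sigma, Nat.cast_sum]
  have h : ∀ x : K, (Nat.card {y : K // x ^ 2 + y ^ 2 = 0} : ℝ) =
      1 + if x = 0 then 0 else nu K 2 := by
    intro x
    have h1 := quadraticChar_card_sqrts hK (-x ^ 2)
    have h2 : Nat.card {y : K // x ^ 2 + y ^ 2 = 0} =
        ({y : K | y ^ 2 = -x ^ 2} : Set K).toFinset.card := by
      rw [Set.toFinset_card, ← Nat.card_eq_fintype_card]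
      exact Nat.card_congr (Equiv.subtypeEquivRight fun y => by
        rw [Set.mem_ofPred_eq, eq_neg_iff_add_eq_zero, add_comm])
    rw [h2, ← Int.cast_natCast, h1, Int.cast_add, Int.cast_one, add_comm]
    congr 1
    split_ifs with hx
    · simp [hx]
    · rw [← neg_one_mul, map_mul, quadraticChar_sq_one' hx, mul_one, quadraticChar_neg_one_eq_nu]
  rw [Finset.sum_congr rfl fun x _ => h x, Finset.sum_add_distrib, Finset.sum_ite]
  simp [Finset.filter_ne', Nat.card_eq_fintype_card, Nat.cast_sub Fintype.card_pos]

/-- All nonzero values are taken equally often, so they share evenly the pairs left over by the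
value zero. -/
theorem card_two_squares_ne_zero (hK : ringChar K ≠ 2) {c : K} (hc : c ≠ 0) :
    (Nat.card {p : K × K // p.1 ^ 2 + p.2 ^ 2 = c} : ℝ) = Nat.card K - nu K 2 := by
  classical
  have := Fintype.ofFinite K
  have hconst : ∀ c : K, c ≠ 0 → Nat.card {p : K × K // p.1 ^ 2 + p.2 ^ 2 = c} =
      Nat.card {p : K × K // p.1 ^ 2 + p.2 ^ 2 = 1} := by
    intro c hc
    obtain ⟨a, b, hab⟩ : ∃ a b : K, a ^ 2 + b ^ 2 = c := by
      obtain ⟨a, b, hab⟩ := FiniteField.exists_root_sum_quadratic (R := K) (f := X ^ 2)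
        (g := X ^ 2 - C c) (degree_X_pow 2) (degree_X_pow_sub_C (by decide) _)
        (FiniteField.odd_card_of_char_ne_two hK)
      refine ⟨a, b, ?_⟩
      rw [← sub_eq_zero]
      simpa only [eval_C, eval_X, eval_pow, eval_sub, ← add_sub_assoc] using hab
    -- Multiplicativity of `a² + b²`, the norm of `a + b i`: multiplication by `a + b i` carries the
    -- solutions for `1` to those for `c`.
    refine Nat.card_congr
      { toFun := fun p => ⟨((a * p.1.1 + b * p.1.2) / c, (a * p.1.2 - b * p.1.1) / c), ?_⟩
        invFun := fun p => ⟨(a * p.1.1 - b * p.1.2, a * p.1.2 + b * p.1.1), ?_⟩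
        left_inv := fun p => ?_
        right_inv := fun p => ?_ }
    · have hp := p.2
      field_simp
      linear_combination (a ^ 2 + b ^ 2) * hp + c * hab
    · have hp := p.2
      linear_combination (a ^ 2 + b ^ 2) * hp + hab
    · refine Subtype.ext (Prod.ext ?_ ?_) <;> simp only <;> field_simp <;> subst hab <;> ring
    · refine Subtype.ext (Prod.ext ?_ ?_) <;> simp only <;> field_simp <;> subst hab <;> ring
  have htot : (Nat.card K : ℝ) ^ 2 = Nat.card {p : K × K // p.1 ^ 2 + p.2 ^ 2 = 0} +
      (Nat.card K - 1) * Nat.card {p : K × K // p.1 ^ 2 + p.2 ^ 2 = c} := by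
    have h1 : Nat.card (K × K) = ∑ d : K, Nat.card {p : K × K // p.1 ^ 2 + p.2 ^ 2 = d} :=
      card_eq_sum_fibers Finset.univ (fun p : K × K => p.1 ^ 2 + p.2 ^ 2) (by simp)
    rw [← Finset.add_sum_erase _ _ (Finset.mem_univ 0), Finset.sum_congr rfl (g := fun _ =>
      Nat.card {p : K × K // p.1 ^ 2 + p.2 ^ 2 = c}) fun d hd => by
        rw [hconst d (Finset.ne_of_mem_erase hd), hconst c hc]] at h1
    have h2 := congrArg (Nat.cast (R := ℝ)) h1
    rw [Nat.card_prod] at h2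
    rw [Finset.sum_const, Finset.card_erase_of_mem (Finset.mem_univ _), Finset.card_univ,
      smul_eq_mul, Nat.cast_add, Nat.cast_mul, Nat.cast_mul, Nat.cast_sub Fintype.card_pos,
      ← Nat.card_eq_fintype_card, Nat.cast_one] at h2
    linear_combination h2
  rw [card_two_squares_zero hK] at htot
  have hq : (Nat.card K : ℝ) - 1 ≠ 0 := by
    have : 1 < Nat.card K := Finite.one_lt_card
    have : (1 : ℝ) < Nat.card K := by exact_mod_cast this
    linarith
  refine mul_left_cancel₀ hq ?_
  linear_combination -htot

/-- Induction in steps of two: the first two coordinates must represent minus the sum of the other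
squares, and the number of ways depends only on whether that sum vanishes. -/
theorem card_sum_squares_zero (hK : ringChar K ≠ 2) (n : ℕ) :
    (Nat.card K : ℝ) * Nat.card {v : Fin n → K // v ⬝ᵥ v = 0} =
      (Nat.card K : ℝ) ^ n + zeroCorrection K n := by
  classical
  have := Fintype.ofFinite K
  induction n using Nat.twoStepInduction with
  | zero => simp [zeroCorrection, nu]
  | one =>
    have : Unique {v : Fin 1 → K // v ⬝ᵥ v = 0} :=
      { default := ⟨0, by simp⟩
        uniq := fun v => Subtype.ext (funext fun i => by
          have := v.2
          rw [Subsingleton.elim i 0]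
          simpa [dotProduct] using this) }
    simp [zeroCorrection]
  | more n ih _ =>
    have e : {v : Fin (n + 2) → K // v ⬝ᵥ v = 0} ≃
        (w : Fin n → K) × {p : K × K // p.1 ^ 2 + p.2 ^ 2 = -(w ⬝ᵥ w)} :=
      { toFun := fun v => ⟨fun i => v.1 i.succ.succ, (v.1 0, v.1 (Fin.succ 0)), by
          have := v.2
          simp only [dotProduct, Fin.sum_univ_succ] at this ⊢
          linear_combination this⟩
        invFun := fun x => ⟨Fin.cons x.2.1.1 (Fin.cons x.2.1.2 x.1), by
          have := x.2.2
          simp only [dotProduct, Fin.sum_univ_succ, Fin.cons_zero, Fin.cons_succ] at this ⊢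
          linear_combination this⟩
        left_inv := fun v => by
          ext i
          refine Fin.cases ?_ (fun i => Fin.cases ?_ (fun i => ?_) i) i <;> simp
        right_inv := fun x => rfl }
    rw [Nat.card_congr e, Nat.card_sigma, Nat.cast_sum]
    have h : ∀ w : Fin n → K,
        (Nat.card {p : K × K // p.1 ^ 2 + p.2 ^ 2 = -(w ⬝ᵥ w)} : ℝ) =
          (Nat.card K - nu K 2) + if w ⬝ᵥ w = 0 then nu K 2 * Nat.card K else 0 := by
      intro w
      split_ifs with hw
      · rw [hw, neg_zero, card_two_squares_zero hK]; ring
      · rw [card_two_squares_ne_zero hK (neg_ne_zero.2 hw), add_zero]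
    rw [Finset.sum_congr rfl fun w _ => h w, Finset.sum_add_distrib, ← Finset.sum_filter,
      Finset.sum_const, Finset.sum_const, ← Fintype.card_subtype, ← Nat.card_eq_fintype_card,
      Finset.card_univ, ← Nat.card_eq_fintype_card, Nat.card_fun, zeroCorrection_add_two]
    simp only [nsmul_eq_mul, Nat.cast_pow, Nat.card_eq_fintype_card (α := Fin n), Fintype.card_fin]
    linear_combination (nu K 2 * Nat.card K) * ih

end SumsOfSquares

/-! ### Duals and self-orthogonal codes over a finite field -/

section Isotropic

variable {K : Type*} [Field K] {ι : Type*} [Fintype ι]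

/-- The dual of a linear code, as a linear code. -/
def dual (C : Submodule K (ι → K)) : Submodule K (ι → K) where
  carrier := {v | ∀ c ∈ C, v ⬝ᵥ c = 0}
  add_mem' := fun ha hb c hc => by rw [add_dotProduct, ha c hc, hb c hc, add_zero]
  zero_mem' := fun c _ => zero_dotProduct c
  smul_mem' := fun r a ha c hc => by rw [smul_dotProduct, ha c hc, smul_zero]

theorem mem_dual {C : Submodule K (ι → K)} {v : ι → K} : v ∈ dual C ↔ ∀ c ∈ C, v ⬝ᵥ c = 0 :=
  Iff.rfl

theorem mem_dual_span {s : Set (ι → K)} {v : ι → K} :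
    v ∈ dual (Submodule.span K s) ↔ ∀ c ∈ s, v ⬝ᵥ c = 0 := by
  refine ⟨fun h c hc => h c (Submodule.subset_span hc), fun h c hc => ?_⟩
  induction hc using Submodule.span_induction with
  | mem x hx => exact h x hx
  | zero => exact dotProduct_zero v
  | add x y _ _ hx hy => rw [dotProduct_add, hx, hy, add_zero]
  | smul a x _ hx => rw [dotProduct_smul, hx, smul_zero]

theorem dual_anti {A B : Submodule K (ι → K)} (h : A ≤ B) : dual B ≤ dual A :=
  fun _ hv c hc => hv c (h hc)

theorem le_dual_comm {A B : Submodule K (ι → K)} : A ≤ dual B ↔ B ≤ dual A :=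
  ⟨fun h b hb a ha => by rw [dotProduct_comm]; exact h ha b hb,
    fun h a ha b hb => by rw [dotProduct_comm]; exact h hb a ha⟩

/-- The dot products with a family of words. -/
def dotWith {κ : Type*} (b : κ → ι → K) : (ι → K) →ₗ[K] (κ → K) where
  toFun v j := v ⬝ᵥ b j
  map_add' v w := funext fun j => add_dotProduct v w (b j)
  map_smul' r v := funext fun j => smul_dotProduct r v (b j)

theorem dotWith_apply {κ : Type*} (b : κ → ι → K) (v : ι → K) (j : κ) :
    dotWith b v j = v ⬝ᵥ b j := rfl

/-- The matrix with rows `b` has full row rank. This is what makes every later system of dot product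
conditions independent. -/
theorem dotWith_surjective {κ : Type*} [Fintype κ] {b : κ → ι → K} (hb : LinearIndependent K b) :
    Function.Surjective (dotWith b) := by
  classical
  have h : (Matrix.of b).rank = Fintype.card κ := LinearIndependent.rank_matrix hb
  rw [Matrix.rank] at h
  have h1 : LinearMap.range (Matrix.of b).mulVecLin = ⊤ :=
    Submodule.eq_top_of_finrank_eq (by rw [h, Module.finrank_fintype_fun_eq_card])
  intro w
  obtain ⟨v, hv⟩ := LinearMap.range_eq_top.1 h1 w
  refine ⟨v, ?_⟩
  rw [← hv]
  ext j
  simp [dotWith_apply, dotProduct_comm, Matrix.mulVec]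

theorem ker_dotWith {κ : Type*} (b : κ → ι → K) :
    LinearMap.ker (dotWith b) = dual (Submodule.span K (Set.range b)) := by
  ext v
  rw [LinearMap.mem_ker, mem_dual_span, Set.forall_mem_range, funext_iff]
  rfl

theorem finrank_dual (C : Submodule K (ι → K)) :
    Module.finrank K (dual C) + Module.finrank K C = Fintype.card ι := by
  obtain ⟨b, hb, hspan⟩ := exists_linearIndependent_span_eq C rfl
  have h := LinearMap.finrank_range_add_finrank_ker (dotWith b)
  rw [LinearMap.range_eq_top.2 (dotWith_surjective hb), finrank_top, ker_dotWith, hspan,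
    Module.finrank_fintype_fun_eq_card, Module.finrank_fintype_fun_eq_card, Fintype.card_fin] at h
  omega

theorem two_mul_finrank_le {C : Submodule K (ι → K)} (hC : C ≤ dual C) :
    2 * Module.finrank K C ≤ Fintype.card ι := by
  have := finrank_dual C
  have := Submodule.finrank_mono hC
  omega

variable [Finite K]

/-- The number of isotropic vectors in the dual of a self-orthogonal code. -/
theorem card_isotropic_dual (hK : ringChar K ≠ 2) (C : Submodule K (ι → K)) (hC : C ≤ dual C) :
    (Nat.card K : ℝ) * Nat.card {v // v ∈ dual C ∧ v ⬝ᵥ v = 0} =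
      (Nat.card K : ℝ) ^ (Fintype.card ι - Module.finrank K C) +
        zeroCorrection K (Fintype.card ι) := by
  classical
  have := Fintype.ofFinite K
  set q : ℝ := (Nat.card K : ℝ) with hq
  have hZ : q * Nat.card {v : ι → K // v ⬝ᵥ v = 0} =
      q ^ Fintype.card ι + zeroCorrection K (Fintype.card ι) := by
    rw [← card_sum_squares_zero hK]
    congr 2
    refine Nat.card_congr ((Equiv.arrowCongr (Fintype.equivFin ι) (Equiv.refl K)).subtypeEquiv
      fun v => ?_)
    rw [show (Equiv.arrowCongr (Fintype.equivFin ι) (Equiv.refl K)) v =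
      v ∘ (Fintype.equivFin ι).symm from rfl, dotProduct_comp_equiv_symm]
    simp [Function.comp_assoc]
  -- Count in two ways the pairs `(v, c)` with `v + c` isotropic. Substituting `v - c` for `v` gives
  -- all isotropic vectors, once for each `c`.
  have hP1 : Nat.card {p : (ι → K) × C // (p.1 + (p.2 : ι → K)) ⬝ᵥ (p.1 + (p.2 : ι → K)) = 0} =
      Nat.card {v : ι → K // v ⬝ᵥ v = 0} * Nat.card C := by
    rw [← Nat.card_prod]
    exact Nat.card_congr
      { toFun := fun p => (⟨p.1.1 + p.1.2, p.2⟩, p.1.2)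
        invFun := fun x => ⟨(x.1.1 - x.2, x.2), by simpa using x.1.2⟩
        left_inv := fun p => by ext <;> simp
        right_inv := fun x => by ext <;> simp }
  -- For fixed `v` the condition is affine in `c`, since `c` is isotropic. On the dual it holds for
  -- all `c` or none; off the dual exactly one `c` in `q` satisfies it.
  have hP2 : ∀ v : ι → K, q * Nat.card {c : C // (v + (c : ι → K)) ⬝ᵥ (v + (c : ι → K)) = 0} =
      Nat.card C * (if v ∈ dual C then (if v ⬝ᵥ v = 0 then q else 0) else 1) := by
    intro v
    have hexp : ∀ c : C, (v + (c : ι → K)) ⬝ᵥ (v + (c : ι → K)) = v ⬝ᵥ v + 2 * (v ⬝ᵥ c) := by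
      intro c
      have : (c : ι → K) ⬝ᵥ c = 0 := hC c.2 c c.2
      rw [add_dotProduct, dotProduct_add, dotProduct_add, this, dotProduct_comm c.1 v]
      ring
    simp only [hexp]
    split_ifs with h1 h2
    · have : ∀ c : C, v ⬝ᵥ v + 2 * (v ⬝ᵥ c) = 0 := fun c => by rw [h2, h1 c c.2]; ring
      rw [Nat.card_congr (Equiv.subtypeUnivEquiv this), mul_comm]
    · have : IsEmpty {c : C // v ⬝ᵥ v + 2 * (v ⬝ᵥ (c : ι → K)) = 0} :=
        ⟨fun c => h2 (by simpa [h1 c.1 c.1.2] using c.2)⟩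
      simp
    · have h2 := Ring.two_ne_zero hK
      let f : C →+ K := AddMonoidHom.mk' (fun c => v ⬝ᵥ (c : ι → K)) fun a b => by
        simp [dotProduct_add]
      have hf : Function.Surjective f := by
        rw [mem_dual] at h1
        push Not at h1
        obtain ⟨c, hc, hvc⟩ := h1
        intro a
        refine ⟨(a / (v ⬝ᵥ c)) • ⟨c, hc⟩, ?_⟩
        simp [f, dotProduct_smul, hvc]
      have := card_fiber_mul f hf (-(v ⬝ᵥ v) / 2)
      rw [mul_one, ← this, mul_comm, Nat.cast_mul]
      congr 2
      refine Nat.card_congr (Equiv.subtypeEquivRight fun c => ?_)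
      change _ ↔ v ⬝ᵥ (c : ι → K) = _
      rw [eq_div_iff h2, eq_neg_iff_add_eq_zero]
      ring_nf
  have hP3 := congrArg (fun n : ℕ => q * n) hP1
  rw [Nat.card_congr (Equiv.subtypeProdEquivSigmaSubtype
    fun (v : ι → K) (c : C) => (v + (c : ι → K)) ⬝ᵥ (v + (c : ι → K)) = 0), Nat.card_sigma,
    Nat.cast_sum,
    Finset.mul_sum, Finset.sum_congr rfl fun v _ => hP2 v, ← Finset.mul_sum, Nat.cast_mul] at hP3
  have hC0 : (Nat.card C : ℝ) ≠ 0 := Nat.cast_ne_zero.2 Nat.card_pos.ne'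
  have hsum : (∑ v : ι → K, if v ∈ dual C then (if v ⬝ᵥ v = 0 then q else 0) else 1) =
      q * Nat.card {v // v ∈ dual C ∧ v ⬝ᵥ v = 0} + (q ^ Fintype.card ι - Nat.card (dual C)) := by
    have : ∀ v : ι → K, (if v ∈ dual C then (if v ⬝ᵥ v = 0 then q else 0) else 1) =
        (if v ∈ dual C ∧ v ⬝ᵥ v = 0 then q else 0) + (1 - if v ∈ dual C then 1 else 0) := by
      intro v
      by_cases h1 : v ∈ dual C <;> by_cases h2 : v ⬝ᵥ v = 0 <;> simp [h1, h2]
    rw [Finset.sum_congr rfl fun v _ => this v, Finset.sum_add_distrib, Finset.sum_sub_distrib,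
      ← Finset.sum_filter, ← Finset.sum_filter, Finset.sum_const, Finset.sum_const,
      Finset.sum_const, ← Fintype.card_subtype, ← Fintype.card_subtype, Finset.card_univ,
      ← Nat.card_eq_fintype_card, ← Nat.card_eq_fintype_card, ← Nat.card_eq_fintype_card,
      Nat.card_fun, Nat.card_eq_fintype_card (α := ι)]
    simp only [nsmul_eq_mul, mul_one, Nat.cast_pow, ← hq]
    rw [mul_comm q]
  rw [hsum] at hP3
  have hdual : (Nat.card (dual C) : ℝ) = q ^ (Fintype.card ι - Module.finrank K C) := by
    rw [card_submodule, Nat.cast_pow, ← finrank_dual C, Nat.add_sub_cancel]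
  rw [hdual] at hP3
  refine mul_left_cancel₀ hC0 ?_
  linear_combination hP3 + (Nat.card C : ℝ) * hZ

/-- A vector may be adjoined exactly when it is isotropic, lies in the dual and is not in `C`. All
of `C` is among the isotropic vectors of its dual, so its size is subtracted. -/
theorem card_isotropic_extension (hK : ringChar K ≠ 2) (C : Submodule K (ι → K))
    (hC : C ≤ dual C) :
    (Nat.card {v // v ∉ C ∧ C ⊔ K ∙ v ≤ dual (C ⊔ K ∙ v)} : ℝ) =
      ((Nat.card K : ℝ) ^ (Fintype.card ι - Module.finrank K C) +
        zeroCorrection K (Fintype.card ι)) / Nat.card K - (Nat.card K : ℝ) ^ Module.finrank K C := by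
  classical
  have := Fintype.ofFinite K
  have hq : (Nat.card K : ℝ) ≠ 0 := Nat.cast_ne_zero.2 Nat.card_pos.ne'
  have hiff : ∀ v, C ⊔ K ∙ v ≤ dual (C ⊔ K ∙ v) ↔ v ∈ dual C ∧ v ⬝ᵥ v = 0 := by
    intro v
    constructor
    · intro h
      have hv : v ∈ dual (C ⊔ K ∙ v) :=
        h (Submodule.mem_sup_right (Submodule.mem_span_singleton_self v))
      exact ⟨dual_anti le_sup_left hv,
        hv v (Submodule.mem_sup_right (Submodule.mem_span_singleton_self v))⟩
    · rintro ⟨h1, h2⟩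
      have h3 : K ∙ v ≤ dual C := (Submodule.span_singleton_le_iff_mem _ _).2 h1
      have h4 : K ∙ v ≤ dual (K ∙ v) := by
        rw [Submodule.span_singleton_le_iff_mem, mem_dual_span]
        simpa using h2
      have h5 : ∀ A : Submodule K (ι → K), A ≤ dual C → A ≤ dual (K ∙ v) →
          A ≤ dual (C ⊔ K ∙ v) := by
        intro A ha hb
        rw [le_dual_comm] at ha hb ⊢
        exact sup_le ha hb
      exact sup_le (h5 _ hC (le_dual_comm.1 h3)) (h5 _ h3 h4)
  have hsplit : Nat.card {v // v ∈ dual C ∧ v ⬝ᵥ v = 0} =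
      Nat.card C + Nat.card {v // v ∉ C ∧ C ⊔ K ∙ v ≤ dual (C ⊔ K ∙ v)} := by
    rw [← Nat.card_sum]
    refine Nat.card_congr ((Equiv.sumCompl fun v : {v // v ∈ dual C ∧ v ⬝ᵥ v = 0} =>
      v.1 ∈ C).symm.trans (Equiv.sumCongr ?_ ?_))
    · exact (Equiv.subtypeSubtypeEquivSubtype fun {v} hv => ⟨hC hv, hC hv v hv⟩)
    · exact (Equiv.subtypeSubtypeEquivSubtypeInter _ fun v => v ∉ C).trans
        (Equiv.subtypeEquivRight fun v => by rw [hiff, and_comm])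
  have h := card_isotropic_dual hK C hC
  rw [hsplit, Nat.cast_add, card_submodule, Nat.cast_pow] at h
  rw [← h]
  field_simp
  ring

theorem prod_pow_sub_pow (q : ℝ) (s : ℕ) : ∏ i ∈ Finset.range s, (q ^ s - q ^ i) =
    (∏ i ∈ Finset.range s, q ^ i) * ∏ j ∈ Finset.Icc 1 s, (q ^ j - 1) := by
  have h : ∏ j ∈ Finset.Icc 1 s, (q ^ j - 1) = ∏ i ∈ Finset.range s, (q ^ (s - i) - 1) := by
    have h1 : Finset.Icc 1 s = Finset.Ico 1 (s + 1) := rfl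
    rw [← Finset.prod_range_reflect, h1, Finset.prod_Ico_eq_prod_range, Nat.add_sub_cancel]
    refine Finset.prod_congr rfl fun i hi => ?_
    rw [Finset.mem_range] at hi
    congr 2
    omega
  rw [h, ← Finset.prod_mul_distrib]
  refine Finset.prod_congr rfl fun i hi => ?_
  rw [mul_sub, ← pow_add, mul_one]
  congr 2
  have := Finset.mem_range.1 hi
  omega

/-- Neighbouring factors pair up as `(q^b + ν)(q^b - ν) = q^(2b) - 1`. The unpaired outer two give
the special factor of `sigma` for even length. -/
theorem prod_even_type (q ν : ℝ) (hν : ν ^ 2 = 1) (m s : ℕ) (hs : s + 1 ≤ m) :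
    ∏ i ∈ Finset.range (s + 1), ((q ^ (m - i) - ν) * (q ^ (m - i - 1) + ν)) =
      (q ^ (2 * m - (s + 1)) - ν * q ^ (m - (s + 1)) + ν * q ^ m - 1) *
        ∏ i ∈ Finset.Icc 1 s, (q ^ (2 * m - 2 * i) - 1) := by
  have key : ∀ a b : ℕ, q ^ (a + b) - ν * q ^ b + ν * q ^ a - 1 = (q ^ a - ν) * (q ^ b + ν) := by
    intro a b
    rw [pow_add]
    linear_combination hν
  have h : 2 * m - (s + 1) = m + (m - (s + 1)) := by omega
  rw [h, key]
  clear h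
  induction s with
  | zero => simp
  | succ s ih =>
    rw [Finset.prod_range_succ, ih (by omega), Finset.prod_Icc_succ_top (by omega)]
    have h1 : 2 * m - 2 * (s + 1) = (m - (s + 1)) + (m - (s + 1)) := by omega
    have h2 : m - (s + 1) - 1 = m - (s + 1 + 1) := by omega
    rw [h1, h2, pow_add]
    linear_combination (-(q ^ m - ν) * (q ^ (m - (s + 1 + 1)) + ν) *
      ∏ i ∈ Finset.Icc 1 s, (q ^ (2 * m - 2 * i) - 1)) * hν

/-- The number of self-orthogonal codes of given dimension over a finite field of odd
characteristic. -/
theorem card_isotropic (hK : ringChar K ≠ 2) (s : ℕ) :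
    (Nat.card {C : Submodule K (ι → K) // C ≤ dual C ∧ Module.finrank K C = s} : ℝ) =
      sigma K (Fintype.card ι) s := by
  have := Fintype.ofFinite K
  set n := Fintype.card ι with hn
  have hq1 : (1 : ℝ) < Nat.card K := by exact_mod_cast Finite.one_lt_card
  have hfam := card_family (fun C : Submodule K (ι → K) => C ≤ dual C) bot_le
    (fun A B hAB hB => hAB.trans (hB.trans (dual_anti hAB)))
    (fun i => ((Nat.card K : ℝ) ^ (n - i) + zeroCorrection K n) / Nat.card K -
      (Nat.card K : ℝ) ^ i) s (card_isotropic_extension hK)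
  rw [prod_pow_sub_pow] at hfam
  -- A self-orthogonal code has at most half the length as dimension, which matches the zero branch
  -- of `sigma`.
  by_cases hsn : n / 2 < s
  · have : IsEmpty {C : Submodule K (ι → K) // C ≤ dual C ∧ Module.finrank K C = s} :=
      ⟨fun C => by
        have h1 := two_mul_finrank_le C.2.1
        rw [C.2.2] at h1
        omega⟩
    have hs0 : s ≠ 0 := by omega
    simp [sigma, hs0, hsn]
  set q : ℝ := (Nat.card K : ℝ) with hqd
  have hq0 : q ≠ 0 := by positivity
  have hD1 : ∏ i ∈ Finset.range s, q ^ i ≠ 0 := Finset.prod_ne_zero_iff.2 fun i _ => by positivity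
  have hD2 : ∏ j ∈ Finset.Icc 1 s, (q ^ j - 1) ≠ 0 := Finset.prod_ne_zero_iff.2 fun j hj => by
    have := one_lt_pow₀ hq1 (n := j) (by rw [Finset.mem_Icc] at hj; omega)
    linarith
  rcases Nat.eq_zero_or_pos s with rfl | hs
  · simp only [Finset.prod_range_zero, one_mul] at hfam
    simpa [sigma] using hfam
  suffices h : ∏ i ∈ Finset.range s, ((q ^ (n - i) + zeroCorrection K n) / q - q ^ i) =
      (∏ i ∈ Finset.range s, q ^ i) * (sigma K n s * ∏ j ∈ Finset.Icc 1 s, (q ^ j - 1)) by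
    rw [h] at hfam
    refine mul_right_cancel₀ hD2 (mul_left_cancel₀ hD1 ?_)
    linear_combination hfam
  unfold sigma
  rw [if_neg hs.ne', if_neg hsn]
  split_ifs with hodd
  · rw [div_mul_cancel₀ _ hD2, ← Finset.prod_mul_distrib]
    refine Finset.prod_congr rfl fun i hi => ?_
    have hi := Finset.mem_range.1 hi
    -- One `q` cancels the denominator and `q^i` splits off, to be matched with the powers of `q` in
    -- the number of bases.
    have h1 : n - i = i + (n - 1 - 2 * i) + 1 := by
      obtain ⟨k, hk⟩ := hodd
      omega
    rw [zeroCorrection, if_neg (Nat.not_even_iff_odd.2 hodd), h1]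
    field_simp
    ring
  · rw [div_mul_cancel₀ _ hD2]
    rw [Nat.not_odd_iff_even] at hodd
    obtain ⟨m, hm⟩ := hodd
    obtain ⟨s, rfl⟩ : ∃ s', s = s' + 1 := ⟨s - 1, by omega⟩
    have h2m : n = 2 * m := by omega
    have hm2 : n / 2 = m := by omega
    rw [zeroCorrection, if_pos ⟨m, hm⟩, hm2, Nat.add_sub_cancel, h2m]
    have hν : nu K (2 * m) ^ 2 = 1 := by
      rw [nu_eq_pow, ← pow_mul, mul_comm, pow_mul, nu_two_sq, one_pow]
    -- Each extension count factors as `q^i (q^(m-i) - ν)(q^(m-i-1) + ν)`; this is checked factor by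
    -- factor.
    rw [← prod_even_type q _ hν m s (by omega), ← Finset.prod_mul_distrib]
    refine Finset.prod_congr rfl fun i hi => ?_
    have hi := Finset.mem_range.1 hi
    obtain ⟨d, rfl⟩ : ∃ d, m = i + d + 1 := ⟨m - i - 1, by omega⟩
    have h1 : 2 * (i + d + 1) - i = i + d + d + 1 + 1 := by omega
    have h2 : i + d + 1 - i = d + 1 := by omega
    rw [h1, h2, Nat.add_sub_cancel, ← hqd]
    generalize nu K (2 * (i + d + 1)) = ν at hν
    have h3 : (q ^ (i + d + d + 1 + 1) + ν * ((q - 1) * q ^ (i + d + 1))) / q =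
        q ^ (i + d + d + 1) + ν * ((q - 1) * q ^ (i + d)) := by
      field_simp
      ring
    rw [h3]
    linear_combination q ^ i * hν

end Isotropic

/-! ### Gaussian binomials -/

section Gauss

variable {K V : Type*} [Field K] [Finite K] [AddCommGroup V] [Module K V] [Finite V]

theorem card_subspaces_le (D : Submodule K V) (s : ℕ) :
    (Nat.card {A : Submodule K V // A ≤ D ∧ Module.finrank K A = s} : ℝ) =
      gaussBinom (Nat.card K) (Module.finrank K D) s := by
  have hq1 : (1 : ℝ) < Nat.card K := by exact_mod_cast Finite.one_lt_card
  have := card_family (fun A : Submodule K V => A ≤ D) bot_le (fun A B h h' => h.trans h')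
    (fun i => (Nat.card K : ℝ) ^ Module.finrank K D - (Nat.card K : ℝ) ^ i) s (fun A hA => by
      have hsplit : Nat.card D = Nat.card A + Nat.card {v // v ∉ A ∧ A ⊔ K ∙ v ≤ D} := by
        classical
        rw [← Nat.card_sum]
        refine Nat.card_congr ((Equiv.sumCompl fun v : D => v.1 ∈ A).symm.trans
          (Equiv.sumCongr ?_ ?_))
        · exact (Equiv.subtypeSubtypeEquivSubtype fun {v} hv => hA hv)
        · exact (Equiv.subtypeSubtypeEquivSubtypeInter _ fun v => v ∉ A).trans
            (Equiv.subtypeEquivRight fun v => by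
              simp [hA, and_comm])
      rw [card_submodule, card_submodule] at hsplit
      have h := congrArg (Nat.cast (R := ℝ)) hsplit
      push_cast at h
      linear_combination -h)
  rw [gaussBinom, eq_div_iff, this]
  refine Finset.prod_ne_zero_iff.2 fun i hi => ?_
  have := pow_lt_pow_right₀ hq1 (Finset.mem_range.1 hi)
  linarith

/-- Passing to the quotient by `B` reduces this to subspaces of the image of `D`. -/
theorem card_subspaces_between {B D : Submodule K V} (hBD : B ≤ D) (s : ℕ) :
    (Nat.card {A : Submodule K V // B ≤ A ∧ A ≤ D ∧
      Module.finrank K A = Module.finrank K B + s} : ℝ) =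
        gaussBinom (Nat.card K) (Module.finrank K D - Module.finrank K B) s := by
  have : Finite (V ⧸ B) := Quotient.finite _
  have hfin : ∀ A : Submodule K V, B ≤ A →
      Module.finrank K (A.map B.mkQ) + Module.finrank K B = Module.finrank K A := by
    intro A hA
    have h := LinearMap.finrank_range_add_finrank_ker (B.mkQ.domRestrict A)
    rw [LinearMap.range_domRestrict] at h
    rw [← h]
    congr 1
    have : LinearMap.ker (B.mkQ.domRestrict A) = B.comap A.subtype := by
      ext x
      simp
    rw [this]
    exact (LinearEquiv.finrank_eq (Submodule.comapSubtypeEquivOfLe hA)).symm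
  have hD := hfin D hBD
  rw [← hD, Nat.add_sub_cancel, ← card_subspaces_le]
  congr 1
  refine Nat.card_congr
    { toFun := fun A => ⟨A.1.map B.mkQ, Submodule.map_mono A.2.2.1, by
        have h1 := hfin A.1 A.2.1
        have h2 := A.2.2.2
        omega⟩
      invFun := fun A => ⟨A.1.comap B.mkQ, Submodule.le_comap_mkQ _ _, ?_, ?_⟩
      left_inv := fun A => Subtype.ext ?_
      right_inv := fun A => Subtype.ext ?_ }
  · refine (Submodule.comap_mono A.2.1).trans ?_
    rw [Submodule.comap_map_mkQ]
    exact sup_le hBD le_rfl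
  · have h1 := hfin (A.1.comap B.mkQ) (Submodule.le_comap_mkQ _ _)
    rw [Submodule.map_comap_eq_of_surjective B.mkQ_surjective, A.2.2] at h1
    omega
  · simp only [Submodule.comap_map_mkQ]
    exact sup_eq_right.2 A.2.1
  · exact Submodule.map_comap_eq_of_surjective B.mkQ_surjective _

end Gauss

/-! ### Submodules with prescribed image and kernel part -/

section Extensions

variable {R M V : Type*} [CommRing R] [AddCommGroup M] [Module R M] [AddCommGroup V] [Module R V]

/-- Submodules `C` with given `f(C)` and `C ∩ ker f`, counted through lifts of generators of
`f(C)`. -/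
theorem card_extensions [Finite M] (f : M →ₗ[R] V) (U : Submodule R M) (hU : U ≤ LinearMap.ker f)
    {k : ℕ} (b : Fin k → V)
    (h : ∀ m : Fin k → M, (∀ i, f (m i) = b i) → ∀ r : Fin k → R, ∑ i, r i • b i = 0 →
      ∑ i, r i • m i ∈ U) (P : Submodule R M → Prop) :
    Nat.card {m : Fin k → M // (∀ i, f (m i) = b i) ∧
        P (U ⊔ Submodule.span R (Set.range m))} =
      Nat.card {C : Submodule R M // C.map f = Submodule.span R (Set.range b) ∧
        C ⊓ LinearMap.ker f = U ∧ P C} * Nat.card U ^ k := by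
  have hfin : Finite (Submodule R M) :=
    Finite.of_injective (fun C => (C : Set M)) SetLike.coe_injective
  have hmap : ∀ m : Fin k → M, (∀ i, f (m i) = b i) →
      (U ⊔ Submodule.span R (Set.range m)).map f = Submodule.span R (Set.range b) := by
    intro m hm
    have hbot : U.map f = ⊥ := (Submodule.map_le_iff_le_comap.2 hU).antisymm bot_le
    rw [Submodule.map_sup, hbot, bot_sup_eq, Submodule.map_span, ← Set.range_comp]
    congr 2
    exact funext hm
  have hker : ∀ m : Fin k → M, (∀ i, f (m i) = b i) →
      -- The `b i` need not be free over `R`. Hypothesis `h` makes every relation among them lift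
      -- into `U`, so adjoining the lifts adds nothing to the kernel.
      (U ⊔ Submodule.span R (Set.range m)) ⊓ LinearMap.ker f = U := by
    intro m hm
    refine le_antisymm ?_ (le_inf le_sup_left hU)
    rintro c ⟨hc, hfc⟩
    obtain ⟨u, hu, w, hw, rfl⟩ := Submodule.mem_sup.1 hc
    obtain ⟨r, rfl⟩ := (Submodule.mem_span_range_iff_exists_fun R).1 hw
    refine U.add_mem hu (h m hm r ?_)
    rw [SetLike.mem_coe, LinearMap.mem_ker, map_add, LinearMap.mem_ker.1 (hU hu), zero_add, map_sum] at hfc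
    simpa [hm] using hfc
  have hgen : ∀ C : Submodule R M, C.map f = Submodule.span R (Set.range b) →
      C ⊓ LinearMap.ker f = U → ∀ m : Fin k → M, (∀ i, f (m i) = b i) → (∀ i, m i ∈ C) →
      U ⊔ Submodule.span R (Set.range m) = C := by
    intro C hC hCU m hm hmC
    refine le_antisymm (sup_le (hCU ▸ inf_le_left) ?_) fun c hc => ?_
    · rw [Submodule.span_le]
      rintro _ ⟨i, rfl⟩
      exact hmC i
    · have hfc : f c ∈ Submodule.span R (Set.range b) := hC ▸ Submodule.mem_map_of_mem hc
      obtain ⟨r, hr⟩ := (Submodule.mem_span_range_iff_exists_fun R).1 hfc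
      have hu : c - ∑ i, r i • m i ∈ U := by
        rw [← hCU]
        refine ⟨C.sub_mem hc (C.sum_mem fun i _ => C.smul_mem _ (hmC i)), ?_⟩
        rw [SetLike.mem_coe, LinearMap.mem_ker, map_sub, map_sum, ← hr]
        simp [hm]
      rw [← sub_add_cancel c (∑ i, r i • m i)]
      exact Submodule.add_mem_sup hu (Submodule.sum_mem _ fun i _ =>
        Submodule.smul_mem _ _ (Submodule.subset_span ⟨i, rfl⟩))
  -- The fibre over `C` consists of all lifts inside `C`; two of them differ by a tuple of elements
  -- of `C ⊓ ker f = U`.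
  refine card_eq_mul_of_fibers (fun m => ⟨U ⊔ Submodule.span R (Set.range m.1),
    hmap m.1 m.2.1, hker m.1 m.2.1, m.2.2⟩) _ ?_
  rintro ⟨C, hC, hCU, hP⟩
  have hex : ∀ i, ∃ c ∈ C, f c = b i := fun i => by
    have : b i ∈ C.map f := hC ▸ Submodule.subset_span ⟨i, rfl⟩
    exact this
  choose m₀ hm₀ hfm₀ using hex
  have hpow : Nat.card U ^ k = Nat.card (Fin k → U) := by
    rw [Nat.card_fun, Nat.card_eq_fintype_card (α := Fin k), Fintype.card_fin]
  rw [hpow]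
  have hUC : U ≤ C := hCU ▸ inf_le_left
  refine Nat.card_congr
    { toFun := fun m i => ⟨m.1.1 i - m₀ i, ?_⟩
      invFun := fun u => ⟨⟨fun i => u i + m₀ i, ?_, ?_⟩, ?_⟩
      left_inv := fun m => ?_
      right_inv := fun u => ?_ }
  · have hm := congrArg Subtype.val m.2
    simp only at hm
    refine hCU.le ⟨C.sub_mem ?_ (hm₀ i), ?_⟩
    · exact hm.le (Submodule.mem_sup_right (Submodule.subset_span ⟨i, rfl⟩))
    · rw [SetLike.mem_coe, LinearMap.mem_ker, map_sub, m.1.2.1, hfm₀, sub_self]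
  · intro i
    rw [map_add, hfm₀, LinearMap.mem_ker.1 (hU (u i).2), zero_add]
  · rwa [hgen C hC hCU _ (fun i => by
      rw [map_add, hfm₀, LinearMap.mem_ker.1 (hU (u i).2), zero_add])
      fun i => C.add_mem (hUC (u i).2) (hm₀ i)]
  · exact Subtype.ext (hgen C hC hCU _ (fun i => by
      rw [map_add, hfm₀, LinearMap.mem_ker.1 (hU (u i).2), zero_add])
      fun i => C.add_mem (hUC (u i).2) (hm₀ i))
  · ext i
    simp
  · ext i
    simp

end Extensions

/-! ### Submodules over `R` seen over `K` -/

/-- A submodule over a ring that surjects onto `K`, seen over `K`. -/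
def overField {R K W : Type*} [CommRing R] [CommRing K] [Algebra R K] [AddCommGroup W]
    [Module R W] [Module K W] [IsScalarTower R K W]
    (hs : Function.Surjective (algebraMap R K)) (A : Submodule R W) : Submodule K W where
  __ := A.toAddSubmonoid
  smul_mem' := fun c x hx => by
    obtain ⟨r, rfl⟩ := hs c
    rw [algebraMap_smul]
    exact A.smul_mem r hx

section OverField

variable {R K W : Type*} [CommRing R] [CommRing K] [Algebra R K] [AddCommGroup W]
  [Module R W] [Module K W] [IsScalarTower R K W] (hs : Function.Surjective (algebraMap R K))

theorem overField_eq_iff {A : Submodule R W} {B : Submodule K W} :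
    overField hs A = B ↔ A = B.restrictScalars R := by
  rw [SetLike.ext_iff, SetLike.ext_iff]
  rfl

theorem overField_span (s : Set W) :
    overField hs (Submodule.span R s) = Submodule.span K s := by
  refine le_antisymm (fun x hx => ?_) (Submodule.span_le.2 Submodule.subset_span)
  have : Submodule.span R s ≤ (Submodule.span K s).restrictScalars R :=
    Submodule.span_le.2 Submodule.subset_span
  exact this hx

end OverField

/-- `g : K → R` behaves like multiplication by a generator of the maximal ideal of a chain ring of
nilpotency index `2` with residue field `K`. -/
structure IsSocleEmbedding {R K : Type*} [CommRing R] [CommRing K] [Algebra R K]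
    (g : K →ₗ[R] R) : Prop where
  surjective : Function.Surjective (algebraMap R K)
  injective : Function.Injective g
  exact_iff : ∀ x, algebraMap R K x = 0 ↔ ∃ k, g k = x

/-! ### Mixed codes, their torsion codes and the bilinear form -/

section Codes

variable {R K : Type*} [CommRing R] [Field K] [Algebra R K] {ι κ : Type*}
  (g : K →ₗ[R] R)

variable (ι κ) in
/-- Reduction of the first block of coordinates. -/
def red : (ι → R) × (κ → K) →ₗ[R] (ι → K) where
  toFun m i := algebraMap R K (m.1 i)
  map_add' _ _ := by ext; simp
  map_smul' _ _ := by ext; simp [Algebra.smul_def]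

theorem red_apply (m : (ι → R) × (κ → K)) (i : ι) : red ι κ m i = algebraMap R K (m.1 i) := rfl

variable (ι κ) in
/-- The embedding of the words whose first block reduces to zero. -/
def emb : (ι → K) × (κ → K) →ₗ[R] (ι → R) × (κ → K) where
  toFun w := (fun i => g (w.1 i), w.2)
  map_add' _ _ := by ext <;> simp
  map_smul' _ _ := by ext <;> simp

theorem emb_apply (w : (ι → K) × (κ → K)) : emb ι κ g w = (fun i => g (w.1 i), w.2) := rfl

variable {g}

theorem mul_socle (r : R) (k : K) : r * g k = g (algebraMap R K r * k) := by
  rw [← smul_eq_mul, ← map_smul, Algebra.smul_def]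

section

variable (hg : IsSocleEmbedding g)
include hg

theorem algebraMap_socle (k : K) : algebraMap R K (g k) = 0 := (hg.exact_iff _).2 ⟨k, rfl⟩

theorem red_emb (w : (ι → K) × (κ → K)) : red ι κ (emb ι κ g w) = 0 :=
  funext fun _ => algebraMap_socle hg _

theorem emb_injective : Function.Injective (emb ι κ g) := by
  intro v w h
  refine Prod.ext (funext fun i => hg.injective ?_) (Prod.ext_iff.1 h).2
  exact congrFun (Prod.ext_iff.1 h).1 i

theorem exists_emb {m : (ι → R) × (κ → K)} (hm : red ι κ m = 0) : ∃ w, emb ι κ g w = m := by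
  have h : ∀ i, ∃ k, g k = m.1 i := fun i => (hg.exact_iff _).1 (congrFun hm i)
  choose z hz using h
  exact ⟨(z, m.2), Prod.ext (funext hz) rfl⟩

theorem ker_red : LinearMap.ker (red ι κ) = LinearMap.range (emb ι κ g) := by
  ext m
  refine ⟨fun h => exists_emb hg h, ?_⟩
  rintro ⟨w, rfl⟩
  exact red_emb hg w

/-- A scalar from the socle sees only the reduction of the first block and annihilates the second
block. -/
theorem socle_smul (s : K) (m : (ι → R) × (κ → K)) :
    g s • m = emb ι κ g (s • red ι κ m, 0) := by
  refine Prod.ext (funext fun i => ?_) (funext fun j => ?_)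
  · simp only [Prod.smul_fst, Pi.smul_apply, smul_eq_mul, emb_apply, red_apply]
    rw [mul_comm, mul_socle, mul_comm]
  · simp [emb_apply, Algebra.smul_def, algebraMap_socle hg]

end

/-- The first torsion code of the first block. -/
def tor₁ (hg : IsSocleEmbedding g) (C : Submodule R ((ι → R) × (κ → K))) : Submodule K (ι → K) :=
  overField hg.surjective (C.map (red ι κ))

/-- The words of `C` whose first block reduces to zero. -/
def kerPart (hg : IsSocleEmbedding g) (C : Submodule R ((ι → R) × (κ → K))) :
    Submodule K ((ι → K) × (κ → K)) :=
  overField hg.surjective (C.comap (emb ι κ g))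

/-- The second torsion code of the first block. -/
def tor₂ (hg : IsSocleEmbedding g) (C : Submodule R ((ι → R) × (κ → K))) : Submodule K (ι → K) :=
  (kerPart hg C).comap (LinearMap.inl K _ _)

/-- The torsion code of the second block. -/
def tor₃ (hg : IsSocleEmbedding g) (C : Submodule R ((ι → R) × (κ → K))) : Submodule K (κ → K) :=
  (kerPart hg C).map (LinearMap.snd K _ _)

variable (hg : IsSocleEmbedding g) {C : Submodule R ((ι → R) × (κ → K))}

theorem mem_tor₂ {z : ι → K} : z ∈ tor₂ hg C ↔ emb ι κ g (z, 0) ∈ C := Iff.rfl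

theorem mem_tor₃ {y : κ → K} : y ∈ tor₃ hg C ↔ ∃ z, emb ι κ g (z, y) ∈ C := by
  constructor
  · rintro ⟨⟨z, y⟩, hw, rfl⟩
    exact ⟨z, hw⟩
  · rintro ⟨z, hz⟩
    exact ⟨(z, y), hz, rfl⟩

/-- Multiply a word by `g 1`, the analogue of `γ`. -/
theorem tor₁_le_tor₂ : tor₁ hg C ≤ tor₂ hg C := by
  rintro _ ⟨m, hm, rfl⟩
  rw [mem_tor₂]
  have := socle_smul hg 1 m
  rw [one_smul] at this
  rw [← this]
  exact C.smul_mem _ hm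

theorem kerPart_eq_iff {U : Submodule K ((ι → K) × (κ → K))} :
    kerPart hg C = U ↔
      C ⊓ LinearMap.ker (red ι κ) = (U.restrictScalars R).map (emb ι κ g) := by
  rw [kerPart, overField_eq_iff, ker_red hg, inf_comm, ← Submodule.map_comap_eq]
  exact (Submodule.map_injective_of_injective (emb_injective hg)).eq_iff.symm

variable [Fintype ι] [Fintype κ]

section Form

variable (g)

/-- The bilinear form `∑ cᵢ c'ᵢ + g (∑ dⱼ d'ⱼ)`. -/
def form (m m' : (ι → R) × (κ → K)) : R := m.1 ⬝ᵥ m'.1 + g (m.2 ⬝ᵥ m'.2)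

/-- Self-orthogonality with respect to `form`. -/
def IsSelfOrth (C : Submodule R ((ι → R) × (κ → K))) : Prop :=
  ∀ m ∈ C, ∀ m' ∈ C, form g m m' = 0

theorem form_comm (m m' : (ι → R) × (κ → K)) : form g m m' = form g m' m := by
  rw [form, form, dotProduct_comm, dotProduct_comm m.2]

theorem form_add_left (m m' n : (ι → R) × (κ → K)) :
    form g (m + m') n = form g m n + form g m' n := by
  simp only [form, Prod.fst_add, Prod.snd_add, add_dotProduct, map_add]
  ring

theorem form_smul_left (r : R) (m n : (ι → R) × (κ → K)) :
    form g (r • m) n = r * form g m n := by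
  simp only [form, Prod.smul_fst, Prod.smul_snd, smul_dotProduct, map_smul, smul_eq_mul, mul_add]

theorem form_zero_left (n : (ι → R) × (κ → K)) : form g 0 n = 0 := by
  simp [form]

theorem isSelfOrth_span {s : Set ((ι → R) × (κ → K))} :
    IsSelfOrth g (Submodule.span R s) ↔ ∀ m ∈ s, ∀ m' ∈ s, form g m m' = 0 := by
  refine ⟨fun h m hm m' hm' => h m (Submodule.subset_span hm) m' (Submodule.subset_span hm'),
    fun h m hm m' hm' => ?_⟩
  have key : ∀ n, (∀ x ∈ s, form g x n = 0) → ∀ x ∈ Submodule.span R s, form g x n = 0 := by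
    intro n hn x hx
    induction hx using Submodule.span_induction with
    | mem x hx => exact hn x hx
    | zero => exact form_zero_left g n
    | add x y _ _ hx hy => rw [form_add_left, hx, hy, add_zero]
    | smul a x _ hx => rw [form_smul_left, hx, mul_zero]
  refine key m' (fun x hx => ?_) m hm
  rw [form_comm]
  exact key x (fun y hy => h y hy x hx) m' hm'

end Form

theorem socle_sum_mul (z : ι → K) (x : ι → R) :
    (fun i => g (z i)) ⬝ᵥ x = g (z ⬝ᵥ fun i => algebraMap R K (x i)) := by
  simp only [dotProduct, map_sum]
  refine Finset.sum_congr rfl fun i _ => ?_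
  rw [mul_comm, mul_socle, mul_comm]

/-- Pairing with a word of the kernel lands in the socle and is a plain dot product over `K`. All
orthogonality conditions become linear algebra through this identity. -/
theorem form_emb (w : (ι → K) × (κ → K)) (m : (ι → R) × (κ → K)) :
    form g (emb ι κ g w) m = g (w.1 ⬝ᵥ red ι κ m + w.2 ⬝ᵥ m.2) := by
  rw [form, emb_apply, socle_sum_mul, map_add]
  rfl

theorem tor₂_le_dual (hC : IsSelfOrth g C) : tor₂ hg C ≤ dual (tor₁ hg C) := by
  rintro z hz _ ⟨m, hm, rfl⟩
  have := hC _ hz m hm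
  rw [LinearMap.inl_apply, form_emb, zero_dotProduct, add_zero] at this
  exact hg.injective (this.trans (map_zero g).symm)

theorem tor₁_le_dual (hC : IsSelfOrth g C) : tor₁ hg C ≤ dual (tor₁ hg C) :=
  (tor₁_le_tor₂ hg).trans (tor₂_le_dual hg hC)

/-- For two words of the kernel the first blocks contribute nothing, since products of socle
elements vanish; only the second blocks remain. -/
theorem tor₃_le_dual (hC : IsSelfOrth g C) : tor₃ hg C ≤ dual (tor₃ hg C) := by
  intro y hy y' hy'
  obtain ⟨z, hz⟩ := (mem_tor₃ hg).1 hy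
  obtain ⟨z', hz'⟩ := (mem_tor₃ hg).1 hy'
  have := hC _ hz _ hz'
  rw [form_emb, red_emb hg, dotProduct_zero, zero_add] at this
  exact hg.injective (this.trans (map_zero g).symm)

theorem finrank_tor_le (hC : IsSelfOrth g C) :
    Module.finrank K (tor₁ hg C) + Module.finrank K (tor₂ hg C) ≤ Fintype.card ι ∧
      2 * Module.finrank K (tor₃ hg C) ≤ Fintype.card κ := by
  have h1 := finrank_dual (tor₁ hg C)
  have h2 := Submodule.finrank_mono (tor₂_le_dual hg hC)
  exact ⟨by omega, two_mul_finrank_le (tor₃_le_dual hg hC)⟩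

end Codes

/-! ### The kernel part `U` and the second block -/

section KernelParts

variable {K : Type*} [Field K] {ι κ : Type*} [Fintype ι] [Fintype κ]

theorem finrank_kernel (U : Submodule K ((ι → K) × (κ → K))) :
    Module.finrank K U = Module.finrank K (U.comap (LinearMap.inl K (ι → K) (κ → K))) +
      Module.finrank K (U.map (LinearMap.snd K (ι → K) (κ → K))) := by
  have h := LinearMap.finrank_range_add_finrank_ker
    ((LinearMap.snd K (ι → K) (κ → K)).domRestrict U)
  rw [LinearMap.range_domRestrict] at h
  rw [← h, add_comm]
  congr 1
  refine LinearEquiv.finrank_eq (LinearEquiv.ofBijective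
    (M₂ := U.comap (LinearMap.inl K (ι → K) (κ → K)))
    (LinearMap.codRestrict _ ((LinearMap.fst K _ _) ∘ₗ U.subtype ∘ₗ Submodule.subtype _) ?_)
    ⟨?_, ?_⟩)
  · rintro ⟨⟨⟨x, y⟩, hu⟩, hy⟩
    obtain rfl : y = 0 := hy
    exact hu
  · rintro ⟨⟨⟨x, y⟩, hu⟩, hy⟩ ⟨⟨⟨x', y'⟩, hu'⟩, hy'⟩ h
    obtain rfl : y = 0 := hy
    obtain rfl : y' = 0 := hy'
    obtain rfl : x = x' := congrArg Subtype.val h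
    rfl
  · rintro ⟨x, hx⟩
    exact ⟨⟨⟨(x, 0), hx⟩, rfl⟩, rfl⟩

variable [Finite K]

/-- Such a `U` is generated by `B` and lifts `(z i, b i)` of a basis of `D`. The `z i` are
arbitrary, and each matters only modulo `B`. -/
theorem card_kernels (B : Submodule K (ι → K)) (D : Submodule K (κ → K)) :
    Nat.card {U : Submodule K ((ι → K) × (κ → K)) //
        U.comap (LinearMap.inl K _ _) = B ∧ U.map (LinearMap.snd K _ _) = D} *
      Nat.card K ^ (Module.finrank K B * Module.finrank K D) =
        Nat.card K ^ (Fintype.card ι * Module.finrank K D) := by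
  have := Fintype.ofFinite K
  obtain ⟨d, hd⟩ : ∃ d, Module.finrank K D = d := ⟨_, rfl⟩
  rw [hd]
  obtain ⟨b, hb, rfl⟩ := exists_linearIndependent_span_eq D hd
  have hinl : Function.Injective (LinearMap.inl K (ι → K) (κ → K)) := LinearMap.inl_injective
  have h := card_extensions (LinearMap.snd K (ι → K) (κ → K))
    (B.map (LinearMap.inl K (ι → K) (κ → K))) (by rintro _ ⟨x, _, rfl⟩; rfl) b
    (fun m hm r hr => by
      have hr0 := Fintype.linearIndependent_iff.1 hb r hr
      simp [hr0]) fun _ => True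
  have hU : Nat.card (B.map (LinearMap.inl K (ι → K) (κ → K))) =
      Nat.card K ^ Module.finrank K B := by
    rw [← card_submodule B]
    exact Nat.card_congr (Submodule.equivMapOfInjective _ hinl B).symm.toEquiv
  have hT : Nat.card {m : Fin d → (ι → K) × (κ → K) //
      (∀ i, LinearMap.snd K (ι → K) (κ → K) (m i) = b i) ∧ True} =
      Nat.card K ^ (Fintype.card ι * d) := by
    have e : {m : Fin d → (ι → K) × (κ → K) //
        (∀ i, LinearMap.snd K (ι → K) (κ → K) (m i) = b i) ∧ True} ≃ (Fin d → ι → K) :=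
      { toFun := fun m i => (m.1 i).1
        invFun := fun z => ⟨fun i => (z i, b i), fun _ => rfl, trivial⟩
        left_inv := fun m => Subtype.ext (funext fun i => Prod.ext rfl (m.2.1 i).symm)
        right_inv := fun _ => rfl }
    rw [Nat.card_congr e, Nat.card_fun, Nat.card_fun, ← pow_mul]
    simp
  rw [hT, hU, ← pow_mul] at h
  rw [h]
  congr 1
  refine Nat.card_congr (Equiv.subtypeEquivRight fun U => ?_)
  rw [and_true, and_comm]
  refine and_congr Iff.rfl ?_
  have hker : LinearMap.ker (LinearMap.snd K (ι → K) (κ → K)) =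
      LinearMap.range (LinearMap.inl K (ι → K) (κ → K)) := LinearMap.range_inl K _ _ |>.symm
  rw [hker, inf_comm, ← Submodule.map_comap_eq]
  exact (Submodule.map_injective_of_injective hinl).eq_iff.symm

/-- Since `v` is orthogonal to the words `(z, 0)` of `U`, the value `w.1 ⬝ᵥ v` depends only on
`w.2`. It suffices to impose one affine condition for each basis vector of the projection of `U`. -/
theorem card_second_block (U : Submodule K ((ι → K) × (κ → K))) (v : ι → K)
    (hv : v ∈ dual (U.comap (LinearMap.inl K _ _))) :
    Nat.card {y : κ → K // ∀ w ∈ U, w.1 ⬝ᵥ v + w.2 ⬝ᵥ y = 0} *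
      Nat.card K ^ Module.finrank K (U.map (LinearMap.snd K _ _)) =
        Nat.card K ^ Fintype.card κ := by
  have := Fintype.ofFinite K
  obtain ⟨b, hb, hspan⟩ := exists_linearIndependent_span_eq (U.map (LinearMap.snd K _ _)) rfl
  have hex : ∀ i, ∃ z, (z, b i) ∈ U := fun i => by
    have : b i ∈ U.map (LinearMap.snd K _ _) := hspan ▸ Submodule.subset_span ⟨i, rfl⟩
    obtain ⟨⟨z, y⟩, hw, h⟩ := this
    obtain rfl : y = b i := h
    exact ⟨z, hw⟩
  choose z hz using hex
  have h := card_fiber_mul (dotWith b).toAddMonoidHom (dotWith_surjective hb)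
    fun i => -(z i ⬝ᵥ v)
  rw [Nat.card_fun, Nat.card_fun, Nat.card_eq_fintype_card (α := Fin _), Fintype.card_fin,
    Nat.card_eq_fintype_card (α := κ)] at h
  rw [← h]
  congr 1
  refine Nat.card_congr (Equiv.subtypeEquivRight fun y => ?_)
  rw [funext_iff]
  change _ ↔ ∀ i, y ⬝ᵥ b i = _
  constructor
  · intro hy i
    rw [dotProduct_comm]
    linear_combination hy _ (hz i)
  · rintro hy ⟨x, y'⟩ hw
    have hy' : y' ∈ Submodule.span K (Set.range b) := by
      rw [hspan]
      exact ⟨_, hw, rfl⟩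
    obtain ⟨r, rfl⟩ := (Submodule.mem_span_range_iff_exists_fun K).1 hy'
    have hx : x - ∑ i, r i • z i ∈ U.comap (LinearMap.inl K (ι → K) (κ → K)) := by
      have h1 := U.sub_mem hw (U.sum_mem fun i (_ : i ∈ Finset.univ) => U.smul_mem (r i) (hz i))
      have h2 : (x, ∑ i, r i • b i) - ∑ i, r i • (z i, b i) = (x - ∑ i, r i • z i, 0) := by
        ext <;> simp [Prod.fst_sum, Prod.snd_sum]
      rw [h2] at h1
      exact h1
    have h3 := hv _ hx
    rw [dotProduct_comm, sub_dotProduct, sum_dotProduct, sub_eq_zero] at h3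
    simp only [h3, sum_dotProduct, smul_dotProduct, ← Finset.sum_add_distrib, ← smul_add]
    refine Finset.sum_eq_zero fun i _ => ?_
    rw [dotProduct_comm (b i), hy i, add_neg_cancel, smul_zero]

end KernelParts

/-! ### Self-orthogonal lifts of a basis of the first torsion code -/

section Lifts

variable {R K : Type*} [CommRing R] [Finite R] [Field K] [Finite K] [Algebra R K] {ι κ : Type*}
  [Fintype ι] [Fintype κ] {g : K →ₗ[R] R}

/-- Fix the second block `y` first, then write the first block as `x + g z` with `x` a fixed lift of
`v`. The remaining conditions are `k + 1` affine equations in `z`, one against each vector of an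
independent family, so the number of `z` does not depend on `y`. -/
theorem card_lift (hg : IsSocleEmbedding g) (hK : ringChar K ≠ 2)
    (U : Submodule K ((ι → K) × (κ → K))) {k : ℕ}
    (v : ι → K) (hv : v ∈ dual (U.comap (LinearMap.inl K _ _))) (hvv : v ⬝ᵥ v = 0)
    (m : Fin k → (ι → R) × (κ → K))
    (hb : LinearIndependent K (Fin.cons v fun i => red ι κ (m i) : Fin (k + 1) → ι → K))
    (hvm : ∀ i, v ⬝ᵥ red ι κ (m i) = 0) :
    Nat.card {n : (ι → R) × (κ → K) // red ι κ n = v ∧ (∀ w ∈ U, w.1 ⬝ᵥ v + w.2 ⬝ᵥ n.2 = 0) ∧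
        form g n n = 0 ∧ ∀ i, form g n (m i) = 0} *
      Nat.card K ^ (Module.finrank K (U.map (LinearMap.snd K _ _)) + (k + 1)) =
        Nat.card K ^ (Fintype.card ι + Fintype.card κ) := by
  have := Fintype.ofFinite K
  have hex : ∀ i, ∃ r, algebraMap R K r = v i := fun i => hg.surjective (v i)
  choose x hx using hex
  have hxv : (fun i => algebraMap R K (x i)) = v := funext hx
  have hred : ∀ (a b : ι → R), algebraMap R K (a ⬝ᵥ b) =
      (fun i => algebraMap R K (a i)) ⬝ᵥ fun i => algebraMap R K (b i) := fun a b => by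
    simp [dotProduct]
  -- The products of `x` with itself and with the earlier lifts reduce to zero, so they lie in the
  -- socle and can be divided by `g`.
  obtain ⟨s, hs⟩ := (hg.exact_iff (x ⬝ᵥ x)).1 (by rw [hred, hxv, hvv])
  have hex : ∀ i, ∃ a, g a = x ⬝ᵥ (m i).1 := fun i =>
    (hg.exact_iff _).1 (by rw [hred, hxv]; exact hvm i)
  choose a ha using hex
  have h2 := Ring.two_ne_zero hK
  rw [pow_add, ← mul_assoc, pow_add (Nat.card K) (Fintype.card ι),
    ← card_second_block U v hv, ← mul_assoc, mul_right_comm]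
  congr 1
  rw [mul_comm (_ ^ Fintype.card ι)]
  let F : {n : (ι → R) × (κ → K) // red ι κ n = v ∧ (∀ w ∈ U, w.1 ⬝ᵥ v + w.2 ⬝ᵥ n.2 = 0) ∧
      form g n n = 0 ∧ ∀ i, form g n (m i) = 0} →
      {y : κ → K // ∀ w ∈ U, w.1 ⬝ᵥ v + w.2 ⬝ᵥ y = 0} := fun n => ⟨n.1.2, n.2.2.1⟩
  -- The required values of `z` against `v` and the earlier reductions. The first entry solves `s +
  -- 2 (z ⬝ᵥ v) + y ⬝ᵥ y = 0`, which is where odd characteristic enters.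
  let t : (κ → K) → Fin (k + 1) → K := fun y =>
    Fin.cons (-(s + y ⬝ᵥ y) / 2) fun i => -(a i + y ⬝ᵥ (m i).2)
  have hfib : ∀ y, Nat.card {n // F n = y} = Nat.card {z : ι → K //
      dotWith (Fin.cons v fun i => red ι κ (m i)) z = 0} := by
    intro y
    refine Eq.trans ?_ (card_fiber_ker
      (dotWith (Fin.cons v fun i => red ι κ (m i))).toAddMonoidHom
      (dotWith_surjective hb) (t y.1) 0)
    have hform : ∀ (z : ι → K) (n : (ι → R) × (κ → K)),
        form g ((fun i => x i + g (z i)), y.1) n =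
          x ⬝ᵥ n.1 + g (z ⬝ᵥ red ι κ n + y.1 ⬝ᵥ n.2) := by
      intro z n
      have : ((fun i => x i + g (z i)), y.1) = ((x, 0) : (ι → R) × (κ → K)) +
          emb ι κ g (z, y.1) := by
        rw [emb_apply]; ext <;> simp
      rw [this, form_add_left, form_emb]
      simp [form]
    have hself : ∀ z : ι → K, form g ((fun i => x i + g (z i)), y.1)
        ((fun i => x i + g (z i)), y.1) = g (s + 2 * (z ⬝ᵥ v) + y.1 ⬝ᵥ y.1) := by
      intro z
      have h1 : red ι κ ((fun i => x i + g (z i)), y.1) = v := by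
        ext i
        rw [red_apply, map_add, algebraMap_socle hg, add_zero, hx]
      have h3 : x ⬝ᵥ (fun i => x i + g (z i)) = g s + g (z ⬝ᵥ v) := by
        rw [hs, ← hxv, ← socle_sum_mul, dotProduct_comm (fun i => g (z i)) x]
        exact dotProduct_add x x fun i => g (z i)
      rw [hform, h1, h3, ← map_add, ← map_add]
      congr 1
      ring
    have hiff : ∀ z : ι → K, dotWith (Fin.cons v fun i => red ι κ (m i)) z = t y.1 ↔
        form g ((fun i => x i + g (z i)), y.1) ((fun i => x i + g (z i)), y.1) = 0 ∧
          ∀ i, form g ((fun i => x i + g (z i)), y.1) (m i) = 0 := by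
      intro z
      rw [funext_iff, Fin.forall_fin_succ, hself, map_eq_zero_iff g hg.injective]
      simp only [dotWith_apply, Fin.cons_zero, Fin.cons_succ, t]
      refine and_congr ?_ (forall_congr' fun i => ?_)
      · rw [eq_div_iff h2]
        constructor <;> intro h <;> linear_combination h
      · rw [hform, ← ha, ← map_add, map_eq_zero_iff g hg.injective]
        constructor <;> intro h <;> linear_combination h
    symm
    refine Nat.card_congr (Equiv.ofBijective (fun z => ⟨⟨((fun i => x i + g (z.1 i)), y.1), ?_,
      y.2, (hiff z.1).1 z.2⟩, rfl⟩) ⟨?_, ?_⟩)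
    · ext i
      rw [red_apply, map_add, algebraMap_socle hg, add_zero, hx]
    · rintro ⟨z, hz⟩ ⟨z', hz'⟩ h
      refine Subtype.ext (funext fun i => hg.injective ?_)
      have h1 := congrArg (fun n => n.1.1.1 i) h
      exact add_left_cancel h1
    · rintro ⟨⟨⟨c, y'⟩, h1, h3, h4⟩, h5⟩
      obtain rfl : y' = y.1 := congrArg Subtype.val h5
      have hex : ∀ i, ∃ k, g k = c i - x i := fun i => (hg.exact_iff _).1 (by
        rw [map_sub, hx, sub_eq_zero]
        exact congrFun h1 i)
      choose z hz using hex
      have hc : (fun i => x i + g (z i)) = c := funext fun i => by rw [hz]; ring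
      refine ⟨⟨z, (hiff z).2 (by rwa [hc])⟩, ?_⟩
      refine Subtype.ext (Subtype.ext (Prod.ext hc rfl))
  have hF := card_eq_mul_of_fibers F _ hfib
  rw [hF, mul_assoc]
  congr 1
  have h := card_fiber_mul (dotWith (Fin.cons v fun i => red ι κ (m i))).toAddMonoidHom
    (dotWith_surjective hb) 0
  rw [Nat.card_fun, Nat.card_fun, Nat.card_eq_fintype_card (α := Fin _), Fintype.card_fin,
    Nat.card_eq_fintype_card (α := ι)] at h
  exact h

/-- Lifts are prepended one at a time. The self-products and the mutual products together cost `1 +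
2 + ⋯ + k = (k + 1).choose 2` conditions. -/
theorem card_lifts (hg : IsSocleEmbedding g) (hK : ringChar K ≠ 2)
    (U : Submodule K ((ι → K) × (κ → K))) {k : ℕ} (b : Fin k → ι → K)
    (hb : LinearIndependent K b) (hbU : ∀ i, b i ∈ dual (U.comap (LinearMap.inl K _ _)))
    (hbb : ∀ i j, b i ⬝ᵥ b j = 0) :
    Nat.card {m : Fin k → (ι → R) × (κ → K) // (∀ i, red ι κ (m i) = b i) ∧
        (∀ i, ∀ w ∈ U, w.1 ⬝ᵥ b i + w.2 ⬝ᵥ (m i).2 = 0) ∧ ∀ i j, form g (m i) (m j) = 0} *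
      Nat.card K ^ (k * Module.finrank K (U.map (LinearMap.snd K _ _)) + (k + 1).choose 2) =
        Nat.card K ^ (k * (Fintype.card ι + Fintype.card κ)) := by
  induction k with
  | zero =>
    have : Unique {m : Fin 0 → (ι → R) × (κ → K) // (∀ i, red ι κ (m i) = b i) ∧
        (∀ i, ∀ w ∈ U, w.1 ⬝ᵥ b i + w.2 ⬝ᵥ (m i).2 = 0) ∧ ∀ i j, form g (m i) (m j) = 0} :=
      { default := ⟨Fin.elim0, fun i => i.elim0, fun i => i.elim0, fun i => i.elim0⟩
        uniq := fun a => Subtype.ext (Subsingleton.elim _ _) }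
    rw [Nat.card_unique]
    simp
  | succ k ih =>
    have hb' := (linearIndependent_finSucc.1 hb).1
    have ih := ih (Fin.tail b) hb' (fun i => hbU i.succ) fun i j => hbb i.succ j.succ
    set l := Module.finrank K (U.map (LinearMap.snd K (ι → K) (κ → K)))
    have hexp : (k + 1) * l + (k + 1 + 1).choose 2 =
        (l + (k + 1)) + (k * l + (k + 1).choose 2) := by
      rw [Nat.choose_succ_succ' (k + 1) 1, Nat.choose_one_right]
      ring
    have hexp' : (k + 1) * (Fintype.card ι + Fintype.card κ) =
        (Fintype.card ι + Fintype.card κ) + k * (Fintype.card ι + Fintype.card κ) := by ring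
    have hpos : 0 < Nat.card K ^ (l + (k + 1)) := pow_pos Nat.card_pos _
    -- The number of choices for one new lift, as a natural number: `l ≤ N₂` and `k + 1 ≤ N₁`, so
    -- the exponent difference is not truncated.
    obtain ⟨c, hc⟩ : ∃ c, c * Nat.card K ^ (l + (k + 1)) =
        Nat.card K ^ (Fintype.card ι + Fintype.card κ) := by
      have h1 := (U.map (LinearMap.snd K (ι → K) (κ → K))).finrank_le
      have h2 := hb.fintype_card_le_finrank
      rw [Module.finrank_fintype_fun_eq_card] at h1 h2
      rw [Fintype.card_fin] at h2
      refine ⟨Nat.card K ^ (Fintype.card ι + Fintype.card κ - (l + (k + 1))), ?_⟩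
      rw [← pow_add]
      congr 1
      omega
    rw [hexp, hexp', pow_add _ (l + (k + 1)), pow_add _ (Fintype.card ι + Fintype.card κ), ← ih,
      ← hc]
    suffices h : Nat.card {m : Fin (k + 1) → (ι → R) × (κ → K) // (∀ i, red ι κ (m i) = b i) ∧
        (∀ i, ∀ w ∈ U, w.1 ⬝ᵥ b i + w.2 ⬝ᵥ (m i).2 = 0) ∧ ∀ i j, form g (m i) (m j) = 0} =
        Nat.card {m : Fin k → (ι → R) × (κ → K) // (∀ i, red ι κ (m i) = Fin.tail b i) ∧
        (∀ i, ∀ w ∈ U, w.1 ⬝ᵥ Fin.tail b i + w.2 ⬝ᵥ (m i).2 = 0) ∧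
          ∀ i j, form g (m i) (m j) = 0} * c by
      rw [h]
      ring
    refine card_eq_mul_of_fibers (fun m => ⟨Fin.tail m.1, fun i => m.2.1 i.succ,
      fun i => m.2.2.1 i.succ, fun i j => m.2.2.2 i.succ j.succ⟩) _ ?_
    rintro ⟨m, hm1, hm2, hm3⟩
    have hcons : (Fin.cons (b 0) fun i => red ι κ (m i) : Fin (k + 1) → ι → K) = b := by
      conv_rhs => rw [← Fin.cons_self_tail b]
      congr 1
      exact funext hm1
    have h := card_lift hg hK U (b 0) (hbU 0) (hbb 0 0) m (hcons.symm ▸ hb) fun i => by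
      rw [hm1]
      exact hbb _ _
    refine Nat.eq_of_mul_eq_mul_right hpos ?_
    rw [hc, ← h]
    congr 1
    refine Nat.card_congr
      { toFun := fun n => ⟨n.1.1 0, ?_⟩
        invFun := fun n => ⟨⟨Fin.cons n.1 m, ?_, ?_, ?_⟩, ?_⟩
        left_inv := fun n => ?_
        right_inv := fun n => by simp }
    · have hn := congrArg Subtype.val n.2
      simp only at hn
      refine ⟨n.1.2.1 0, n.1.2.2.1 0, n.1.2.2.2 0 0, fun i => ?_⟩
      have hi := n.1.2.2.2 0 i.succ
      rwa [show n.1.1 i.succ = m i from congrFun hn i] at hi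
    · exact Fin.cases n.2.1 hm1
    · exact Fin.cases n.2.2.1 hm2
    · refine Fin.cases (Fin.cases n.2.2.2.1 n.2.2.2.2) fun i => Fin.cases ?_ (hm3 i)
      rw [form_comm]
      exact n.2.2.2.2 i
    · exact Subtype.ext (by simp)
    · have hn := congrArg Subtype.val n.2
      simp only at hn
      refine Subtype.ext (Subtype.ext ?_)
      simp [← hn]

end Lifts

theorem finite_submodule (R M : Type*) [Semiring R] [AddCommMonoid M] [Module R M] [Finite M] :
    Finite (Submodule R M) :=
  Finite.of_injective (fun C => (C : Set M)) SetLike.coe_injective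

theorem real_card_sigma {A : Type*} {B : A → Type*} [Finite A] [∀ a, Finite (B a)] (n : ℝ)
    (h : ∀ a, (Nat.card (B a) : ℝ) = n) : (Nat.card ((a : A) × B a) : ℝ) = Nat.card A * n := by
  have := Fintype.ofFinite A
  rw [Nat.card_sigma]
  simp [h, Nat.card_eq_fintype_card]

/-! ### Counting self-orthogonal mixed codes -/

section Counts

variable {R K : Type*} [CommRing R] [Finite R] [Field K] [Finite K] [Algebra R K] {ι κ : Type*}
  [Fintype ι] [Fintype κ] {g : K →ₗ[R] R}

/-- Codes are counted through lifts of a basis of `A`, each code arising from `|U|^k` tuples of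
lifts. Self-orthogonality of the generated code splits into `U` against itself (given by `hU`), `U`
against the lifts, and the lifts against one another. -/
theorem card_codes_kerPart (hg : IsSocleEmbedding g) (hK : ringChar K ≠ 2)
    (A : Submodule K (ι → K)) (U : Submodule K ((ι → K) × (κ → K))) (hA : A ≤ dual A)
    (hAU : A ≤ U.comap (LinearMap.inl K _ _)) (hUA : U.comap (LinearMap.inl K _ _) ≤ dual A)
    (hU : U.map (LinearMap.snd K _ _) ≤ dual (U.map (LinearMap.snd K _ _))) :
    Nat.card {C : Submodule R ((ι → R) × (κ → K)) //
        IsSelfOrth g C ∧ tor₁ hg C = A ∧ kerPart hg C = U} *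
      Nat.card K ^ (Module.finrank K A * Module.finrank K U + (Module.finrank K A *
        Module.finrank K (U.map (LinearMap.snd K _ _)) + (Module.finrank K A + 1).choose 2)) =
      Nat.card K ^ (Module.finrank K A * (Fintype.card ι + Fintype.card κ)) := by
  obtain ⟨k, hk⟩ : ∃ k, Module.finrank K A = k := ⟨_, rfl⟩
  rw [hk]
  obtain ⟨b, hb, hspan⟩ := exists_linearIndependent_span_eq A hk
  have hbA : ∀ i, b i ∈ A := fun i => hspan ▸ Submodule.subset_span ⟨i, rfl⟩
  have hlifts := card_lifts hg hK U b hb (fun i => le_dual_comm.1 hUA (hbA i))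
    fun i j => hA (hbA i) _ (hbA j)
  have hinj := emb_injective (ι := ι) (κ := κ) hg
  have h := card_extensions (red ι κ) ((U.restrictScalars R).map (emb ι κ g))
    (by rintro _ ⟨w, _, rfl⟩; exact red_emb hg w) b (fun m hm r hr => by
      -- The basis is independent over `K` only, so a relation over `R` has coefficients `g s`. Each
      -- `g s • m i` is the image of `(s • b i, 0)`, which lies in `U` because `A` is contained in
      -- its second torsion code.
      have hr0 : ∀ i, algebraMap R K (r i) = 0 :=
        Fintype.linearIndependent_iff.1 hb (fun i => algebraMap R K (r i)) (by
          rw [← hr]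
          exact Finset.sum_congr rfl fun i _ => algebraMap_smul K (r i) (b i))
      refine Submodule.sum_mem _ fun i _ => ?_
      obtain ⟨s, hs⟩ := (hg.exact_iff _).1 (hr0 i)
      rw [← hs, socle_smul hg]
      refine Submodule.mem_map_of_mem ?_
      have : s • b i ∈ U.comap (LinearMap.inl K (ι → K) (κ → K)) :=
        hAU (A.smul_mem s (hbA i))
      rw [hm]
      exact this) (IsSelfOrth g)
  have hcardU : Nat.card ((U.restrictScalars R).map (emb ι κ g)) =
      Nat.card K ^ Module.finrank K U := by
    rw [← card_submodule U]
    exact Nat.card_congr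
      (Submodule.equivMapOfInjective _ hinj (U.restrictScalars R)).symm.toEquiv
  have hcodes : Nat.card {C : Submodule R ((ι → R) × (κ → K)) //
        IsSelfOrth g C ∧ tor₁ hg C = A ∧ kerPart hg C = U} =
      Nat.card {C : Submodule R ((ι → R) × (κ → K)) //
        C.map (red ι κ) = Submodule.span R (Set.range b) ∧
          C ⊓ LinearMap.ker (red ι κ) = (U.restrictScalars R).map (emb ι κ g) ∧
            IsSelfOrth g C} := by
    refine Nat.card_congr (Equiv.subtypeEquivRight fun C => ?_)
    have h1 : Submodule.span R (Set.range b) = A.restrictScalars R := by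
      rw [← overField_eq_iff hg.surjective, overField_span, hspan]
    rw [kerPart_eq_iff, h1, tor₁, overField_eq_iff, and_comm, and_assoc]
  have htuples : Nat.card {m : Fin k → (ι → R) × (κ → K) // (∀ i, red ι κ (m i) = b i) ∧
      (∀ i, ∀ w ∈ U, w.1 ⬝ᵥ b i + w.2 ⬝ᵥ (m i).2 = 0) ∧ ∀ i j, form g (m i) (m j) = 0} =
      Nat.card {m : Fin k → (ι → R) × (κ → K) // (∀ i, red ι κ (m i) = b i) ∧
        IsSelfOrth g ((U.restrictScalars R).map (emb ι κ g) ⊔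
          Submodule.span R (Set.range m))} := by
    refine Nat.card_congr (Equiv.subtypeEquivRight fun m => and_congr_right fun hm => ?_)
    have hsup : (U.restrictScalars R).map (emb ι κ g) ⊔ Submodule.span R (Set.range m) =
        Submodule.span R (((U.restrictScalars R).map (emb ι κ g) :
          Set ((ι → R) × (κ → K))) ∪ Set.range m) := by
      rw [Submodule.span_union, Submodule.span_eq]
    have hmix : ∀ i, ∀ w, form g (emb ι κ g w) (m i) = 0 ↔
        w.1 ⬝ᵥ b i + w.2 ⬝ᵥ (m i).2 = 0 := fun i w => by
      rw [form_emb, hm, map_eq_zero_iff g hg.injective]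
    rw [hsup, isSelfOrth_span]
    constructor
    · rintro ⟨h1, h2⟩ x hx y hy
      rcases hx with ⟨w, hw, rfl⟩ | ⟨i, rfl⟩ <;> rcases hy with ⟨w', hw', rfl⟩ | ⟨j, rfl⟩
      · rw [form_emb, red_emb hg, dotProduct_zero, zero_add, map_eq_zero_iff g hg.injective]
        exact hU ⟨w, hw, rfl⟩ _ ⟨w', hw', rfl⟩
      · exact (hmix j w).2 (h1 j w hw)
      · rw [form_comm]
        exact (hmix i w').2 (h1 i w' hw')
      · exact h2 i j
    · intro h
      exact ⟨fun i w hw => (hmix i w).1 (h _ (Or.inl ⟨w, hw, rfl⟩) _ (Or.inr ⟨i, rfl⟩)),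
        fun i j => h _ (Or.inr ⟨i, rfl⟩) _ (Or.inr ⟨j, rfl⟩)⟩
  rw [← htuples, ← hcodes, hcardU, ← pow_mul] at h
  rw [h] at hlifts
  rw [← hlifts, pow_add _ (k * Module.finrank K U), mul_comm k (Module.finrank K U), mul_assoc]

/-- The number of self-orthogonal codes with given torsion codes. -/
theorem card_codes_torsion (hg : IsSocleEmbedding g) (hK : ringChar K ≠ 2)
    (A B : Submodule K (ι → K)) (D : Submodule K (κ → K)) (hAB : A ≤ B) (hBA : B ≤ dual A)
    (hD : D ≤ dual D) :
    (Nat.card {C : Submodule R ((ι → R) × (κ → K)) // IsSelfOrth g C ∧ tor₁ hg C = A ∧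
        tor₂ hg C = B ∧ tor₃ hg C = D} : ℝ) =
      (Nat.card K : ℝ) ^ Theta (Fintype.card ι) (Fintype.card κ) (Module.finrank K A)
        (Module.finrank K B - Module.finrank K A) (Module.finrank K D) := by
  have hfin : Finite (Submodule R ((ι → R) × (κ → K))) :=
    finite_submodule _ _
  have hfin' : Finite (Submodule K ((ι → K) × (κ → K))) :=
    finite_submodule _ _
  have hq : (0 : ℝ) < Nat.card K := by exact_mod_cast Nat.card_pos
  have hrank := Submodule.finrank_mono hAB
  have hU := card_kernels B D
  have h1 : (Nat.card {C : Submodule R ((ι → R) × (κ → K)) // IsSelfOrth g C ∧ tor₁ hg C = A ∧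
      tor₂ hg C = B ∧ tor₃ hg C = D} : ℝ) =
      Nat.card {U : Submodule K ((ι → K) × (κ → K)) //
        U.comap (LinearMap.inl K _ _) = B ∧ U.map (LinearMap.snd K _ _) = D} *
      ((Nat.card K : ℝ) ^ (Module.finrank K A * (Fintype.card ι + Fintype.card κ)) /
        (Nat.card K : ℝ) ^ (Module.finrank K A * (Module.finrank K B + Module.finrank K D) +
        (Module.finrank K A * Module.finrank K D + (Module.finrank K A + 1).choose 2))) := by
    refine real_card_eq_mul_of_fibers (fun C => ⟨kerPart hg C.1, C.2.2.2.1, C.2.2.2.2⟩) _ ?_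
    rintro ⟨U, rfl, rfl⟩
    rw [eq_div_iff (by positivity), ← finrank_kernel]
    have h := card_codes_kerPart hg hK A U (hAB.trans hBA) hAB hBA hD
    have h' := congrArg (Nat.cast (R := ℝ)) h
    push_cast at h'
    rw [← h']
    congr 2
    refine Nat.card_congr
      { toFun := fun C => ⟨C.1.1, C.1.2.1, C.1.2.2.1, congrArg Subtype.val C.2⟩
        invFun := fun C => ⟨⟨C.1, C.2.1, C.2.2.1, ?_, ?_⟩, Subtype.ext C.2.2.2⟩
        left_inv := fun _ => rfl
        right_inv := fun _ => rfl }
    · rw [tor₂, C.2.2.2]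
    · rw [tor₃, C.2.2.2]
  have h2 := congrArg (Nat.cast (R := ℝ)) hU
  push_cast at h2
  rw [← eq_div_iff (by positivity)] at h2
  rw [h1, h2]
  -- The exponents are compared as real numbers, where subtraction and the halves in `Theta` cause
  -- no truncation.
  simp only [← Real.rpow_natCast, ← Real.rpow_sub hq, ← Real.rpow_add hq]
  congr 1
  push_cast [Theta, Nat.cast_sub hrank, Nat.cast_choose_two]
  ring

/-- The number of self-orthogonal codes whose torsion codes have given dimensions. -/
theorem card_codes_type (hg : IsSocleEmbedding g) (hK : ringChar K ≠ 2) (k₀ k₁ l₀ : ℕ) :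
    (Nat.card {C : Submodule R ((ι → R) × (κ → K)) // IsSelfOrth g C ∧
        Module.finrank K (tor₁ hg C) = k₀ ∧ Module.finrank K (tor₂ hg C) = k₀ + k₁ ∧
        Module.finrank K (tor₃ hg C) = l₀} : ℝ) =
      if 2 * k₀ + k₁ ≤ Fintype.card ι ∧ 2 * l₀ ≤ Fintype.card κ then
        sigma K (Fintype.card ι) k₀ * sigma K (Fintype.card κ) l₀ *
          gaussBinom (Nat.card K) (Fintype.card ι - 2 * k₀) k₁ *
          (Nat.card K : ℝ) ^ Theta (Fintype.card ι) (Fintype.card κ) k₀ k₁ l₀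
      else 0 := by
  have hfin : Finite (Submodule R ((ι → R) × (κ → K))) :=
    finite_submodule _ _
  have hfinι : Finite (Submodule K (ι → K)) :=
    finite_submodule _ _
  have hfinκ : Finite (Submodule K (κ → K)) :=
    finite_submodule _ _
  split_ifs with h
  · have h1 := real_card_eq_mul_of_fibers
      (A := {C : Submodule R ((ι → R) × (κ → K)) // IsSelfOrth g C ∧
        Module.finrank K (tor₁ hg C) = k₀ ∧ Module.finrank K (tor₂ hg C) = k₀ + k₁ ∧
        Module.finrank K (tor₃ hg C) = l₀})
      (B := {D : Submodule K (κ → K) // D ≤ dual D ∧ Module.finrank K D = l₀} ×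
        (A : {A : Submodule K (ι → K) // A ≤ dual A ∧ Module.finrank K A = k₀}) ×
          {B : Submodule K (ι → K) // A ≤ B ∧ B ≤ dual A.1 ∧
            Module.finrank K B = Module.finrank K A.1 + k₁})
      (fun C => (⟨tor₃ hg C.1, tor₃_le_dual hg C.2.1, C.2.2.2.2⟩,
        ⟨⟨tor₁ hg C.1, tor₁_le_dual hg C.2.1, C.2.2.1⟩, tor₂ hg C.1, tor₁_le_tor₂ hg,
          tor₂_le_dual hg C.2.1, C.2.2.2.1.trans (by rw [C.2.2.1])⟩))
      ((Nat.card K : ℝ) ^ Theta (Fintype.card ι) (Fintype.card κ) k₀ k₁ l₀) (by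
        rintro ⟨⟨D, hD, rfl⟩, ⟨A, hA, rfl⟩, B, hAB, hBA, hB⟩
        have h2 := card_codes_torsion (R := R) hg hK A B D hAB hBA hD
        rw [hB, Nat.add_sub_cancel_left] at h2
        rw [← h2]
        congr 1
        refine Nat.card_congr
          { toFun := fun C => ⟨C.1.1, C.1.2.1, ?_⟩
            invFun := fun C => ⟨⟨C.1, C.2.1, ?_, ?_, ?_⟩, ?_⟩
            left_inv := fun _ => rfl
            right_inv := fun _ => rfl }
        · exact ⟨congrArg (fun x => x.2.1.1) C.2, congrArg (fun x => x.2.2.1) C.2,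
            congrArg (fun x => x.1.1) C.2⟩
        · rw [C.2.2.1]
        · rw [C.2.2.2.1, hB]
        · rw [C.2.2.2.2]
        · obtain ⟨C, hC, rfl, rfl, rfl⟩ := C
          rfl)
    rw [h1, Nat.card_prod, Nat.cast_mul, card_isotropic hK]
    have h3 := real_card_sigma
      (B := fun A : {A : Submodule K (ι → K) // A ≤ dual A ∧ Module.finrank K A = k₀} =>
        {B : Submodule K (ι → K) // A.1 ≤ B ∧ B ≤ dual A.1 ∧
          Module.finrank K B = Module.finrank K A.1 + k₁})
      (gaussBinom (Nat.card K) (Fintype.card ι - 2 * k₀) k₁) (by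
        rintro ⟨A, hA, rfl⟩
        rw [card_subspaces_between hA]
        congr 1
        have := finrank_dual A
        omega)
    rw [h3, card_isotropic hK]
    ring
  · have : IsEmpty {C : Submodule R ((ι → R) × (κ → K)) // IsSelfOrth g C ∧
        Module.finrank K (tor₁ hg C) = k₀ ∧ Module.finrank K (tor₂ hg C) = k₀ + k₁ ∧
        Module.finrank K (tor₃ hg C) = l₀} := ⟨fun C => h (by
      have h1 := finrank_tor_le hg C.2.1
      rw [C.2.2.1, C.2.2.2.1, C.2.2.2.2] at h1
      exact ⟨by omega, h1.2⟩)⟩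
    simp

/-- The number of self-orthogonal codes. -/
theorem card_codes (hg : IsSocleEmbedding g) (hK : ringChar K ≠ 2) :
    (Nat.card {C : Submodule R ((ι → R) × (κ → K)) // IsSelfOrth g C} : ℝ) =
      ∑ k₀ ∈ Finset.range (Fintype.card ι / 2 + 1),
        ∑ k₁ ∈ Finset.range (Fintype.card ι - 2 * k₀ + 1),
          ∑ l₀ ∈ Finset.range (Fintype.card κ / 2 + 1),
            sigma K (Fintype.card ι) k₀ * sigma K (Fintype.card κ) l₀ *
              gaussBinom (Nat.card K) (Fintype.card ι - 2 * k₀) k₁ *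
              (Nat.card K : ℝ) ^ Theta (Fintype.card ι) (Fintype.card κ) k₀ k₁ l₀ := by
  classical
  have hfin : Finite (Submodule R ((ι → R) × (κ → K))) :=
    finite_submodule _ _
  let S := (Finset.range (Fintype.card ι / 2 + 1)).sigma fun k₀ =>
    Finset.range (Fintype.card ι - 2 * k₀ + 1) ×ˢ Finset.range (Fintype.card κ / 2 + 1)
  have h := card_eq_sum_fibers S
    (fun C : {C : Submodule R ((ι → R) × (κ → K)) // IsSelfOrth g C} =>
      (⟨Module.finrank K (tor₁ hg C.1),
        Module.finrank K (tor₂ hg C.1) - Module.finrank K (tor₁ hg C.1),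
        Module.finrank K (tor₃ hg C.1)⟩ : (_ : ℕ) × (ℕ × ℕ))) (fun C => by
      have h1 := finrank_tor_le hg C.2
      have h2 := Submodule.finrank_mono (tor₁_le_tor₂ hg (C := C.1))
      simp only [S, Finset.mem_sigma, Finset.mem_product, Finset.mem_range]
      omega)
  rw [h, Nat.cast_sum, Finset.sum_sigma]
  refine Finset.sum_congr rfl fun k₀ h0 => ?_
  rw [Finset.sum_product]
  refine Finset.sum_congr rfl fun k₁ h1 => Finset.sum_congr rfl fun l₀ h2 => ?_
  rw [Finset.mem_range] at h0 h1 h2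
  have h3 := card_codes_type (R := R) (ι := ι) (κ := κ) hg hK k₀ k₁ l₀
  rw [if_pos (by omega)] at h3
  rw [← h3]
  congr 1
  have hiff : ∀ C : Submodule R ((ι → R) × (κ → K)),
      ((⟨Module.finrank K (tor₁ hg C), Module.finrank K (tor₂ hg C) - Module.finrank K (tor₁ hg C),
        Module.finrank K (tor₃ hg C)⟩ : (_ : ℕ) × (ℕ × ℕ)) = ⟨k₀, k₁, l₀⟩) ↔
      Module.finrank K (tor₁ hg C) = k₀ ∧ Module.finrank K (tor₂ hg C) = k₀ + k₁ ∧
        Module.finrank K (tor₃ hg C) = l₀ := by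
    intro C
    have h4 := Submodule.finrank_mono (tor₁_le_tor₂ hg (C := C))
    simp only [Sigma.mk.injEq, heq_eq_eq, Prod.mk.injEq]
    omega
  exact Nat.card_congr
    { toFun := fun C => ⟨C.1.1, C.1.2, (hiff _).1 C.2⟩
      invFun := fun C => ⟨⟨C.1, C.2.1⟩, (hiff _).2 C.2.2⟩
      left_inv := fun _ => rfl
      right_inv := fun _ => rfl }

end Counts

/-! ### Information sets -/

section InformationSets

variable {K : Type*} [Field K] {ι : Type*}

/-- The coordinate functionals of a linear code. -/
def coordFun (C : Submodule K (ι → K)) (i : ι) : Module.Dual K C :=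
  LinearMap.proj i ∘ₗ C.subtype

theorem linearIndepOn_coordFun_mono {A B : Submodule K (ι → K)} (h : A ≤ B) {I : Set ι}
    (hI : LinearIndepOn K (coordFun A) I) : LinearIndepOn K (coordFun B) I :=
  LinearIndependent.of_comp (Submodule.inclusion h).dualMap hI

/-- An independent set of coordinates of a linear code extends to an information set. -/
theorem exists_information_set [Fintype ι] (C : Submodule K (ι → K)) (I : Set ι)
    (hI : LinearIndepOn K (coordFun C) I) :
    ∃ J, I ⊆ J ∧ LinearIndepOn K (coordFun C) J ∧ J.ncard = Module.finrank K C ∧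
      (∀ x ∈ C, (∀ i ∈ J, x i = 0) → x = 0) ∧ ∀ f : ι → K, ∃ x ∈ C, ∀ i ∈ J, x i = f i := by
  classical
  -- A maximal independent set of coordinate functionals spans all of them, so a codeword vanishing
  -- on `J` is zero. Comparing dimensions makes restriction to `J` bijective.
  let J := hI.extend (Set.subset_univ I)
  have hJ : LinearIndepOn K (coordFun C) J := hI.linearIndepOn_extend _
  have hspan : Submodule.span K (coordFun C '' J) = Submodule.span K (coordFun C '' Set.univ) :=
    hI.span_image_extend_eq_span_image _
  have hinj : ∀ x : C, (∀ i ∈ J, x.1 i = 0) → x = 0 := by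
    intro x hx
    have h1 : Submodule.span K (coordFun C '' J) ≤
        LinearMap.ker (LinearMap.applyₗ (R := K) (M₂ := K) x) := by
      rw [Submodule.span_le]
      rintro _ ⟨i, hi, rfl⟩
      exact hx i hi
    refine Subtype.ext (funext fun i => ?_)
    have h2 : coordFun C i ∈ Submodule.span K (coordFun C '' J) := by
      rw [hspan]
      exact Submodule.subset_span ⟨i, trivial, rfl⟩
    exact h1 h2
  let f : C →ₗ[K] (J → K) := LinearMap.pi fun i => coordFun C i
  have hf : Function.Injective f := by
    rw [← LinearMap.ker_eq_bot, LinearMap.ker_eq_bot']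
    exact fun x hx => hinj x fun i hi => congrFun hx ⟨i, hi⟩
  have hcard : Fintype.card J = Module.finrank K C := by
    refine le_antisymm ?_ ?_
    · rw [← Subspace.dual_finrank_eq]
      exact hJ.fintype_card_le_finrank
    · have := LinearMap.finrank_le_finrank_of_injective hf
      rwa [Module.finrank_fintype_fun_eq_card] at this
  have hsurj : Function.Surjective f := by
    refine (LinearMap.injective_iff_surjective_of_finrank_eq_finrank ?_).1 hf
    rw [Module.finrank_fintype_fun_eq_card, hcard]
  refine ⟨J, hI.subset_extend _, hJ, ?_, fun x hx h => congrArg Subtype.val (hinj ⟨x, hx⟩ h),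
    fun h => ?_⟩
  · rw [← hcard, ← Nat.card_eq_fintype_card, Nat.card_coe_set_eq]
  · obtain ⟨x, hx⟩ := hsurj fun i => h i
    exact ⟨x, x.2, fun i hi => congrFun hx ⟨i, hi⟩⟩

theorem exists_enumeration [Finite ι] {I J : Set ι} (hIJ : I ⊆ J) {k l : ℕ} (hI : I.ncard = k)
    (hJ : J.ncard = k + l) : ∃ (m : ℕ) (e : (Fin k ⊕ Fin l) ⊕ Fin m ≃ ι),
      I = Set.range (fun i => e (.inl (.inl i))) ∧ J = Set.range fun i => e (.inl i) := by
  classical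
  have e₁ : Fin k ≃ I := (finCongr hI.symm).trans (Finite.equivFin I).symm
  have e₂ : Fin l ≃ (J \ I : Set ι) := (finCongr (by
    rw [Nat.card_coe_set_eq, Set.ncard_sdiff hIJ]
    omega)).trans (Finite.equivFin (J \ I : Set ι)).symm
  have e₃ : Fin (Nat.card (Jᶜ : Set ι)) ≃ (Jᶜ : Set ι) := (Finite.equivFin _).symm
  let f : Fin k ⊕ Fin l ≃ J := (Equiv.sumCongr e₁ e₂).trans (Equiv.Set.sumDiffSubset hIJ)
  let e : (Fin k ⊕ Fin l) ⊕ Fin _ ≃ ι := (Equiv.sumCongr f e₃).trans (Equiv.Set.sumCompl J)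
  have he : ∀ i, e (.inl i) = f i := fun _ => rfl
  have hf : ∀ i, (f (.inl i) : ι) = e₁ i := fun i => by simp [f]
  refine ⟨_, e, ?_, ?_⟩
  · ext x
    simp only [he, hf]
    exact ⟨fun hx => ⟨e₁.symm ⟨x, hx⟩, by simp⟩, by rintro ⟨i, rfl⟩; exact (e₁ i).2⟩
  · ext x
    simp only [he]
    exact ⟨fun hx => ⟨f.symm ⟨x, hx⟩, by simp⟩, by rintro ⟨i, rfl⟩; exact (f i).2⟩

theorem linearIndependent_of_coords {α : Type*} [Fintype α] [DecidableEq α] {v : α → ι → K}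
    {e : α → ι} (h : ∀ i j, v i (e j) = (1 : Matrix α α K) i j) : LinearIndependent K v := by
  rw [Fintype.linearIndependent_iff]
  intro c hc j
  have := congrFun hc (e j)
  simpa [h, Matrix.one_apply] using this

end InformationSets

/-! ### Generators in standard form -/

section StandardGenerators

variable {R K : Type*} [CommRing R] [Field K] [Algebra R K] {ι κ : Type*} {g : K →ₗ[R] R}
  {k₀ k₁ l₀ : ℕ}

/-- The coordinates of generators in standard form, where `eX₀`, `eX₁` and `eY` say where the
identity blocks are. -/
structure IsStd (eX₀ : Fin k₀ → ι) (eX₁ : Fin k₁ → ι) (eY : Fin l₀ → κ)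
    (a : Fin k₀ → (ι → R) × (κ → K)) (p : Fin k₁ → ι → K)
    (w : Fin l₀ → (ι → K) × (κ → K)) : Prop where
  a_fst : ∀ i j, (a i).1 (eX₀ j) = (1 : Matrix (Fin k₀) (Fin k₀) R) i j
  a_snd : ∀ i j, (a i).2 (eY j) = 0
  p_zero : ∀ i j, p i (eX₀ j) = 0
  p_one : ∀ i j, p i (eX₁ j) = (1 : Matrix (Fin k₁) (Fin k₁) K) i j
  w_fst₀ : ∀ i j, (w i).1 (eX₀ j) = 0
  w_fst₁ : ∀ i j, (w i).1 (eX₁ j) = 0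
  w_snd : ∀ i j, (w i).2 (eY j) = (1 : Matrix (Fin l₀) (Fin l₀) K) i j

/-- The code generated by `a`, by `g p` and by the image of `w`. -/
def genCode (g : K →ₗ[R] R) (a : Fin k₀ → (ι → R) × (κ → K)) (p : Fin k₁ → ι → K)
    (w : Fin l₀ → (ι → K) × (κ → K)) : Submodule R ((ι → R) × (κ → K)) :=
  Submodule.span R ((Set.range a ∪ Set.range fun i => emb ι κ g (p i, 0)) ∪
    Set.range fun j => emb ι κ g (w j))

/-- The code of the first block generated by `a` and by `g p`. -/
def genCodeX (g : K →ₗ[R] R) (a : Fin k₀ → (ι → R) × (κ → K)) (p : Fin k₁ → ι → K) :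
    Submodule R (ι → R) :=
  Submodule.span R ((Set.range fun i => (a i).1) ∪ Set.range fun i x => g (p i x))

variable {eX₀ : Fin k₀ → ι} {eX₁ : Fin k₁ → ι} {eY : Fin l₀ → κ}
  {a : Fin k₀ → (ι → R) × (κ → K)} {p : Fin k₁ → ι → K} {w : Fin l₀ → (ι → K) × (κ → K)}

/-- The generators coming from `emb` are killed by the kernel of `R → K`, so their coefficients may
be taken in `K`. -/
theorem mem_genCode (hg : IsSocleEmbedding g) {m : (ι → R) × (κ → K)} :
    m ∈ genCode g a p w ↔ ∃ (r : Fin k₀ → R) (s : Fin k₁ → K) (t : Fin l₀ → K),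
      m = ∑ i, r i • a i + emb ι κ g (∑ i, s i • (p i, 0) + ∑ j, t j • w j) := by
  have hemb : ∀ (r : R) (v : (ι → K) × (κ → K)),
      emb ι κ g (algebraMap R K r • v) = r • emb ι κ g v := fun r v => by
    rw [algebraMap_smul, map_smul]
  constructor
  · intro hm
    rw [genCode, Submodule.span_union, Submodule.span_union] at hm
    obtain ⟨m', hm', v, hv, rfl⟩ := Submodule.mem_sup.1 hm
    obtain ⟨u, hu, u', hu', rfl⟩ := Submodule.mem_sup.1 hm'
    obtain ⟨r, rfl⟩ := (Submodule.mem_span_range_iff_exists_fun R).1 hu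
    obtain ⟨s, rfl⟩ := (Submodule.mem_span_range_iff_exists_fun R).1 hu'
    obtain ⟨t, rfl⟩ := (Submodule.mem_span_range_iff_exists_fun R).1 hv
    refine ⟨r, fun i => algebraMap R K (s i), fun i => algebraMap R K (t i), ?_⟩
    rw [map_add, map_sum, map_sum, add_assoc]
    simp only [hemb]
  · rintro ⟨r, s, t, rfl⟩
    choose f hf using hg.surjective
    rw [map_add, map_sum, map_sum]
    refine Submodule.add_mem _ (Submodule.sum_mem _ fun i _ => Submodule.smul_mem _ _
      (Submodule.subset_span (Or.inl (Or.inl ⟨i, rfl⟩))))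
      (Submodule.add_mem _ (Submodule.sum_mem _ fun i _ => ?_)
        (Submodule.sum_mem _ fun i _ => ?_))
    · rw [← hf (s i), hemb]
      exact Submodule.smul_mem _ _ (Submodule.subset_span (Or.inl (Or.inr ⟨i, rfl⟩)))
    · rw [← hf (t i), hemb]
      exact Submodule.smul_mem _ _ (Submodule.subset_span (Or.inr ⟨i, rfl⟩))

theorem mem_genCodeX (hg : IsSocleEmbedding g) {m : ι → R} :
    m ∈ genCodeX g a p ↔ ∃ (r : Fin k₀ → R) (s : Fin k₁ → K),
      m = ∑ i, r i • (a i).1 + fun x => g (∑ i, s i * p i x) := by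
  have hsum : ∀ s : Fin k₁ → K, (fun x => g (∑ i, s i * p i x)) =
      ∑ i, (fun x => g (s i * p i x)) := fun s => by
    ext x
    rw [map_sum, Finset.sum_apply]
  have hsmul : ∀ (r : R) (v : ι → K), (fun x => g (algebraMap R K r * v x)) =
      r • fun x => g (v x) := fun r v => by
    ext x
    rw [← Algebra.smul_def, map_smul]
    rfl
  constructor
  · intro hm
    rw [genCodeX, Submodule.span_union] at hm
    obtain ⟨u, hu, u', hu', rfl⟩ := Submodule.mem_sup.1 hm
    obtain ⟨r, rfl⟩ := (Submodule.mem_span_range_iff_exists_fun R).1 hu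
    obtain ⟨s, rfl⟩ := (Submodule.mem_span_range_iff_exists_fun R).1 hu'
    refine ⟨r, fun i => algebraMap R K (s i), ?_⟩
    rw [hsum]
    simp only [hsmul]
  · rintro ⟨r, s, rfl⟩
    choose f hf using hg.surjective
    rw [hsum]
    refine Submodule.add_mem _ (Submodule.sum_mem _ fun i _ => Submodule.smul_mem _ _
      (Submodule.subset_span (Or.inl ⟨i, rfl⟩))) (Submodule.sum_mem _ fun i _ => ?_)
    rw [← hf (s i), hsmul]
    exact Submodule.smul_mem _ _ (Submodule.subset_span (Or.inr ⟨i, rfl⟩))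

theorem tor₁_genCode (hg : IsSocleEmbedding g) :
    tor₁ hg (genCode g a p w) = Submodule.span K (Set.range fun i => red ι κ (a i)) := by
  refine le_antisymm ?_ (Submodule.span_le.2 ?_)
  · rintro _ ⟨m, hm, rfl⟩
    obtain ⟨r, s, t, rfl⟩ := (mem_genCode hg).1 hm
    rw [map_add, red_emb hg, add_zero, map_sum]
    refine Submodule.sum_mem _ fun i _ => ?_
    rw [map_smul, ← algebraMap_smul K]
    exact Submodule.smul_mem _ _ (Submodule.subset_span ⟨i, rfl⟩)
  · rintro _ ⟨i, rfl⟩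
    exact ⟨a i, Submodule.subset_span (Or.inl (Or.inl ⟨i, rfl⟩)), rfl⟩

theorem mem_tor₁_iff_genCodeX (hg : IsSocleEmbedding g) {x : ι → K} :
    x ∈ tor₁ hg (genCode g a p w) ↔
      ∃ c : ι → R, (∀ j, algebraMap R K (c j) = x j) ∧ c ∈ genCodeX g a p := by
  constructor
  · rintro ⟨m, hm, rfl⟩
    obtain ⟨r, s, t, rfl⟩ := (mem_genCode hg).1 hm
    refine ⟨∑ i, r i • (a i).1, fun j => ?_, ?_⟩
    · rw [map_add, red_emb hg, add_zero, red_apply, Prod.fst_sum]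
      rfl
    · exact Submodule.sum_mem _ fun i _ => Submodule.smul_mem _ _
        (Submodule.subset_span (Or.inl ⟨i, rfl⟩))
  · rintro ⟨c, hc, hcX⟩
    obtain ⟨r, s, rfl⟩ := (mem_genCodeX hg).1 hcX
    refine ⟨∑ i, r i • a i, Submodule.sum_mem _ fun i _ => Submodule.smul_mem _ _
        (Submodule.subset_span (Or.inl (Or.inl ⟨i, rfl⟩))), funext fun j => ?_⟩
    rw [← hc j, Pi.add_apply, map_add, algebraMap_socle hg, add_zero, red_apply, Prod.fst_sum]
    rfl

namespace IsStd

variable (h : IsStd eX₀ eX₁ eY a p w)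
include h

/-- The coefficients of a word of the code can be read off. -/
theorem coords (r : Fin k₀ → R) (s : Fin k₁ → K) (t : Fin l₀ → K) :
    (∀ j, (∑ i, r i • a i + emb ι κ g (∑ i, s i • (p i, 0) + ∑ j, t j • w j)).1 (eX₀ j) = r j) ∧
      ∀ j, (∑ i, r i • a i + emb ι κ g (∑ i, s i • (p i, 0) + ∑ j, t j • w j)).2 (eY j) =
        t j := by
  constructor
  · intro j
    simp [emb_apply, Prod.fst_sum, h.a_fst, h.p_zero, h.w_fst₀, Matrix.one_apply]
  · intro j
    simp [emb_apply, Prod.snd_sum, h.a_snd, h.w_snd, Matrix.one_apply]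

/-- The identity blocks show that the coefficients of the rows `a` lie in the socle. These rows then
contribute only multiples of their reductions, and the whole identity can be divided by `g`. -/
theorem eq_of_emb_mem (hg : IsSocleEmbedding g) {v : (ι → K) × (κ → K)}
    (hv : emb ι κ g v ∈ genCode g a p w) : ∃ (s : Fin k₁ → K), v =
      ∑ i, v.1 (eX₀ i) • (red ι κ (a i), 0) + ∑ i, s i • (p i, 0) +
        ∑ j, v.2 (eY j) • w j := by
  obtain ⟨r, s, t, hm⟩ := (mem_genCode hg).1 hv
  obtain ⟨h1, h2⟩ := h.coords (g := g) r s t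
  rw [← hm] at h1 h2
  have hr : ∀ j, r j = g (v.1 (eX₀ j)) := fun j => (h1 j).symm
  have ht : ∀ j, t j = v.2 (eY j) := fun j => (h2 j).symm
  refine ⟨s, emb_injective hg ?_⟩
  rw [hm]
  have hpair : ∀ (k : K) (b : ι → K), (k • b, (0 : κ → K)) = k • (b, 0) := fun k b => by
    ext <;> simp
  simp only [hr, ht, socle_smul hg, hpair]
  rw [← map_sum (emb ι κ g), ← map_add, add_assoc]

theorem tor₂_genCode (hg : IsSocleEmbedding g) : tor₂ hg (genCode g a p w) =
    Submodule.span K (Set.range (Sum.elim (fun i => red ι κ (a i)) p)) := by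
  refine le_antisymm (fun z hz => ?_) (Submodule.span_le.2 ?_)
  · obtain ⟨s, hs⟩ := h.eq_of_emb_mem hg ((mem_tor₂ hg).1 hz)
    have hs := (Prod.ext_iff.1 hs).1
    simp only [Prod.fst_add, Prod.fst_sum, Prod.smul_mk, Pi.zero_apply, zero_smul,
      Finset.sum_const_zero, add_zero] at hs
    rw [hs]
    exact Submodule.add_mem _ (Submodule.sum_mem _ fun i _ => Submodule.smul_mem _ _
      (Submodule.subset_span ⟨.inl i, rfl⟩)) (Submodule.sum_mem _ fun i _ =>
        Submodule.smul_mem _ _ (Submodule.subset_span ⟨.inr i, rfl⟩))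
  · rintro _ ⟨i | i, rfl⟩
    · exact tor₁_le_tor₂ hg ⟨a i, Submodule.subset_span (Or.inl (Or.inl ⟨i, rfl⟩)), rfl⟩
    · exact Submodule.subset_span (Or.inl (Or.inr ⟨i, rfl⟩))

theorem tor₃_genCode (hg : IsSocleEmbedding g) : tor₃ hg (genCode g a p w) =
    Submodule.span K (Set.range fun j => (w j).2) := by
  refine le_antisymm (fun y hy => ?_) (Submodule.span_le.2 ?_)
  · obtain ⟨z, hz⟩ := (mem_tor₃ hg).1 hy
    obtain ⟨s, hs⟩ := h.eq_of_emb_mem hg hz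
    have hs := (Prod.ext_iff.1 hs).2
    simp only [Prod.snd_add, Prod.snd_sum, Prod.smul_mk, smul_zero, Finset.sum_const_zero,
      zero_add, Prod.smul_snd] at hs
    rw [hs]
    exact Submodule.sum_mem _ fun j _ =>
      Submodule.smul_mem _ _ (Submodule.subset_span ⟨j, rfl⟩)
  · rintro _ ⟨j, rfl⟩
    exact (mem_tor₃ hg).2 ⟨(w j).1, Submodule.subset_span (Or.inr ⟨j, rfl⟩)⟩

theorem red_a (i j : Fin k₀) :
    red ι κ (a i) (eX₀ j) = (1 : Matrix (Fin k₀) (Fin k₀) K) i j := by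
  rw [red_apply, h.a_fst, Matrix.one_apply, Matrix.one_apply]
  split_ifs <;> simp

theorem finrank_tor₁ (hg : IsSocleEmbedding g) :
    Module.finrank K (tor₁ hg (genCode g a p w)) = k₀ := by
  rw [tor₁_genCode, finrank_span_eq_card (linearIndependent_of_coords h.red_a), Fintype.card_fin]

theorem finrank_tor₂ (hg : IsSocleEmbedding g) :
    Module.finrank K (tor₂ hg (genCode g a p w)) = k₀ + k₁ := by
  rw [h.tor₂_genCode, finrank_span_eq_card, Fintype.card_sum, Fintype.card_fin, Fintype.card_fin]
  rw [Fintype.linearIndependent_iff]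
  intro c hc
  rw [Fintype.sum_sum_type] at hc
  have h1 : ∀ j, c (.inl j) = 0 := fun j => by
    have := congrFun hc (eX₀ j)
    simpa [h.red_a, h.p_zero, Matrix.one_apply] using this
  rintro (j | j)
  · exact h1 j
  · have := congrFun hc (eX₁ j)
    simpa [h1, h.p_one, Matrix.one_apply] using this

theorem finrank_tor₃ (hg : IsSocleEmbedding g) :
    Module.finrank K (tor₃ hg (genCode g a p w)) = l₀ := by
  rw [h.tor₃_genCode, finrank_span_eq_card (linearIndependent_of_coords h.w_snd),
    Fintype.card_fin]

/-- This reconciles the torsion code of the full code with that of the rows in the first block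
alone: both are spanned by the reductions of the `a i` and the `p i`. -/
theorem mem_tor₂_iff_genCodeX (hg : IsSocleEmbedding g) {x : ι → K} :
    x ∈ tor₂ hg (genCode g a p w) ↔ (fun i => g (x i)) ∈ genCodeX g a p := by
  have hsmul : ∀ (k : K) i, (fun x => g (k * red ι κ (a i) x)) = g k • (a i).1 := fun k i =>
    (Prod.ext_iff.1 (socle_smul hg k (a i))).1.symm
  rw [h.tor₂_genCode hg, Submodule.mem_span_range_iff_exists_fun, mem_genCodeX hg]
  constructor
  · rintro ⟨c, rfl⟩
    refine ⟨fun i => g (c (.inl i)), fun i => c (.inr i), ?_⟩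
    simp only [← hsmul]
    ext j
    simp [Fintype.sum_sum_type]
  · rintro ⟨r, s, hx⟩
    have hr : ∀ j, r j = g (x (eX₀ j)) := fun j => by
      have := congrFun hx (eX₀ j)
      rw [this]
      simp [h.a_fst, h.p_zero, Matrix.one_apply]
    refine ⟨Sum.elim (fun j => x (eX₀ j)) s, funext fun j => hg.injective ?_⟩
    have := congrFun hx j
    simp only [hr, ← hsmul] at this
    rw [this]
    simp [Fintype.sum_sum_type]

end IsStd

/-- Every code has generators in standard form. -/
theorem exists_standard_generators [Fintype ι] [Fintype κ] (hg : IsSocleEmbedding g)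
    (C : Submodule R ((ι → R) × (κ → K))) (hk₀ : Module.finrank K (tor₁ hg C) = k₀)
    (hk₁ : Module.finrank K (tor₂ hg C) = k₀ + k₁) (hl₀ : Module.finrank K (tor₃ hg C) = l₀) :
    ∃ (m n : ℕ) (eX : (Fin k₀ ⊕ Fin k₁) ⊕ Fin m ≃ ι) (eY : Fin l₀ ⊕ Fin n ≃ κ)
      (a : Fin k₀ → (ι → R) × (κ → K)) (p : Fin k₁ → ι → K)
      (w : Fin l₀ → (ι → K) × (κ → K)),
      IsStd (fun i => eX (.inl (.inl i))) (fun i => eX (.inl (.inr i))) (fun j => eY (.inl j))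
        a p w ∧ genCode g a p w = C := by
  classical
  obtain ⟨I, -, hI, hIcard, hIinj, hIsurj⟩ := exists_information_set (tor₁ hg C) ∅
    (linearIndepOn_empty K _)
  obtain ⟨J, hIJ, hJ, hJcard, hJinj, hJsurj⟩ := exists_information_set (tor₂ hg C) I
    (linearIndepOn_coordFun_mono (tor₁_le_tor₂ hg) hI)
  obtain ⟨L, -, hL, hLcard, hLinj, hLsurj⟩ := exists_information_set (tor₃ hg C) ∅
    (linearIndepOn_empty K _)
  obtain ⟨m, eX, rfl, rfl⟩ := exists_enumeration hIJ (hIcard.trans hk₀) (hJcard.trans hk₁)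
  -- The second block has a single identity block, so the middle group of columns is empty and is
  -- removed afterwards.
  obtain ⟨n, eY', hLr, -⟩ := exists_enumeration (J := L) (l := 0) subset_rfl (hLcard.trans hl₀)
    (hLcard.trans hl₀)
  obtain ⟨eY, hL'⟩ : ∃ eY : Fin l₀ ⊕ Fin n ≃ κ, L = Set.range fun j => eY (.inl j) :=
    ⟨(Equiv.sumCongr (Equiv.sumEmpty _ _).symm (Equiv.refl _)).trans eY', hLr⟩
  subst hL'
  simp only [Set.forall_mem_range] at hIinj hIsurj hJinj hJsurj hLinj hLsurj
  -- Start from a word whose reduction is a unit vector on the first information set. Subtract a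
  -- word of the kernel to clear the second block on `L`, then a word `(g v, 0)` with `v ∈ tor₂` to
  -- remove the socle error in the identity block.
  have ha : ∀ i, ∃ c ∈ C, (∀ j, c.1 (eX (.inl (.inl j))) =
      (1 : Matrix (Fin k₀) (Fin k₀) R) i j) ∧ ∀ j, c.2 (eY (.inl j)) = 0 := by
    intro i
    obtain ⟨_, ⟨c, hc, rfl⟩, hcx⟩ := hIsurj fun x => if x = eX (.inl (.inl i)) then 1 else 0
    obtain ⟨y, hy, hcy⟩ := hLsurj c.2
    obtain ⟨z, hz⟩ := (mem_tor₃ hg).1 hy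
    have hex : ∀ x, ∃ e, x ∈ Set.range (fun j => eX (.inl (.inl j))) →
        g e = (c - emb ι κ g (z, y)).1 x - if x = eX (.inl (.inl i)) then 1 else 0 := by
      intro x
      by_cases hx : x ∈ Set.range (fun j => eX (.inl (.inl j)))
      · obtain ⟨j, rfl⟩ := hx
        have h1 := hcx j
        rw [red_apply] at h1
        obtain ⟨e, he⟩ := (hg.exact_iff ((c - emb ι κ g (z, y)).1 (eX (.inl (.inl j))) -
          if eX (.inl (.inl j)) = eX (.inl (.inl i)) then 1 else 0)).1 (by
            rw [map_sub, Prod.fst_sub, Pi.sub_apply, map_sub, h1, emb_apply]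
            simp only [algebraMap_socle hg]
            split_ifs <;> simp)
        exact ⟨e, fun _ => he⟩
      · exact ⟨0, fun h => absurd h hx⟩
    choose e he using hex
    obtain ⟨v, hv, hve⟩ := hJsurj e
    refine ⟨c - emb ι κ g (z, y) - emb ι κ g (v, 0), C.sub_mem (C.sub_mem hc hz) hv,
      fun j => ?_, fun j => ?_⟩
    · have h1 := he _ ⟨j, rfl⟩
      rw [Prod.fst_sub, Pi.sub_apply, emb_apply g (v, 0)]
      simp only [hve, h1, Matrix.one_apply]
      simp [eq_comm]
    · simp [emb_apply, hcy]
  have hp : ∀ i, ∃ v ∈ tor₂ hg C, (∀ j, v (eX (.inl (.inl j))) = 0) ∧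
      ∀ j, v (eX (.inl (.inr j))) = (1 : Matrix (Fin k₁) (Fin k₁) K) i j := by
    intro i
    obtain ⟨v, hv, hvx⟩ := hJsurj fun x => if x = eX (.inl (.inr i)) then 1 else 0
    refine ⟨v, hv, fun j => ?_, fun j => ?_⟩
    · simp [hvx]
    · simp [hvx, Matrix.one_apply, eq_comm]
  have hw : ∀ i, ∃ v, emb ι κ g v ∈ C ∧ (∀ j, v.1 (eX (.inl j)) = 0) ∧
      ∀ j, v.2 (eY (.inl j)) = (1 : Matrix (Fin l₀) (Fin l₀) K) i j := by
    intro i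
    obtain ⟨y, hy, hyx⟩ := hLsurj fun x => if x = eY (.inl i) then 1 else 0
    obtain ⟨z, hz⟩ := (mem_tor₃ hg).1 hy
    obtain ⟨v, hv, hvz⟩ := hJsurj z
    refine ⟨(z, y) - (v, 0), ?_, fun j => ?_, fun j => ?_⟩
    · rw [map_sub]
      exact C.sub_mem hz hv
    · simp [hvz]
    · simp [hyx, Matrix.one_apply, eq_comm]
  choose a haC ha1 ha2 using ha
  choose p hpC hp0 hp1 using hp
  choose w hwC hw1 hw2 using hw
  refine ⟨m, n, eX, eY, a, p, w, ⟨ha1, ha2, hp0, hp1, fun i j => hw1 i _, fun i j => hw1 i _,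
    hw2⟩, le_antisymm ?_ fun c hc => ?_⟩
  · rw [genCode, Submodule.span_le]
    rintro _ ((⟨i, rfl⟩ | ⟨i, rfl⟩) | ⟨i, rfl⟩)
    · exact haC i
    · exact hpC i
    · exact hwC i
  -- Conversely, a word of `C` is recovered from its coordinates. Removing the `a i` leaves the
  -- image of some `(z, y)`; then `y` is determined on `L`, and the remaining first block on the
  -- information set of `tor₂`.
  have hred : red ι κ (c - ∑ i, c.1 (eX (.inl (.inl i))) • a i) = 0 := by
    refine hIinj _ ⟨_, C.sub_mem hc (C.sum_mem fun i _ => C.smul_mem _ (haC i)), rfl⟩ fun j => ?_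
    rw [red_apply]
    simp [Prod.fst_sum, ha1, Matrix.one_apply]
  obtain ⟨⟨z, y⟩, hv⟩ := exists_emb hg hred
  have hvC : emb ι κ g (z, y) ∈ C := by
    rw [hv]
    exact C.sub_mem hc (C.sum_mem fun i _ => C.smul_mem _ (haC i))
  have hz0 : ∀ j, z (eX (.inl (.inl j))) = 0 := fun j => by
    refine hg.injective ?_
    rw [map_zero]
    have := congrFun (Prod.ext_iff.1 hv).1 (eX (.inl (.inl j)))
    rw [emb_apply] at this
    simp only at this
    rw [this]
    simp [Prod.fst_sum, ha1, Matrix.one_apply]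
  have hsumC : emb ι κ g (∑ j, y (eY (.inl j)) • w j) ∈ C := by
    have : ∑ j, y (eY (.inl j)) • w j ∈ kerPart hg C :=
      Submodule.sum_mem _ fun j _ => Submodule.smul_mem _ _ (hwC j)
    exact this
  have hy : y = (∑ j, y (eY (.inl j)) • w j).2 := by
    rw [← sub_eq_zero]
    refine hLinj _ ?_ fun j => ?_
    · rw [mem_tor₃]
      refine ⟨z - (∑ j, y (eY (.inl j)) • w j).1, ?_⟩
      have : (z - (∑ j, y (eY (.inl j)) • w j).1, y - (∑ j, y (eY (.inl j)) • w j).2) =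
        (z, y) - ∑ j, y (eY (.inl j)) • w j := rfl
      rw [this, map_sub]
      exact C.sub_mem hvC hsumC
    · simp [Prod.snd_sum, hw2, Matrix.one_apply]
  have hz : z = ∑ i, z (eX (.inl (.inr i))) • p i + (∑ j, y (eY (.inl j)) • w j).1 := by
    rw [← sub_eq_zero, ← sub_sub, sub_right_comm]
    refine hJinj _ (Submodule.sub_mem _ ?_ (Submodule.sum_mem _ fun i _ =>
      Submodule.smul_mem _ _ (hpC i))) ?_
    · rw [mem_tor₂]
      have : (z - (∑ j, y (eY (.inl j)) • w j).1, (0 : κ → K)) =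
          (z, y) - ∑ j, y (eY (.inl j)) • w j := by
        refine Prod.ext rfl ?_
        rw [Prod.snd_sub, ← hy, sub_self]
      rw [this, map_sub]
      exact C.sub_mem hvC hsumC
    · rintro (j | j)
      · simp [Prod.fst_sum, hz0, hp0, hw1]
      · simp [Prod.fst_sum, hp1, hw1, Matrix.one_apply]
  rw [mem_genCode hg]
  refine ⟨fun i => c.1 (eX (.inl (.inl i))), fun i => z (eX (.inl (.inr i))),
    fun j => y (eY (.inl j)), ?_⟩
  rw [← sub_eq_iff_eq_add', ← hv]
  congr 1
  refine Prod.ext ?_ ?_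
  · rw [Prod.fst_add, Prod.fst_sum]
    exact hz
  · rw [Prod.snd_add, ← hy, Prod.snd_sum]
    simp

end StandardGenerators

/-! ### Generator matrices over the mixed alphabet -/

section MixedAlphabet

variable {R : Type*} [CommRing R] {γ : R}

namespace StdGen

variable {N₁ N₂ k₀ k₁ l₀ : ℕ} (S : StdGen γ N₁ N₂ k₀ k₁ l₀)

/-- The rows of the first block. -/
def rowA (i : Fin k₀) : (Fin N₁ → R) × (Fin N₂ → Res γ) := (S.A (.inl i), S.B (.inl i))

/-- The rows of the second block, divided by `γ`. -/
def rowP (i : Fin k₁) (x : Fin N₁) : Res γ :=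
  Sum.elim (Sum.elim 0 ((1 : Matrix (Fin k₁) (Fin k₁) (Res γ)) i))
    (fun j => Ideal.Quotient.mk _ (S.A₁₂ i j)) (S.eX.symm x)

/-- The rows of the third block, with their first part divided by `γ`. -/
def rowW (i : Fin l₀) : (Fin N₁ → Res γ) × (Fin N₂ → Res γ) :=
  (fun x => Sum.elim 0 (fun j => Ideal.Quotient.mk _ (S.C₀₂ i j)) (S.eX.symm x), S.D i)

theorem forall_eX {P : Fin N₁ → Prop} (h₀ : ∀ j, P (S.eX (.inl (.inl j))))
    (h₁ : ∀ j, P (S.eX (.inl (.inr j)))) (h₂ : ∀ j, P (S.eX (.inr j))) (x : Fin N₁) : P x := by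
  obtain ⟨(j | j) | j, rfl⟩ := S.eX.surjective x
  exacts [h₀ j, h₁ j, h₂ j]

theorem forall_eY {P : Fin N₂ → Prop} (h₀ : ∀ j, P (S.eY (.inl j)))
    (h₁ : ∀ j, P (S.eY (.inr j))) (x : Fin N₂) : P x := by
  obtain ⟨j | j, rfl⟩ := S.eY.surjective x
  exacts [h₀ j, h₁ j]

theorem row_p (hγ : γ ^ 2 = 0) (i : Fin k₁) :
    ((S.A (.inr i), S.B (.inr i)) : (Fin N₁ → R) × (Fin N₂ → Res γ)) =
      (fun x => gammaMul γ hγ (S.rowP i x), 0) := by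
  refine Prod.ext (funext (S.forall_eX (fun j => ?_) (fun j => ?_) fun j => ?_))
    (funext (S.forall_eY (fun j => ?_) fun j => ?_))
  · simp [A, rowP]
  · by_cases h : i = j
    · subst h
      have := gammaMul_mk γ hγ 1
      simp_all [A, rowP]
    · simp [A, rowP, h]
  · simp [A, rowP, gammaMul_mk]
  · simp [B]
  · simp [B]

theorem row_w (hγ : γ ^ 2 = 0) (i : Fin l₀) :
    ((S.C i, S.D i) : (Fin N₁ → R) × (Fin N₂ → Res γ)) =
      (fun x => gammaMul γ hγ ((S.rowW i).1 x), (S.rowW i).2) := by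
  refine Prod.ext (funext (S.forall_eX (fun j => ?_) (fun j => ?_) fun j => ?_)) rfl
  · simp [C, rowW]
  · simp [C, rowW]
  · simp [C, rowW, gammaMul_mk]

end StdGen

variable [hmax : (Ideal.span {γ}).IsMaximal]

attribute [local instance] Ideal.Quotient.field

variable {N₁ N₂ k₀ k₁ l₀ : ℕ}

namespace StdGen

variable (S : StdGen γ N₁ N₂ k₀ k₁ l₀)

theorem isStd : IsStd (fun i => S.eX (.inl (.inl i))) (fun i => S.eX (.inl (.inr i)))
    (fun j => S.eY (.inl j)) S.rowA S.rowP S.rowW where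
  a_fst i j := by simp [rowA, A]
  a_snd i j := by simp [rowA, B]
  p_zero i j := by simp [rowP]
  p_one i j := by simp [rowP]
  w_fst₀ i j := by simp [rowW]
  w_fst₁ i j := by simp [rowW]
  w_snd i j := by simp [rowW, D]

theorem code_eq (hγ : γ ^ 2 = 0) :
    S.code = genCode (gammaMul γ hγ) S.rowA S.rowP S.rowW := by
  have h₁ : (fun i => ((S.A i, S.B i) : Ambient γ N₁ N₂)) =
      Sum.elim S.rowA fun i => emb _ _ (gammaMul γ hγ) (S.rowP i, 0) := by
    refine funext ?_
    rintro (i | i)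
    · rfl
    · exact S.row_p hγ i
  have h₂ : (fun j => ((S.C j, S.D j) : Ambient γ N₁ N₂)) =
      fun j => emb _ _ (gammaMul γ hγ) (S.rowW j) := funext (S.row_w hγ)
  rw [code, genCode, h₁, h₂, Set.Sum.elim_range]

theorem codeX_eq (hγ : γ ^ 2 = 0) : S.codeX = genCodeX (gammaMul γ hγ) S.rowA S.rowP := by
  have h : S.A = Sum.elim (fun i => (S.rowA i).1) fun i x => gammaMul γ hγ (S.rowP i x) := by
    refine funext ?_
    rintro (i | i)
    · rfl
    · exact (Prod.ext_iff.1 (S.row_p hγ i)).1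
  rw [codeX, genCodeX, h, Set.Sum.elim_range]

end StdGen

theorem exists_stdGen {m n : ℕ} (eX : (Fin k₀ ⊕ Fin k₁) ⊕ Fin m ≃ Fin N₁)
    (eY : Fin l₀ ⊕ Fin n ≃ Fin N₂) {a : Fin k₀ → (Fin N₁ → R) × (Fin N₂ → Res γ)}
    {p : Fin k₁ → Fin N₁ → Res γ} {w : Fin l₀ → (Fin N₁ → Res γ) × (Fin N₂ → Res γ)}
    (h : IsStd (fun i => eX (.inl (.inl i))) (fun i => eX (.inl (.inr i)))
      (fun j => eY (.inl j)) a p w) :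
    ∃ S : StdGen γ N₁ N₂ k₀ k₁ l₀, S.rowA = a ∧ S.rowP = p ∧ S.rowW = w := by
  -- The blocks `A₁₂` and `C₀₂` occur only multiplied by `γ`, so any lifts of the residue entries
  -- will do.
  choose f hf using Ideal.Quotient.mk_surjective (I := Ideal.span {γ})
  let S : StdGen γ N₁ N₂ k₀ k₁ l₀ :=
    { m := m
      n := n
      eX := eX
      eY := eY
      A₀₁ := fun i j => (a i).1 (eX (.inl (.inr j)))
      A₀₂ := fun i j => (a i).1 (eX (.inr j))
      A₁₂ := fun i j => f (p i (eX (.inr j)))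
      B₀₁ := fun i j => (a i).2 (eY (.inr j))
      C₀₂ := fun i j => f ((w i).1 (eX (.inr j)))
      D₀₁ := fun i j => (w i).2 (eY (.inr j)) }
  refine ⟨S, funext fun i => Prod.ext (funext (S.forall_eX (fun j => ?_) (fun j => ?_)
    fun j => ?_)) (funext (S.forall_eY (fun j => ?_) fun j => ?_)),
    funext fun i => funext (S.forall_eX (fun j => ?_) (fun j => ?_) fun j => ?_),
    funext fun i => Prod.ext (funext (S.forall_eX (fun j => ?_) (fun j => ?_) fun j => ?_))
      (funext (S.forall_eY (fun j => ?_) fun j => ?_))⟩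
  · rw [S.isStd.a_fst, ← h.a_fst]
  · simp [StdGen.rowA, StdGen.A, S]
    rfl
  · simp [StdGen.rowA, StdGen.A, S]
    rfl
  · rw [S.isStd.a_snd, ← h.a_snd i j]
  · simp [StdGen.rowA, StdGen.B, S]
    rfl
  · rw [S.isStd.p_zero, ← h.p_zero i j]
  · rw [S.isStd.p_one, ← h.p_one i j]
  · simp [StdGen.rowP, S, hf]
  · rw [S.isStd.w_fst₀, ← h.w_fst₀ i j]
  · rw [S.isStd.w_fst₁, ← h.w_fst₁ i j]
  · simp [StdGen.rowW, S, hf]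
  · rw [S.isStd.w_snd, ← h.w_snd i j]
  · simp [StdGen.rowW, StdGen.D, S]
    rfl

variable {hγ : γ ^ 2 = 0} (hg : IsSocleEmbedding (gammaMul γ hγ))
include hg

/-- The identity blocks give the dimensions of the torsion codes, and generators in standard form
exist for any code with these dimensions. In particular the type of a code is unique. -/
theorem hasType_iff (C : Submodule R (Ambient γ N₁ N₂)) :
    HasType C k₀ k₁ l₀ ↔ Module.finrank (Res γ) (tor₁ hg C) = k₀ ∧
      Module.finrank (Res γ) (tor₂ hg C) = k₀ + k₁ ∧
        Module.finrank (Res γ) (tor₃ hg C) = l₀ := by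
  constructor
  · rintro ⟨S, rfl⟩
    rw [S.code_eq hγ]
    exact ⟨S.isStd.finrank_tor₁ hg, S.isStd.finrank_tor₂ hg, S.isStd.finrank_tor₃ hg⟩
  · rintro ⟨h₀, h₁, h₂⟩
    obtain ⟨m, n, eX, eY, a, p, w, h, hC⟩ := exists_standard_generators hg C h₀ h₁ h₂
    obtain ⟨S, rfl, rfl, rfl⟩ := exists_stdGen eX eY h
    exact ⟨S, (S.code_eq hγ).trans hC⟩

theorem torsion_one_codeX (S : StdGen γ N₁ N₂ k₀ k₁ l₀) :
    torsion γ 1 S.codeX = (tor₁ hg S.code : Set (Fin N₁ → Res γ)) := by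
  ext x
  rw [S.code_eq hγ, S.codeX_eq hγ, SetLike.mem_coe, mem_tor₁_iff_genCodeX hg]
  simp only [torsion, Nat.sub_self, pow_zero, one_smul]
  rfl

theorem torsion_two_codeX (S : StdGen γ N₁ N₂ k₀ k₁ l₀) :
    torsion γ 2 S.codeX = (tor₂ hg S.code : Set (Fin N₁ → Res γ)) := by
  ext x
  have key : ∀ c : Fin N₁ → R, (∀ j, Ideal.Quotient.mk (Ideal.span {γ}) (c j) = x j) →
      γ ^ (2 - 1) • c = fun i => gammaMul γ hγ (x i) := by
    intro c hc
    ext j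
    rw [← hc, gammaMul_mk]
    simp
  rw [S.code_eq hγ, S.codeX_eq hγ, SetLike.mem_coe, S.isStd.mem_tor₂_iff_genCodeX hg]
  constructor
  · rintro ⟨c, hc, hcX⟩
    rwa [key c hc] at hcX
  · intro hx
    choose c hc using fun j => Ideal.Quotient.mk_surjective (x j)
    refine ⟨c, hc, ?_⟩
    rwa [key c hc]

/-- The torsion codes read off a generator matrix agree with the intrinsic ones, so they do not
depend on the matrix, and a matrix always exists. -/
theorem hasTorsionCodes_iff (C : Submodule R (Ambient γ N₁ N₂))
    (C₁ C₂ : Submodule (Res γ) (Fin N₁ → Res γ)) (C₃ : Submodule (Res γ) (Fin N₂ → Res γ)) :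
    HasTorsionCodes C C₁ C₂ C₃ ↔ tor₁ hg C = C₁ ∧ tor₂ hg C = C₂ ∧ tor₃ hg C = C₃ := by
  have key : ∀ (k₀ k₁ l₀ : ℕ) (S : StdGen γ N₁ N₂ k₀ k₁ l₀), tor₃ hg S.code = S.codeY := by
    intro k₀ k₁ l₀ S
    rw [S.code_eq hγ, S.isStd.tor₃_genCode hg]
    rfl
  constructor
  · rintro ⟨k₀, k₁, l₀, S, rfl, h₁, h₂, rfl⟩
    rw [torsion_one_codeX hg] at h₁
    rw [torsion_two_codeX hg] at h₂
    exact ⟨SetLike.coe_injective h₁, SetLike.coe_injective h₂, key _ _ _ S⟩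
  · rintro ⟨rfl, rfl, rfl⟩
    have h := Submodule.finrank_mono (tor₁_le_tor₂ hg (C := C))
    obtain ⟨S, hS⟩ := (hasType_iff hg C).2 ⟨rfl, (Nat.add_sub_cancel' h).symm, rfl⟩
    exact ⟨_, _, _, S, hS, by rw [torsion_one_codeX hg, hS], by rw [torsion_two_codeX hg, hS],
      by rw [← key, hS]⟩

end MixedAlphabet

/-! ### Chain rings of nilpotency index two -/

section ChainRing

variable {R : Type*} [CommRing R] {γ : R}

theorem ringChar_res_ne_two [Nontrivial (Res γ)] (hodd : Odd (ringChar R)) :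
    ringChar (Res γ) ≠ 2 := by
  intro h
  have h1 : ringChar (Res γ) ∣ ringChar R := ringChar.dvd (by
    rw [← map_natCast (Ideal.Quotient.mk (Ideal.span {γ})), CharP.cast_eq_zero, map_zero])
  rw [h] at h1
  exact (Nat.not_even_iff_odd.2 hodd) (even_iff_two_dvd.2 h1)

variable [IsLocalRing R]

/-- Injectivity is where locality and `γ ≠ 0` are needed: a unit cannot annihilate `γ`, so the
annihilator of `γ` lies in the maximal ideal. -/
theorem isSocleEmbedding_gammaMul (hm : IsLocalRing.maximalIdeal R = Ideal.span {γ})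
    (hγ0 : γ ≠ 0) (hγ : γ ^ 2 = 0) : IsSocleEmbedding (gammaMul γ hγ) where
  surjective := Ideal.Quotient.mk_surjective
  injective := by
    rw [injective_iff_map_eq_zero]
    intro a ha
    obtain ⟨x, rfl⟩ := Ideal.Quotient.mk_surjective a
    rw [gammaMul_mk] at ha
    rw [Ideal.Quotient.eq_zero_iff_mem, ← hm, IsLocalRing.mem_maximalIdeal, mem_nonunits_iff]
    intro hx
    exact hγ0 ((hx.mul_left_eq_zero).1 ha)
  exact_iff x := by
    change Ideal.Quotient.mk _ x = 0 ↔ _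
    rw [Ideal.Quotient.eq_zero_iff_mem, Ideal.mem_span_singleton']
    constructor
    · rintro ⟨a, rfl⟩
      exact ⟨Ideal.Quotient.mk _ a, by rw [gammaMul_mk, mul_comm]⟩
    · rintro ⟨k, rfl⟩
      obtain ⟨a, rfl⟩ := Ideal.Quotient.mk_surjective k
      exact ⟨a, by rw [gammaMul_mk, mul_comm]⟩

attribute [local instance] Ideal.Quotient.field

theorem mixed_counts [Finite R] (hm : IsLocalRing.maximalIdeal R = Ideal.span {γ})
    (hγ0 : γ ≠ 0) (hγ : γ ^ 2 = 0) (hodd : Odd (ringChar R)) (N₁ N₂ : ℕ) :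
    ((Nat.card {C : Submodule R (Ambient γ N₁ N₂) // IsSelfOrthogonal γ hγ C} : ℝ) =
        ∑ k₀ ∈ Finset.range (N₁ / 2 + 1), ∑ k₁ ∈ Finset.range (N₁ - 2 * k₀ + 1),
          ∑ l₀ ∈ Finset.range (N₂ / 2 + 1), sigma (Res γ) N₁ k₀ * sigma (Res γ) N₂ l₀ *
            gaussBinom (Nat.card (Res γ)) (N₁ - 2 * k₀) k₁ *
            (Nat.card (Res γ) : ℝ) ^ Theta N₁ N₂ k₀ k₁ l₀) ∧
    (∀ k₀ k₁ l₀ : ℕ, (Nat.card {C : Submodule R (Ambient γ N₁ N₂) //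
          IsSelfOrthogonal γ hγ C ∧ HasType C k₀ k₁ l₀} : ℝ) =
        if 2 * k₀ + k₁ ≤ N₁ ∧ 2 * l₀ ≤ N₂ then
          sigma (Res γ) N₁ k₀ * sigma (Res γ) N₂ l₀ *
            gaussBinom (Nat.card (Res γ)) (N₁ - 2 * k₀) k₁ *
            (Nat.card (Res γ) : ℝ) ^ Theta N₁ N₂ k₀ k₁ l₀
        else 0) ∧
    (∀ (k₀ k₁ l₀ : ℕ) (C₁ C₂ : Submodule (Res γ) (Fin N₁ → Res γ))
        (C₃ : Submodule (Res γ) (Fin N₂ → Res γ)),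
      Module.finrank (Res γ) C₁ = k₀ → Module.finrank (Res γ) C₂ = k₀ + k₁ →
      Module.finrank (Res γ) C₃ = l₀ → C₁ ≤ C₂ →
      (C₁ : Set (Fin N₁ → Res γ)) ⊆ fieldDual C₁ → (C₂ : Set (Fin N₁ → Res γ)) ⊆ fieldDual C₁ →
      (C₃ : Set (Fin N₂ → Res γ)) ⊆ fieldDual C₃ →
      (Nat.card {C : Submodule R (Ambient γ N₁ N₂) //
          IsSelfOrthogonal γ hγ C ∧ HasTorsionCodes C C₁ C₂ C₃} : ℝ) =
        (Nat.card (Res γ) : ℝ) ^ Theta N₁ N₂ k₀ k₁ l₀) := by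
  have hmax : (Ideal.span {γ}).IsMaximal := hm ▸ IsLocalRing.maximalIdeal.isMaximal R
  have hfin : Finite (Res γ) := Quotient.finite _
  have hg := isSocleEmbedding_gammaMul hm hγ0 hγ
  have hK := ringChar_res_ne_two (γ := γ) hodd
  have hso : ∀ C : Submodule R (Ambient γ N₁ N₂),
      IsSelfOrthogonal γ hγ C ↔ IsSelfOrth (gammaMul γ hγ) C := fun _ => Iff.rfl
  refine ⟨?_, fun k₀ k₁ l₀ => ?_, ?_⟩
  · have h := card_codes (ι := Fin N₁) (κ := Fin N₂) hg hK
    simp only [Fintype.card_fin] at h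
    exact h
  · have h := card_codes_type (ι := Fin N₁) (κ := Fin N₂) hg hK k₀ k₁ l₀
    simp only [Fintype.card_fin] at h
    rw [← h]
    congr 1
    exact Nat.card_congr (Equiv.subtypeEquivRight fun C =>
      and_congr (hso C) (hasType_iff hg C))
  · rintro k₀ k₁ l₀ C₁ C₂ C₃ rfl h₂ rfl h₁₂ - h₂₁ h₃
    have h := card_codes_torsion (R := R) hg hK C₁ C₂ C₃ h₁₂ h₂₁ h₃
    rw [h₂, Nat.add_sub_cancel_left, Fintype.card_fin, Fintype.card_fin] at h
    rw [← h]
    congr 1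
    exact Nat.card_congr (Equiv.subtypeEquivRight fun C =>
      and_congr (hso C) (hasTorsionCodes_iff hg C C₁ C₂ C₃))

end ChainRing

/-! ### The chain ring `ℤ/p²` -/

section PrimeSquare

variable (p : ℕ)

/-- The carry in adding representatives is a multiple of `n`, which `c` kills. It yields the
additivity of both `mulP` and the coordinate expansion. -/
theorem cast_val_add_mul {S : Type*} [CommRing S] {n : ℕ} [NeZero n] {c : S} (hc : (n : S) * c = 0)
    (a b : ZMod n) : ((a + b).val : S) * c = (a.val : S) * c + (b.val : S) * c := by
  have h := congrArg (Nat.cast (R := S)) (Nat.mod_add_div (a.val + b.val) n)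
  rw [← ZMod.val_add] at h
  push_cast at h
  linear_combination c * h - ((a.val + b.val) / n : ℕ) * hc

/-- The residue field of `ℤ/p²` as an algebra. -/
abbrev algebraResidue : Algebra (ZMod (p ^ 2)) (ZMod p) :=
  (ZMod.castHom (dvd_pow_self p two_ne_zero) (ZMod p)).toAlgebra

attribute [local instance] algebraResidue

variable [Fact p.Prime]

/-- Multiplication by `p`, as a map from `ℤ/p` to `ℤ/p²`. -/
def mulP : ZMod p →ₗ[ZMod (p ^ 2)] ZMod (p ^ 2) :=
  (AddMonoidHom.mk' (fun a : ZMod p => (a.val : ZMod (p ^ 2)) * (p : ZMod (p ^ 2))) fun a b =>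
    cast_val_add_mul (by
      rw [← Nat.cast_mul, ← pow_two]
      exact ZMod.natCast_self _) a b).toZModLinearMap (p ^ 2)

theorem mulP_apply (a : ZMod p) : mulP p a = (a.val : ZMod (p ^ 2)) * (p : ZMod (p ^ 2)) := rfl

theorem mulP_eq_natCast (a : ZMod p) : mulP p a = ((a.val * p : ℕ) : ZMod (p ^ 2)) := by
  rw [mulP_apply, Nat.cast_mul]

theorem val_mulP (a : ZMod p) : (mulP p a).val = p * a.val := by
  have hp := (Fact.out : p.Prime).pos
  rw [mulP_eq_natCast, ZMod.val_natCast, Nat.mod_eq_of_lt, mul_comm]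
  rw [pow_two]
  exact Nat.mul_lt_mul_of_pos_right a.val_lt hp

theorem isSocleEmbedding_mulP : IsSocleEmbedding (mulP p) where
  surjective := ZMod.castHom_surjective _
  injective a b h := by
    have h1 := congrArg ZMod.val h
    rw [val_mulP, val_mulP] at h1
    exact ZMod.val_injective p (Nat.eq_of_mul_eq_mul_left (Fact.out : p.Prime).pos h1)
  exact_iff x := by
    have hp := (Fact.out : p.Prime).ne_zero
    have : NeZero (p ^ 2) := ⟨pow_ne_zero 2 hp⟩
    change ZMod.castHom (dvd_pow_self p two_ne_zero) (ZMod p) x = 0 ↔ _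
    constructor
    · intro h
      rw [ZMod.castHom_apply, ZMod.cast_eq_val, ZMod.natCast_eq_zero_iff] at h
      obtain ⟨k, hk⟩ := h
      have hlt := x.val_lt
      rw [hk, pow_two] at hlt
      refine ⟨k, ?_⟩
      rw [mulP_eq_natCast, ZMod.val_natCast, Nat.mod_eq_of_lt (Nat.lt_of_mul_lt_mul_left hlt),
        mul_comm, ← hk, ZMod.natCast_zmod_val]
    · rintro ⟨k, rfl⟩
      rw [mulP_apply, map_mul, map_natCast, map_natCast, ZMod.natCast_self, mul_zero]

end PrimeSquare

/-! ### Additive codes over Eisenstein extensions -/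

namespace EisensteinData

variable {p r k t : ℕ} (E : EisensteinData p r k t)

theorem natCast_sq : ((p ^ 2 : ℕ) : E.ChainRing) = 0 := by
  have h := congrArg (fun a => Ideal.Quotient.mk (Ideal.span {E.g, C (p : E.GR) * X ^ t}) (C a))
    E.natCast_p_mul_p
  simpa [pow_two] using h

theorem natCast_mul_y_pow (j : ℕ) : (p : E.ChainRing) * E.y ^ (t + j) = 0 := by
  have h : Ideal.Quotient.mk (Ideal.span {E.g, C (p : E.GR) * X ^ t})
      (C (p : E.GR) * X ^ t) = 0 :=
    Ideal.Quotient.eq_zero_iff_mem.2 (Ideal.subset_span (by simp))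
  rw [pow_add, ← mul_assoc]
  have h' : (p : E.ChainRing) * E.y ^ t = 0 := by
    simpa [y] using h
  rw [h', zero_mul]

variable [Fact p.Prime]

/-- Carries vanish: they are multiples of `p² = 0` in the low coordinates, and multiples of `p`
times `y^(t+j)`, again zero, in the high ones. -/
theorem expand_add (u v : Coord p r k t) : E.expand (u + v) = E.expand u + E.expand v := by
  have hp := (Fact.out : p.Prime).ne_zero
  have : NeZero (p ^ 2) := ⟨pow_ne_zero 2 hp⟩
  have h₁ : ∀ (c : E.ChainRing) (a b : ZMod (p ^ 2)),
      ((a + b).val : E.ChainRing) * c = a.val * c + b.val * c := fun c =>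
    cast_val_add_mul (by rw [natCast_sq, zero_mul])
  have h₂ : ∀ (j : ℕ) (c : E.ChainRing) (a b : ZMod p),
      ((a + b).val : E.ChainRing) * (c * E.y ^ (t + j)) =
        a.val * (c * E.y ^ (t + j)) + b.val * (c * E.y ^ (t + j)) := fun j c =>
    cast_val_add_mul (by rw [mul_left_comm, natCast_mul_y_pow, mul_zero])
  rw [expand, expand, expand, add_add_add_comm, ← Finset.sum_add_distrib,
    ← Finset.sum_add_distrib]
  congr 1
  · refine Finset.sum_congr rfl fun i _ => ?_
    rw [← Finset.sum_add_distrib]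
    refine Finset.sum_congr rfl fun s _ => ?_
    rw [mul_assoc, mul_assoc, mul_assoc, ← h₁]
    rfl
  · refine Finset.sum_congr rfl fun i _ => ?_
    rw [← Finset.sum_add_distrib]
    refine Finset.sum_congr rfl fun s _ => ?_
    rw [mul_assoc, mul_assoc, mul_assoc, ← h₂]
    rfl

/-- The coordinate map is additive. -/
noncomputable def psiAdd : E.ChainRing ≃+ Coord p r k t :=
  (AddEquiv.ofBijective (AddMonoidHom.mk' E.expand E.expand_add) E.expand_bijective).symm

theorem psiAdd_apply (a : E.ChainRing) : E.psiAdd a = E.psi a := by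
  rw [psiAdd, AddEquiv.symm_apply_eq]
  exact (Equiv.apply_symm_apply (Equiv.ofBijective _ E.expand_bijective) a).symm

/-- The coordinates of a word. -/
noncomputable def psiWord (N : ℕ) : (Fin N → E.ChainRing) ≃+
    (Fin N × (Fin t × Fin r) → ZMod (p ^ 2)) × (Fin N × (Fin (k - t) × Fin r) → ZMod p) where
  toFun c := (fun x => (E.psiAdd (c x.1)).1 x.2, fun x => (E.psiAdd (c x.1)).2 x.2)
  invFun u := fun l => E.psiAdd.symm (fun x => u.1 (l, x), fun x => u.2 (l, x))
  left_inv c := by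
    ext l
    exact E.psiAdd.symm_apply_apply (c l)
  right_inv u := by
    ext <;> simp
  map_add' c d := by
    ext <;> simp

attribute [local instance] algebraResidue

/-- The product of characters is the additive character `a ↦ ξ^a` of `ℤ/p²` at the mixed form; the
factors `ξ^p` match multiplication by `p` on the second block. Primitivity of `ξ` makes the value
`1` equivalent to a zero form. -/
theorem prod_chi {ξ : ℂ} (hξ : IsPrimitiveRoot ξ (p ^ 2)) {N : ℕ} (d c : Fin N → E.ChainRing) :
    ∏ l, E.chi ξ (d l) (c l) = 1 ↔ form (mulP p) (E.psiWord N d) (E.psiWord N c) = 0 := by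
  have hp := (Fact.out : p.Prime).ne_zero
  have : NeZero (p ^ 2) := ⟨pow_ne_zero 2 hp⟩
  let e := AddChar.zmodChar (p ^ 2) hξ.pow_eq_one
  have he : ∀ a, e a = ξ ^ a.val := AddChar.zmodChar_apply hξ.pow_eq_one
  have hsum : ∀ {α : Type} (s : Finset α) (f : α → ZMod (p ^ 2)),
      e (∑ i ∈ s, f i) = ∏ i ∈ s, e (f i) := fun s f =>
    map_prod e.toMonoidHom (fun i => Multiplicative.ofAdd (f i)) s
  have h : ∏ l, E.chi ξ (d l) (c l) = e (form (mulP p) (E.psiWord N d) (E.psiWord N c)) := by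
    rw [form, AddChar.map_add_eq_mul, dotProduct, dotProduct, map_sum (mulP p),
      hsum, hsum, Fintype.prod_prod_type,
      Fintype.prod_prod_type, ← Finset.prod_mul_distrib]
    refine Finset.prod_congr rfl fun l _ => ?_
    simp only [chi, ← psiAdd_apply, he, val_mulP, pow_mul]
    rfl
  rw [h, he, hξ.pow_eq_one_iff_dvd, ← ZMod.natCast_eq_zero_iff, ZMod.natCast_zmod_val]

theorem card_self_orthogonal (hp2 : p ≠ 2) {ξ : ℂ} (hξ : IsPrimitiveRoot ξ (p ^ 2)) (N : ℕ) :
    (Nat.card {C : AddSubgroup (Fin N → E.ChainRing) //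
        (C : Set (Fin N → E.ChainRing)) ⊆ E.chiDual ξ C} : ℝ) =
      ∑ k₀ ∈ Finset.range (N * r * t / 2 + 1),
        ∑ k₁ ∈ Finset.range (N * r * t - 2 * k₀ + 1),
          ∑ l₀ ∈ Finset.range (N * r * (k - t) / 2 + 1),
            sigma (ZMod p) (N * r * t) k₀ * sigma (ZMod p) (N * r * (k - t)) l₀ *
              gaussBinom p (N * r * t - 2 * k₀) k₁ *
              (p : ℝ) ^ ((k₀ : ℝ) * ((N : ℝ) * r * k - 3 / 2 * k₀ - k₁ - l₀ - 1 / 2) +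
                (l₀ : ℝ) * ((N : ℝ) * r * t - 2 * k₀ - k₁)) := by
  have hp := (Fact.out : p.Prime).ne_zero
  have : NeZero (p ^ 2) := ⟨pow_ne_zero 2 hp⟩
  have hK : ringChar (ZMod p) ≠ 2 := by rwa [ZMod.ringChar_zmod_n]
  have hcard : Nat.card {C : AddSubgroup (Fin N → E.ChainRing) //
        (C : Set (Fin N → E.ChainRing)) ⊆ E.chiDual ξ C} =
      Nat.card {C : Submodule (ZMod (p ^ 2)) ((Fin N × (Fin t × Fin r) → ZMod (p ^ 2)) ×
        (Fin N × (Fin (k - t) × Fin r) → ZMod p)) // IsSelfOrth (mulP p) C} := by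
    -- Only the additive structure matters: in coordinates, every additive subgroup is a
    -- `ℤ/p²`-submodule.
    refine Nat.card_congr (((AddEquiv.mapAddSubgroup (E.psiWord N)).toEquiv.trans
      (AddSubgroup.toZModSubmodule (p ^ 2)).toEquiv).subtypeEquiv fun C => ?_)
    constructor
    · rintro h _ ⟨d, hd, rfl⟩ _ ⟨c, hc, rfl⟩
      exact (E.prod_chi hξ d c).1 (h hd c hc)
    · intro h d hd c hc
      exact (E.prod_chi hξ d c).2 (h _ ⟨d, hd, rfl⟩ _ ⟨c, hc, rfl⟩)
  have h₁ : Fintype.card (Fin N × (Fin t × Fin r)) = N * r * t := by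
    simp only [Fintype.card_prod, Fintype.card_fin]
    ring
  have h₂ : Fintype.card (Fin N × (Fin (k - t) × Fin r)) = N * r * (k - t) := by
    simp only [Fintype.card_prod, Fintype.card_fin]
    ring
  have h := card_codes (ι := Fin N × (Fin t × Fin r)) (κ := Fin N × (Fin (k - t) × Fin r))
    (isSocleEmbedding_mulP p) hK
  rw [hcard, h, h₁, h₂, Nat.card_zmod]
  refine Finset.sum_congr rfl fun k₀ _ => Finset.sum_congr rfl fun k₁ _ =>
    Finset.sum_congr rfl fun l₀ _ => ?_
  congr 2
  rw [Theta]
  -- The block lengths add up to `N r t + N r (k - t) = N r k`, which needs `t ≤ k`.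
  push_cast [Nat.cast_sub E.t_le_k]
  ring

end EisensteinData

end MixedCodes

theorem theorem4p3 :
    -- codes over the mixed alphabet of a chain ring of odd characteristic and nilpotency index 2
    -- and its residue field
    (∀ (R : Type*) [CommRing R] [IsLocalRing R] [Finite R] (γ : R)
        (_ : IsLocalRing.maximalIdeal R = Ideal.span {γ}) (_ : γ ≠ 0) (hγ : γ ^ 2 = 0)
        (_ : Odd (ringChar R)) (q : ℕ) (_ : q = Nat.card (MixedCodes.Res γ)) (N₁ N₂ : ℕ),
      -- number of self-orthogonal codes
      ((Nat.card {C : Submodule R (MixedCodes.Ambient γ N₁ N₂) //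
            MixedCodes.IsSelfOrthogonal γ hγ C} : ℝ) =
          ∑ k₀ ∈ Finset.range (N₁ / 2 + 1), ∑ k₁ ∈ Finset.range (N₁ - 2 * k₀ + 1),
            ∑ l₀ ∈ Finset.range (N₂ / 2 + 1),
              MixedCodes.sigma (MixedCodes.Res γ) N₁ k₀ *
                MixedCodes.sigma (MixedCodes.Res γ) N₂ l₀ *
                MixedCodes.gaussBinom q (N₁ - 2 * k₀) k₁ *
                (q : ℝ) ^ MixedCodes.Theta N₁ N₂ k₀ k₁ l₀) ∧
      -- number of self-orthogonal codes of a given type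
      (∀ k₀ k₁ l₀ : ℕ,
        (Nat.card {C : Submodule R (MixedCodes.Ambient γ N₁ N₂) //
            MixedCodes.IsSelfOrthogonal γ hγ C ∧ MixedCodes.HasType C k₀ k₁ l₀} : ℝ) =
          if 2 * k₀ + k₁ ≤ N₁ ∧ 2 * l₀ ≤ N₂ then
            MixedCodes.sigma (MixedCodes.Res γ) N₁ k₀ *
              MixedCodes.sigma (MixedCodes.Res γ) N₂ l₀ *
              MixedCodes.gaussBinom q (N₁ - 2 * k₀) k₁ *
              (q : ℝ) ^ MixedCodes.Theta N₁ N₂ k₀ k₁ l₀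
          else 0) ∧
      -- number of self-orthogonal codes with given torsion codes
      (∀ (k₀ k₁ l₀ : ℕ)
          (C₁ C₂ : Submodule (MixedCodes.Res γ) (Fin N₁ → MixedCodes.Res γ))
          (C₃ : Submodule (MixedCodes.Res γ) (Fin N₂ → MixedCodes.Res γ)),
        Module.finrank (MixedCodes.Res γ) C₁ = k₀ →
        Module.finrank (MixedCodes.Res γ) C₂ = k₀ + k₁ →
        Module.finrank (MixedCodes.Res γ) C₃ = l₀ →
        C₁ ≤ C₂ →
        (C₁ : Set (Fin N₁ → MixedCodes.Res γ)) ⊆ MixedCodes.fieldDual C₁ →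
        (C₂ : Set (Fin N₁ → MixedCodes.Res γ)) ⊆ MixedCodes.fieldDual C₁ →
        (C₃ : Set (Fin N₂ → MixedCodes.Res γ)) ⊆ MixedCodes.fieldDual C₃ →
        (Nat.card {C : Submodule R (MixedCodes.Ambient γ N₁ N₂) //
            MixedCodes.IsSelfOrthogonal γ hγ C ∧ MixedCodes.HasTorsionCodes C C₁ C₂ C₃} : ℝ) =
          (q : ℝ) ^ MixedCodes.Theta N₁ N₂ k₀ k₁ l₀)) ∧
    -- self-orthogonal additive codes over the Eisenstein extensions of `GR(p², r)`
    (∀ (p r k t : ℕ) [Fact p.Prime] (_ : p ≠ 2) (E : MixedCodes.EisensteinData p r k t)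
        (ξ : ℂ) (_ : IsPrimitiveRoot ξ (p ^ 2)) (N : ℕ),
      (Nat.card {C : AddSubgroup (Fin N → E.ChainRing) //
            (C : Set (Fin N → E.ChainRing)) ⊆ E.chiDual ξ C} : ℝ) =
        ∑ k₀ ∈ Finset.range (N * r * t / 2 + 1),
          ∑ k₁ ∈ Finset.range (N * r * t - 2 * k₀ + 1),
            ∑ l₀ ∈ Finset.range (N * r * (k - t) / 2 + 1),
              MixedCodes.sigma (ZMod p) (N * r * t) k₀ *
                MixedCodes.sigma (ZMod p) (N * r * (k - t)) l₀ *
                MixedCodes.gaussBinom p (N * r * t - 2 * k₀) k₁ *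
                (p : ℝ) ^ ((k₀ : ℝ) * ((N : ℝ) * r * k - 3 / 2 * k₀ - k₁ - l₀ - 1 / 2) +
                  (l₀ : ℝ) * ((N : ℝ) * r * t - 2 * k₀ - k₁))) := by
  refine ⟨?_, fun p r k t _ hp E ξ hξ N => E.card_self_orthogonal hp hξ N⟩
  rintro R _ _ _ γ hm hγ0 hγ hodd q rfl N₁ N₂
  exact MixedCodes.mixed_counts hm hγ0 hγ hodd N₁ N₂
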